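/- **Setting.** Let $\mathbb F_q$ be a finite field of characteristic $p$, $q=p^a$, $m=q-1$, and $1\le n<m$, $0\le \ell\le n/2$. For each $y\in\mathbb F_q^*$ let $F_y\subset\mathbb F_q$ be an arbitrary subset, neither empty nor all of $\mathbb F_q$. The Optimal Polynomial Intersection (OPI) problem asks for $x\in\mathbb F_q^n$ such that the polynomial $Q_x(z)=\sum_{j<n}x_jz^j$ satisfies as many of the constraints $Q_x(y)\in F_y$ as possible. Let $f_y=+1$ on $F_y$ and $-1$ off $F_y$, let $f(x)=\sum_y f_y(Q_x(y))$, let $g_y=(f_y-\bar f_y)/c_y$ with $\bar f_y$ the mean of $f_y$ and $c_y>0$ such that $\sum_z g_y(z)^2=1$, and let $\hat g_y(e)=q^{-1/2}\sum_z\chi(ez)g_y(z)$ with $\chi(z)=e^{2\pi i\,\mathrm{Tr}(z)/p}$. Let $B$ be the $m\times n$ matrix $(y^j)_{y,j}$. Field elements are stored in $a\lceil\log_2p\rceil$ bits, through their coordinates in any fixed $\mathbb F_p$-basis. Given weights $w_0,\dots,w_\ell\in\mathbb C$ with $\sum_k|w_k|^2=1$, Decoded Quantum Interferometry (DQI) consists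 of the following stages: (1) prepare $\sum_k w_k\binom mk^{-1/2}\sum_{|S|=k}|S\rangle$; (2) apply to the flag of each $y$ the constraint-encoding gate $G_y|0\rangle=|0\rangle$, $G_y|1\rangle=\sum_{e\ne0}\hat g_y(e)|e\rangle$, and compute the syndrome, $|e\rangle|s\rangle\mapsto|e\rangle|s+B^Te\rangle$; (3) reversibly decode, $|e\rangle|B^Te\rangle\mapsto|0\rangle|B^Te\rangle$ for all $e$ with at most $\ell$ nonzero entries; (4) apply the inverse quantum Fourier transform over $\mathbb F_q^n$. It prepares $$|\psi_w\rangle=\sum_{x\in\mathbb F_q^n}\ \sum_{k=0}^{\ell}\frac{w_k}{\sqrt{q^{n-k}\binom mk}}\ \sum_{|S|=k}\ \prod_{y\in S}g_y(Q_x(y))\ |x\rangle .$$ **Statement.** There are absolute constants $C,\kappa$ such that, for all the data above: 1. DQI is implemented exactly, ancillas returning to $|0\rangle$, by a quantum circuit of at most $C\,m^2\lfloor\log_2m\rfloor^{\kappa}=\widetilde O(m^2)$ elementary gates (one-qubit unitaries, CNOT, Toffoli). In this circuit each of the $m$ constraint-encoding gates $G_y$ is implemented with at most $C\,m\lfloor\log_2m\rfloor^{\kappa}=\widetilde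 O(m)$ gates, which gives the $m\cdot\widetilde O(m)$ of the total, and all other gates together number at most $C\,mn\lfloor\log_2m\rfloor^{\kappa}=\widetilde O(mn)$. 2. If all $F_y$ have the same size (for example in the balanced case), then the prepared states are the states $\sum_xP(f(x))|x\rangle$: every $|\psi_w\rangle$ is of this form for a polynomial $P\in\mathbb C[X]$ of degree at most $\ell$, and every $P$ of degree at most $\ell$ with $\sum_x|P(f(x))|^2=1$ arises from some $w$ with $\sum_k|w_k|^2=1$. -/

import Mathlib

open scoped BigOperators

noncomputable section

namespace DQI

/-! ### Quantum circuits over one-qubit gates, CNOT and Toffoli -/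

/-- A (not necessarily normalized) pure state of the qubits labelled by `W`: one complex amplitude
for each computational basis state. -/
abbrev QState (W : Type*) := (W → Bool) → ℂ

open Classical in
/-- The computational basis state `|s⟩`. -/
def ket {W : Type*} (s : W → Bool) : QState W := fun t => if t = s then 1 else 0

/-- Elementary gates: an arbitrary one-qubit unitary, CNOT, and Toffoli. -/
inductive Gate (W : Type*) where
  | one (U : Matrix.unitaryGroup Bool ℂ) (i : W) : Gate W
  | cnot (c t : W) (h : c ≠ t) : Gate W
  | toffoli (c₁ c₂ t : W) (h : c₁ ≠ c₂) (h₁ : c₁ ≠ t) (h₂ : c₂ ≠ t) : Gate W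

open Classical in
/-- The action of a gate on a state. CNOT and Toffoli are permutations of the basis states equal to
their own inverses, so they act on amplitudes by substitution. -/
def Gate.apply {W : Type*} : Gate W → QState W → QState W
  | .one U i, ψ => fun s => ∑ b : Bool, (U : Matrix Bool Bool ℂ) (s i) b * ψ (Function.update s i b)
  | .cnot c t _, ψ => fun s => ψ (Function.update s t (xor (s t) (s c)))
  | .toffoli c₁ c₂ t _ _ _, ψ => fun s => ψ (Function.update s t (xor (s t) (s c₁ && s c₂)))

/-- The same gate on relabelled qubits. -/
def Gate.relabel {W W' : Type*} (f : W ↪ W') : Gate W → Gate W'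
  | .one U i => .one U (f i)
  | .cnot c t h => .cnot (f c) (f t) (f.injective.ne h)
  | .toffoli c₁ c₂ t h h₁ h₂ =>
      .toffoli (f c₁) (f c₂) (f t) (f.injective.ne h) (f.injective.ne h₁) (f.injective.ne h₂)

/-- A circuit is a list of gates, the head being applied first; its cost is its length. -/
abbrev Circuit (W : Type*) := List (Gate W)

/-- Run a circuit on a state. -/
def Circuit.run {W : Type*} (c : Circuit W) (ψ : QState W) : QState W :=
  c.foldl (fun φ g => g.apply φ) ψ

/-- The same circuit on relabelled qubits. -/
def Circuit.relabel {W W' : Type*} (f : W ↪ W') (c : Circuit W) : Circuit W' :=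
  c.map (Gate.relabel f)

/-! ### The finite field, its binary encoding and its Fourier transform -/

section Field

variable {p : ℕ} [Fact p.Prime] {F : Type*} [Field F] [Fintype F] [DecidableEq F]
  [Algebra (ZMod p) F] {a : ℕ}

/-- The qubits of one field symbol of `𝔽_q`, `q = p ^ a`: `a` coordinates over `𝔽_p`, each written in
`⌈log₂ p⌉` bits. -/
abbrev Sym (p a : ℕ) := Fin a × Fin (Nat.clog 2 p)

/-- Binary encoding of a field element: bit `j` of the `i`-th coordinate in the basis `β`. -/
def enc (β : Module.Basis (Fin a) (ZMod p) F) (x : F) : Sym p a → Bool :=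
  fun ij => (β.repr x ij.1).val.testBit ij.2

/-- The canonical additive character `x ↦ exp (2 π i Tr(x) / p)` of the field. -/
def chi (p : ℕ) [Fact p.Prime] {F : Type*} [Field F] [Fintype F] [Algebra (ZMod p) F] (x : F) : ℂ :=
  ZMod.stdAddChar (Algebra.trace (ZMod p) F x)

/-! ### The problem: optimal polynomial intersection -/

/-- The value at `y` of the polynomial of degree at most `n - 1` with coefficient vector `x`. This is
the row of index `y` of the Vandermonde matrix `B = (y ^ j)` applied to `x`. -/
def polyVal {n : ℕ} (x : Fin n → F) (y : Fˣ) : F := ∑ j : Fin n, x j * (y : F) ^ (j : ℕ)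

/-- The signed indicator `f_y` of the target set: `+1` on it and `-1` off it. -/
def sgn (T : Finset F) (z : F) : ℝ := if z ∈ T then 1 else -1

/-- The objective `f(x)`: number of satisfied constraints minus number of unsatisfied ones. -/
def objective (T : Fˣ → Finset F) {n : ℕ} (x : Fin n → F) : ℝ :=
  ∑ y : Fˣ, sgn (T y) (polyVal x y)

/-- The average of `f_y` over the field. -/
def sgnMean (T : Finset F) : ℝ := (∑ z : F, sgn T z) / Fintype.card F

/-- The normalization constant of `f_y - mean`. -/
def sgnScale (T : Finset F) : ℝ := Real.sqrt (∑ z : F, (sgn T z - sgnMean T) ^ 2)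

/-- The shifted and rescaled `g_y`, of mean zero and with `∑ z, g_y(z)² = 1`. -/
def gFun (T : Finset F) (z : F) : ℝ := (sgn T z - sgnMean T) / sgnScale T

/-- The (unitary) Fourier transform of `g_y`. -/
def gHat (p : ℕ) [Fact p.Prime] [Algebra (ZMod p) F] (T : Finset F) (e : F) : ℂ :=
  (∑ z : F, chi p (e * z) * (gFun T z : ℂ)) / (Real.sqrt (Fintype.card F) : ℂ)

/-- The syndrome `Bᵀ e` of an error vector `e`. -/
def syndrome (n : ℕ) (e : Fˣ → F) : Fin n → F := fun j => ∑ y : Fˣ, e y * (y : F) ^ (j : ℕ)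

/-- The Hamming weight of an error vector. -/
def weight (e : Fˣ → F) : ℕ := (Finset.univ.filter fun y => e y ≠ 0).card

/-- The amplitude at `x` of the state that decoded quantum interferometry prepares from the weights
`w₀, …, w_ℓ`:
`∑ k, w_k / √(q ^ (n - k) * (m choose k)) * e_k (g_y(Q_x(y)) : y)`, with `e_k` the `k`-th elementary
symmetric polynomial in the `m` values and `Q_x` the polynomial with coefficients `x`. -/
def dqiAmplitude (T : Fˣ → Finset F) {n ℓ : ℕ} (w : Fin (ℓ + 1) → ℂ) (x : Fin n → F) : ℂ :=
  ∑ k : Fin (ℓ + 1),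
    w k / (Real.sqrt ((Fintype.card F : ℝ) ^ (n - (k : ℕ)) * (Fintype.card Fˣ).choose k) : ℂ) *
      ((∑ S ∈ Finset.univ.powersetCard (k : ℕ), ∏ y ∈ S, gFun (T y) (polyVal x y) : ℝ) : ℂ)

/-! ### The constraint-encoding gates -/

/-- The qubits of a constraint-encoding gate: one flag, one field symbol, `A` ancillas. -/
inductive GateWire (p a A : ℕ) where
  | flag : GateWire p a A
  | sym (r : Sym p a) : GateWire p a A
  | anc (i : Fin A) : GateWire p a A

/-- The basis state `|t⟩ |e⟩ |0⟩` of flag, symbol and ancillas. -/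
def gateKet (β : Module.Basis (Fin a) (ZMod p) F) (A : ℕ) (t : Bool) (e : F) :
    QState (GateWire p a A) :=
  ket fun
    | .flag => t
    | .sym r => enc β e r
    | .anc _ => false

/-- The circuit implements the isometry `G|0⟩ = |0⟩`, `G|1⟩ = ∑_{e ≠ 0} ĝ(e) |e⟩` from the flag qubit
to the symbol register. The flag ends in `|0⟩`, and the ancillas begin and end in `|0⟩`. -/
def ImplementsEncoding (β : Module.Basis (Fin a) (ZMod p) F) (T : Finset F) {A : ℕ}
    (c : Circuit (GateWire p a A)) : Prop :=
  c.run (gateKet β A false 0) = gateKet β A false 0 ∧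
  c.run (gateKet β A true 0) =
    ∑ e ∈ Finset.univ.filter (fun e : F => e ≠ 0), gHat p T e • gateKet β A false e

/-! ### The stages of the algorithm -/

/-- The qubits of the algorithm: one flag for each constraint (the mask), one error symbol for each
constraint, `n` syndrome symbols, and `A` ancillas. -/
inductive Wire (F : Type*) [Field F] (p a n A : ℕ) where
  | mask (y : Fˣ) : Wire F p a n A
  | err (y : Fˣ) (r : Sym p a) : Wire F p a n A
  | syn (j : Fin n) (r : Sym p a) : Wire F p a n A
  | anc (i : Fin A) : Wire F p a n A

/-- The basis state `|mask⟩ |e⟩ |s⟩ |0⟩`. -/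
def regKet (β : Module.Basis (Fin a) (ZMod p) F) {n : ℕ} (A : ℕ)
    (mask : Fˣ → Bool) (e : Fˣ → F) (s : Fin n → F) : QState (Wire F p a n A) :=
  ket fun
    | .mask y => mask y
    | .err y r => enc β (e y) r
    | .syn j r => enc β (s j) r
    | .anc _ => false

/-- The qubits on which the constraint-encoding gate of the constraint `y` acts. -/
def gateEmb (F : Type*) [Field F] (p a n A : ℕ) (y : Fˣ) : GateWire p a A ↪ Wire F p a n A where
  toFun
    | .flag => .mask y
    | .sym r => .err y r
    | .anc i => .anc i
  inj' := by
    rintro (_ | r | i) (_ | r' | i') h <;> simp_all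

/-- Stage 1, weighted Dicke state preparation:
`|0⟩ ↦ ∑_{k ≤ ℓ} w_k (m choose k)^{-1/2} ∑_{|S| = k} |S⟩`. -/
def IsDickePrep (β : Module.Basis (Fin a) (ZMod p) F) {n ℓ A : ℕ} (w : Fin (ℓ + 1) → ℂ)
    (c : Circuit (Wire F p a n A)) : Prop :=
  c.run (regKet β A (fun _ => false) 0 0) =
    ∑ k : Fin (ℓ + 1), (w k / (Real.sqrt ((Fintype.card Fˣ).choose k) : ℂ)) •
      ∑ S ∈ (Finset.univ : Finset Fˣ).powersetCard (k : ℕ),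
        regKet β A (fun y => decide (y ∈ S)) 0 0

/-- Stage 2, syndrome computation: `|e⟩ |s⟩ ↦ |e⟩ |s + Bᵀ e⟩`. -/
def IsSyndromeUpdate (β : Module.Basis (Fin a) (ZMod p) F) {n A : ℕ}
    (c : Circuit (Wire F p a n A)) : Prop :=
  ∀ (e : Fˣ → F) (s : Fin n → F),
    c.run (regKet β A (fun _ => false) e s) = regKet β A (fun _ => false) e (s + syndrome n e)

/-- Stage 3, reversible decoding of up to `ℓ` errors: `|e⟩ |Bᵀ e⟩ ↦ |0⟩ |Bᵀ e⟩`. -/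
def IsDecoder (β : Module.Basis (Fin a) (ZMod p) F) {n A : ℕ} (ℓ : ℕ)
    (c : Circuit (Wire F p a n A)) : Prop :=
  ∀ e : Fˣ → F, weight e ≤ ℓ →
    c.run (regKet β A (fun _ => false) e (syndrome n e)) =
      regKet β A (fun _ => false) 0 (syndrome n e)

/-- Stage 4, the inverse Fourier transform on the `n` syndrome symbols:
`|s⟩ ↦ q^{-n/2} ∑_x χ(-⟨s, x⟩) |x⟩`. -/
def IsInverseQFT (β : Module.Basis (Fin a) (ZMod p) F) {n A : ℕ}
    (c : Circuit (Wire F p a n A)) : Prop :=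
  ∀ s : Fin n → F,
    c.run (regKet β A (fun _ => false) 0 s) =
      ∑ x : Fin n → F,
        (chi p (-(∑ j, s j * x j)) / (Real.sqrt ((Fintype.card F : ℝ) ^ n) : ℂ)) •
          regKet β A (fun _ => false) 0 x

/-- A circuit for the whole algorithm, by stages. -/
structure DQICircuit (F : Type*) [Field F] [Fintype F] (p a n A : ℕ) where
  /-- Dicke state preparation -/
  dicke : Circuit (Wire F p a n A)
  /-- the constraint-encoding gates, one for each constraint -/
  encode : Fˣ → Circuit (GateWire p a A)
  /-- syndrome computation -/
  synd : Circuit (Wire F p a n A)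
  /-- reversible decoding -/
  decode : Circuit (Wire F p a n A)
  /-- inverse Fourier transform -/
  iqft : Circuit (Wire F p a n A)

/-- The full list of gates, in the order of execution. -/
def DQICircuit.full {n A : ℕ} (D : DQICircuit F p a n A) : Circuit (Wire F p a n A) :=
  D.dicke ++
    (Finset.univ : Finset Fˣ).toList.flatMap
      (fun y => (D.encode y).relabel (gateEmb F p a n A y)) ++
    D.synd ++ D.decode ++ D.iqft

/-- The number of gates outside the constraint-encoding gates. -/
def DQICircuit.otherGates {n A : ℕ} (D : DQICircuit F p a n A) : ℕ :=
  D.dicke.length + D.synd.length + D.decode.length + D.iqft.length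

/-- The circuit implements decoded quantum interferometry for the target sets `T`, with at most `ℓ`
errors and the weights `w`: every stage does what it has to do, and the whole maps `|0⟩` to
`∑_x dqiAmplitude(x) |x⟩`, all other qubits returning to `|0⟩`. -/
structure DQICircuit.Implements {n ℓ A : ℕ} (D : DQICircuit F p a n A)
    (β : Module.Basis (Fin a) (ZMod p) F) (T : Fˣ → Finset F) (w : Fin (ℓ + 1) → ℂ) : Prop where
  dicke : IsDickePrep β w D.dicke
  encode : ∀ y, ImplementsEncoding β (T y) (D.encode y)
  synd : IsSyndromeUpdate β D.synd
  decode : IsDecoder β ℓ D.decode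
  iqft : IsInverseQFT β D.iqft
  full : D.full.run (regKet β A (fun _ => false) 0 0) =
    ∑ x : Fin n → F, dqiAmplitude T w x • regKet β A (fun _ => false) 0 x

end Field

end DQI

end

noncomputable section

namespace DQI

/-! ### Basic facts about circuits -/

section Basics

variable {W W' : Type*}

/-! Correctness of the algorithm is Fourier inversion. After the encoding gates, a mask `S` has
become the product over `y ∈ S` of the states `∑ ĝ_y(e)|e⟩`, with zero errors off `S`. Once the
decoder has erased the error register, the inverse Fourier transform pairs the syndrome `Bᵀe` with
`x`, and `⟨Bᵀe, x⟩ = ∑ e_y Q_x(y)` (`sum_syndrome_mul`). So the sum over `e` factorizes, and each `y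
∈ S` contributes `√q · g_y(Q_x(y))` (`sum_encode_mul_chi`, `DQICircuit.run_full`).

What remains is to build the stages from few gates. The relation `Impl N ψ φ`, with an unlimited
supply of clean ancillas, is closed under composition, inversion and linear combination;
`Impl.exists_circuit` cuts the supply down to finitely many. Classical computations are written as
straight-line programs in field operations, translated to Boolean operations (`FComp.toBComp`),
compiled to gates (`SLP.compile`) and made clean by uncomputing (`impl_conj`). Even schoolbook
arithmetic costs only polylogarithmically many gates for each field operation, so only the number of
field operations matters.

An encoding gate prepares a superposition of `m` patterns; `impl_prep` splits them off a flag one at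
a time, with `O(log q)` gates each. The Dicke state comes from a counter that hands its units to the
sites with the right conditional probabilities (`dicke_step`, `dicke_unload`). The decoder solves
the Reed–Solomon key equation by a division-free iteration on a pair of solutions
(`KeyState.Inv.step`), and reads the errors off by Forney's formula (`error_value`): `O(n)` steps
and `m` evaluations, each of `O(n + log q)` field operations.

The Fourier transform of one symbol may cost `Õ(q)` gates, so a crude method suffices. Hadamard
gates, phases on pairs of bits and Hadamard gates again contain the transform as a component whose
amplitude is at least `1 / q`; an extra qubit lowers it to the exact value for which `q` rounds of
amplitude amplification leave no error (`qft_angle`, `impl_amplify`, `impl_symbol_qft_move`).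

If all target sets have the same size, the values `g_y` are roots of one quadratic polynomial. Their
power sums are then affine in `∑ g_y`, and Newton's identities turn the elementary symmetric
functions into polynomials in the objective (`exists_polynomial_esymm`). For the converse, unitarity
of the circuit makes the map from weights to amplitudes an isometry (`sum_norm_dqiAmplitude_sq`).
Its range has dimension `ℓ + 1` and lies in the space of polynomials of degree at most `ℓ` in the
objective, which is no larger; so the two coincide (`exists_weights`). -/

open Classical in
/-- The bit string `s` with the bit `i` set to `b`. -/
def setBit (s : W → Bool) (i : W) (b : Bool) : W → Bool := Function.update s i b

@[simp] theorem setBit_self (s : W → Bool) (i : W) (b : Bool) : setBit s i b i = b := by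
  simp [setBit]

theorem setBit_of_ne (s : W → Bool) {i j : W} (h : j ≠ i) (b : Bool) : setBit s i b j = s j := by
  simp [setBit, h]

theorem eq_setBit_iff {s t : W → Bool} {i : W} {b : Bool} :
    t = setBit s i b ↔ t i = b ∧ ∀ j, j ≠ i → t j = s j := by
  simp [setBit, Function.eq_update_iff]

theorem setBit_eq_iff {s t : W → Bool} {i : W} {b : Bool} :
    setBit s i b = t ↔ t i = b ∧ ∀ j, j ≠ i → t j = s j := by
  rw [eq_comm, eq_setBit_iff]

@[simp] theorem setBit_setBit (s : W → Bool) (i : W) (b c : Bool) :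
    setBit (setBit s i b) i c = setBit s i c := by
  simp [setBit]

@[simp] theorem setBit_eq_self (s : W → Bool) (i : W) : setBit s i (s i) = s := by
  simp [setBit]

theorem Gate.apply_one (U : Matrix.unitaryGroup Bool ℂ) (i : W) (ψ : QState W) (s : W → Bool) :
    (Gate.one U i).apply ψ s =
      ∑ b : Bool, (U : Matrix Bool Bool ℂ) (s i) b * ψ (setBit s i b) := rfl

theorem Gate.apply_cnot (c t : W) (h : c ≠ t) (ψ : QState W) (s : W → Bool) :
    (Gate.cnot c t h).apply ψ s = ψ (setBit s t (xor (s t) (s c))) := rfl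

theorem Gate.apply_toffoli (c₁ c₂ t : W) (h : c₁ ≠ c₂) (h₁ : c₁ ≠ t) (h₂ : c₂ ≠ t) (ψ : QState W)
    (s : W → Bool) :
    (Gate.toffoli c₁ c₂ t h h₁ h₂).apply ψ s = ψ (setBit s t (xor (s t) (s c₁ && s c₂))) := rfl

/-- The `Decidable` instance is a free argument, so that rewriting works with whichever instance is
at hand; `ket` itself uses the classical one. -/
theorem ket_apply (s t : W → Bool) [Decidable (t = s)] : ket s t = if t = s then 1 else 0 := by
  unfold ket; congr

theorem Gate.apply_add (g : Gate W) (ψ φ : QState W) : g.apply (ψ + φ) = g.apply ψ + g.apply φ := by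
  funext s
  cases g <;> simp [Gate.apply_one, Gate.apply_cnot, Gate.apply_toffoli, mul_add]
  ring

theorem Gate.apply_smul (g : Gate W) (a : ℂ) (ψ : QState W) : g.apply (a • ψ) = a • g.apply ψ := by
  funext s
  cases g <;> simp [Gate.apply_one, Gate.apply_cnot, Gate.apply_toffoli]
  ring

@[simp] theorem Circuit.run_nil (ψ : QState W) : Circuit.run [] ψ = ψ := rfl

@[simp] theorem Circuit.run_cons (g : Gate W) (c : Circuit W) (ψ : QState W) :
    Circuit.run (g :: c) ψ = Circuit.run c (g.apply ψ) := rfl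

theorem Circuit.run_append (c d : Circuit W) (ψ : QState W) :
    Circuit.run (c ++ d) ψ = Circuit.run d (Circuit.run c ψ) := by
  simp [Circuit.run, List.foldl_append]

theorem Circuit.run_add (c : Circuit W) (ψ φ : QState W) :
    c.run (ψ + φ) = c.run ψ + c.run φ := by
  induction c generalizing ψ φ with
  | nil => rfl
  | cons g c ih => simp [Gate.apply_add, ih]

theorem Circuit.run_smul (c : Circuit W) (a : ℂ) (ψ : QState W) :
    c.run (a • ψ) = a • c.run ψ := by
  induction c generalizing ψ with
  | nil => rfl
  | cons g c ih => simp [Gate.apply_smul, ih]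

/-- Running a circuit, as a linear map. -/
def Circuit.runₗ (c : Circuit W) : QState W →ₗ[ℂ] QState W where
  toFun := c.run
  map_add' := c.run_add
  map_smul' := c.run_smul

theorem Circuit.run_sum {ι : Type*} (c : Circuit W) (s : Finset ι) (ψ : ι → QState W) :
    c.run (∑ i ∈ s, ψ i) = ∑ i ∈ s, c.run (ψ i) := map_sum c.runₗ ψ s

/-- Gates act on amplitudes by substitution; as the permutation is an involution, it moves basis
states forward in the same way. The new string is described bit by bit, so that its uses need not
simplify nested updates. -/
theorem Gate.cnot_ket {c t : W} (h : c ≠ t) {s s' : W → Bool} (ht : s' t = xor (s t) (s c))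
    (hs : ∀ i, i ≠ t → s' i = s i) : (Gate.cnot c t h).apply (ket s) = ket s' := by
  classical
  funext u
  rw [Gate.apply_cnot, ket_apply, ket_apply]
  congr 1
  rw [setBit_eq_iff, eq_iff_iff]
  constructor
  · rintro ⟨h1, h2⟩
    funext i
    by_cases hi : i = t
    · subst hi; rw [ht, h1, h2 c h]; cases u i <;> cases u c <;> rfl
    · rw [hs i hi, h2 i hi]
  · rintro rfl
    refine ⟨?_, fun i hi => (hs i hi).symm⟩
    rw [hs c h, ht]; cases s t <;> cases s c <;> rfl

theorem Gate.toffoli_ket {c₁ c₂ t : W} (h : c₁ ≠ c₂) (h₁ : c₁ ≠ t) (h₂ : c₂ ≠ t)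
    {s s' : W → Bool} (ht : s' t = xor (s t) (s c₁ && s c₂))
    (hs : ∀ i, i ≠ t → s' i = s i) : (Gate.toffoli c₁ c₂ t h h₁ h₂).apply (ket s) = ket s' := by
  classical
  funext u
  rw [Gate.apply_toffoli, ket_apply, ket_apply]
  congr 1
  rw [setBit_eq_iff, eq_iff_iff]
  constructor
  · rintro ⟨h1, h2⟩
    funext i
    by_cases hi : i = t
    · subst hi; rw [ht, h1, h2 c₁ h₁, h2 c₂ h₂]; cases u i <;> cases u c₁ <;> cases u c₂ <;> rfl
    · rw [hs i hi, h2 i hi]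
  · rintro rfl
    refine ⟨?_, fun i hi => (hs i hi).symm⟩
    rw [hs c₁ h₁, hs c₂ h₂, ht]; cases s t <;> cases s c₁ <;> cases s c₂ <;> rfl

theorem Gate.one_ket (U : Matrix.unitaryGroup Bool ℂ) (i : W) (s : W → Bool) :
    (Gate.one U i).apply (ket s) =
      ∑ b : Bool, (U : Matrix Bool Bool ℂ) b (s i) • ket (setBit s i b) := by
  classical
  funext u
  rw [Gate.apply_one]
  simp only [Finset.sum_apply, Pi.smul_apply, smul_eq_mul, ket_apply]
  by_cases h : ∀ j, j ≠ i → u j = s j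
  · have h1 : ∀ b, (setBit u i b = s) ↔ b = s i := fun b => by
      rw [setBit_eq_iff]
      exact ⟨fun h' => h'.1.symm, fun h' => ⟨h'.symm, fun j hj => (h j hj).symm⟩⟩
    have h2 : ∀ b, (u = setBit s i b) ↔ u i = b := fun b => by
      rw [eq_setBit_iff]; exact and_iff_left h
    simp [h1, h2]
  · have h1 : ∀ b, ¬ (setBit u i b = s) := fun b hb =>
      h fun j hj => ((setBit_eq_iff.1 hb).2 j hj).symm
    have h2 : ∀ b, ¬ (u = setBit s i b) := fun b hb => h (eq_setBit_iff.1 hb).2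
    simp [h1, h2]

/-! ### Embedding into a larger set of qubits -/

open Classical in
/-- The state `ψ` on the qubits in the range of `f`, and the basis state `env` on the others. -/
def emb (f : W ↪ W') (env : W' → Bool) (ψ : QState W) : QState W' :=
  fun t => if ∀ w, w ∉ Set.range f → t w = env w then ψ (t ∘ f) else 0

theorem emb_add (f : W ↪ W') (env : W' → Bool) (ψ φ : QState W) :
    emb f env (ψ + φ) = emb f env ψ + emb f env φ := by
  funext t; simp only [emb, Pi.add_apply]; split_ifs <;> simp

theorem emb_smul (f : W ↪ W') (env : W' → Bool) (a : ℂ) (ψ : QState W) :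
    emb f env (a • ψ) = a • emb f env ψ := by
  funext t; simp only [emb, Pi.smul_apply]; split_ifs <;> simp

/-- `emb` as a linear map. -/
def embₗ (f : W ↪ W') (env : W' → Bool) : QState W →ₗ[ℂ] QState W' where
  toFun := emb f env
  map_add' := emb_add f env
  map_smul' := emb_smul f env

theorem emb_sum {ι : Type*} (f : W ↪ W') (env : W' → Bool) (s : Finset ι) (ψ : ι → QState W) :
    emb f env (∑ i ∈ s, ψ i) = ∑ i ∈ s, emb f env (ψ i) := map_sum (embₗ f env) ψ s

/-- A string on `W` extends by `env` to a string on `W'` at which `emb` reads off its amplitude.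
This pulls identities of states back to a smaller set of qubits. -/
theorem emb_injective (f : W ↪ W') (env : W' → Bool) : Function.Injective (emb f env) := by
  classical
  intro ψ φ h
  funext u
  let t : W' → Bool := fun w => if hw : ∃ i, f i = w then u hw.choose else env w
  have ht : t ∘ f = u := by
    funext i
    have hi : ∃ j, f j = f i := ⟨i, rfl⟩
    simp only [t, Function.comp_apply, hi, dif_pos]
    exact congrArg u (f.injective hi.choose_spec)
  have ht' : ∀ w, w ∉ Set.range f → t w = env w := fun w hw => by
    have : ¬ ∃ i, f i = w := hw
    simp [t, this]
  have := congrFun h t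
  simpa only [emb, if_pos ht', ht] using this

theorem emb_ket (f : W ↪ W') {env : W' → Bool} {u : W → Bool} {t : W' → Bool}
    (h : ∀ i, t (f i) = u i) (h' : ∀ w, w ∉ Set.range f → t w = env w) :
    emb f env (ket u) = ket t := by
  classical
  funext v
  rw [emb, ket_apply, ket_apply, ← ite_and]
  congr 1
  rw [eq_iff_iff]
  constructor
  · rintro ⟨h1, rfl⟩
    funext w
    by_cases hw : w ∈ Set.range f
    · obtain ⟨i, rfl⟩ := hw; exact (h i).symm
    · rw [h1 w hw, h' w hw]
  · rintro rfl
    exact ⟨h', funext h⟩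

theorem setBit_comp (f : W ↪ W') (t : W' → Bool) (i : W) (b : Bool) :
    setBit t (f i) b ∘ f = setBit (t ∘ f) i b := by
  rw [eq_setBit_iff]
  exact ⟨by simp, fun j hj => setBit_of_ne _ (f.injective.ne hj) _⟩

open Classical in
theorem emb_setBit (f : W ↪ W') (env : W' → Bool) (ψ : QState W) (t : W' → Bool) (i : W)
    (b : Bool) : emb f env ψ (setBit t (f i) b) =
      if ∀ w, w ∉ Set.range f → t w = env w then ψ (setBit (t ∘ f) i b) else 0 := by
  classical
  rw [emb, setBit_comp]
  have : (∀ w, w ∉ Set.range f → setBit t (f i) b w = env w) ↔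
      ∀ w, w ∉ Set.range f → t w = env w := by
    refine forall₂_congr fun w hw => ?_
    rw [setBit_of_ne]
    rintro rfl
    exact hw ⟨i, rfl⟩
  simp only [this]

/-- A relabelled gate neither reads nor changes the wires outside the range of `f`, so the condition
of agreement with `env` passes through it. -/
theorem Gate.apply_relabel (f : W ↪ W') (env : W' → Bool) (g : Gate W) (ψ : QState W) :
    (g.relabel f).apply (emb f env ψ) = emb f env (g.apply ψ) := by
  classical
  funext t
  cases g with
  | one U i =>
    simp only [Gate.relabel, Gate.apply_one, emb_setBit]
    rw [emb]
    split_ifs <;> simp [Gate.apply_one]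
  | cnot c t h => simp only [Gate.relabel, Gate.apply_cnot, emb_setBit]; rfl
  | toffoli c₁ c₂ t h h₁ h₂ =>
    simp only [Gate.relabel, Gate.apply_toffoli, emb_setBit]; rfl

theorem Circuit.run_relabel (f : W ↪ W') (env : W' → Bool) (c : Circuit W) (ψ : QState W) :
    (c.relabel f).run (emb f env ψ) = emb f env (c.run ψ) := by
  induction c generalizing ψ with
  | nil => rfl
  | cons g c ih =>
    have := ih (g.apply ψ)
    simp only [Circuit.relabel, List.map_cons, Circuit.run_cons, Gate.apply_relabel] at this ⊢
    exact this

@[simp] theorem Circuit.length_relabel (f : W ↪ W') (c : Circuit W) :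
    (c.relabel f).length = c.length := List.length_map _

/-! ### Inverses and unitarity -/

/-- The inverse gate. -/
def Gate.inv : Gate W → Gate W
  | .one U i => .one U⁻¹ i
  | .cnot c t h => .cnot c t h
  | .toffoli c₁ c₂ t h h₁ h₂ => .toffoli c₁ c₂ t h h₁ h₂

theorem Gate.inv_inv (g : Gate W) : g.inv.inv = g := by
  cases g <;> simp [Gate.inv]

theorem Gate.apply_inv_apply (g : Gate W) (ψ : QState W) : g.inv.apply (g.apply ψ) = ψ := by
  funext s
  cases g with
  | one U i =>
    have h : ∀ b, ∑ c : Bool, (star (U : Matrix Bool Bool ℂ)) (s i) c * (U : Matrix Bool Bool ℂ) c b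
        = if s i = b then 1 else 0 := fun b => by
      rw [← Matrix.mul_apply, Matrix.mem_unitaryGroup_iff'.1 U.2, Matrix.one_apply]
    simp only [Gate.inv, Gate.apply_one, setBit_self, setBit_setBit, Finset.mul_sum, ← mul_assoc]
    rw [Finset.sum_comm]
    simp only [← Finset.sum_mul]
    have h' : ∀ b, ∑ c : Bool, ((U⁻¹ : Matrix.unitaryGroup Bool ℂ) : Matrix Bool Bool ℂ) (s i) c *
        (U : Matrix Bool Bool ℂ) c b = if s i = b then 1 else 0 := h
    simp only [h', ite_mul, one_mul, zero_mul, Finset.sum_ite_eq, Finset.mem_univ, if_true]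
    rw [setBit_eq_self]
  | cnot c t h =>
    simp only [Gate.inv, Gate.apply_cnot, setBit_self, setBit_setBit, setBit_of_ne s h]
    congr 1
    rw [setBit_eq_iff]
    simp
  | toffoli c₁ c₂ t h h₁ h₂ =>
    simp only [Gate.inv, Gate.apply_toffoli, setBit_self, setBit_setBit, setBit_of_ne s h₁,
      setBit_of_ne s h₂]
    congr 1
    rw [setBit_eq_iff]
    simp

/-- The inverse circuit. -/
def Circuit.inv (c : Circuit W) : Circuit W := (c.map Gate.inv).reverse

@[simp] theorem Circuit.length_inv (c : Circuit W) : c.inv.length = c.length := by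
  simp [Circuit.inv]

theorem Circuit.run_inv_run (c : Circuit W) (ψ : QState W) : c.inv.run (c.run ψ) = ψ := by
  induction c generalizing ψ with
  | nil => rfl
  | cons g c ih =>
    have := ih (g.apply ψ)
    simp only [Circuit.inv, List.map_cons, List.reverse_cons, Circuit.run_append,
      Circuit.run_cons, Circuit.run_nil] at this ⊢
    rw [this, Gate.apply_inv_apply]

theorem Circuit.run_run_inv (c : Circuit W) (ψ : QState W) : c.run (c.inv.run ψ) = ψ := by
  have h : c.inv.inv = c := by
    simp [Circuit.inv, List.map_reverse, Function.comp_def, Gate.inv_inv]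
  have := c.inv.run_inv_run ψ
  rwa [h] at this

/-- The inner product of two states. -/
def braket [Fintype W] (ψ φ : QState W) : ℂ := by
  classical exact ∑ s : W → Bool, star (ψ s) * φ s

/-- Averaging over the bit `i` reduces unitarity of a one-qubit gate on all qubits to an identity
for 2×2 matrices, for each value of the other bits. -/
theorem sum_setBit [Fintype W] [DecidableEq W] (i : W) (h : (W → Bool) → ℂ) :
    ∑ s : W → Bool, h s = ∑ s : W → Bool, (∑ b, h (setBit s i b)) / 2 := by
  have hinv : ∑ s : W → Bool, h (setBit s i (!s i)) = ∑ s : W → Bool, h s := by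
    refine Fintype.sum_equiv (Function.Involutive.toPerm (fun s => setBit s i (!s i)) ?_) _ _ ?_
    · intro s; simp
    · intro s; rfl
  have h2 : ∀ s : W → Bool, ∑ b, h (setBit s i b) = h s + h (setBit s i (!s i)) := by
    intro s
    have : s = setBit s i (s i) := by simp
    conv_rhs => arg 1; rw [this]
    cases s i <;> simp [add_comm]
  rw [← Finset.sum_div, Finset.sum_congr rfl fun s _ => h2 s, Finset.sum_add_distrib, hinv]
  ring

theorem Gate.braket_apply [Fintype W] (g : Gate W) (ψ φ : QState W) :
    braket (g.apply ψ) (g.apply φ) = braket ψ φ := by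
  classical
  unfold braket
  cases g with
  | one U i =>
    rw [sum_setBit i, sum_setBit i (fun s => star (ψ s) * φ s)]
    refine Finset.sum_congr rfl fun s _ => ?_
    congr 1
    simp only [Gate.apply_one, setBit_self, setBit_setBit]
    have h : ∀ b b' : Bool, ∑ c : Bool, star ((U : Matrix Bool Bool ℂ) c b) *
        (U : Matrix Bool Bool ℂ) c b' = if b = b' then 1 else 0 := fun b b' => by
      have := congrFun (congrFun (Matrix.mem_unitaryGroup_iff'.1 U.2) b) b'
      rwa [Matrix.mul_apply, Matrix.one_apply] at this
    have h00 := h false false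
    have h01 := h false true
    have h10 := h true false
    have h11 := h true true
    simp only [Fintype.sum_bool, star_add, star_mul', reduceIte, Bool.false_eq_true,
      Bool.true_eq_false] at h00 h01 h10 h11 ⊢
    linear_combination (star (ψ (setBit s i false)) * φ (setBit s i false)) * h00 +
      (star (ψ (setBit s i false)) * φ (setBit s i true)) * h01 +
      (star (ψ (setBit s i true)) * φ (setBit s i false)) * h10 +
      (star (ψ (setBit s i true)) * φ (setBit s i true)) * h11
  | cnot c t h =>
    refine Fintype.sum_equiv (Function.Involutive.toPerm
      (fun s => setBit s t (xor (s t) (s c))) ?_) _ _ fun s => rfl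
    intro s
    simp [setBit_of_ne s h]
  | toffoli c₁ c₂ t h h₁ h₂ =>
    refine Fintype.sum_equiv (Function.Involutive.toPerm
      (fun s => setBit s t (xor (s t) (s c₁ && s c₂))) ?_) _ _ fun s => rfl
    intro s
    simp [setBit_of_ne s h₁, setBit_of_ne s h₂]

theorem Circuit.braket_run [Fintype W] (c : Circuit W) (ψ φ : QState W) :
    braket (c.run ψ) (c.run φ) = braket ψ φ := by
  induction c generalizing ψ φ with
  | nil => rfl
  | cons g c ih => rw [Circuit.run_cons, Circuit.run_cons, ih, Gate.braket_apply]

end Basics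

/-! ### Straight-line programs, as sets of computed functions -/

section StraightLine

variable {X Y : Type*}

/-- `SLP ops B n S`: starting from the functions in `B` and the constants, some straight-line program
with `n` operations from `ops` computes exactly the functions in `S`. -/
inductive SLP (ops : Set (Y → Y → Y)) (B : Set (X → Y)) : ℕ → Set (X → Y) → Prop
  | base : SLP ops B 0 (B ∪ Set.range (Function.const X))
  | step {n : ℕ} {S : Set (X → Y)} {f g : X → Y} {o : Y → Y → Y} (h : SLP ops B n S) (ho : o ∈ ops)
      (hf : f ∈ S) (hg : g ∈ S) : SLP ops B (n + 1) (insert (fun x => o (f x) (g x)) S)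

/-- The functions in `T` are computable from those in `B` with at most `n` operations. -/
def Comp (ops : Set (Y → Y → Y)) (B : Set (X → Y)) (n : ℕ) (T : Set (X → Y)) : Prop :=
  ∃ k ≤ n, ∃ S, SLP ops B k S ∧ T ⊆ S

variable {ops : Set (Y → Y → Y)} {B B' S T U : Set (X → Y)} {n m : ℕ}

theorem SLP.subset (h : SLP ops B n S) : B ∪ Set.range (Function.const X) ⊆ S := by
  induction h with
  | base => exact subset_rfl
  | step _ _ _ _ ih => exact ih.trans (Set.subset_insert _ _)

/-- The second program is replayed on top of the first; nothing that has been computed is discarded.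
-/
theorem SLP.trans (h : SLP ops B n S) (h' : SLP ops B' m T) (hB : B' ⊆ S) :
    ∃ U, SLP ops B (n + m) U ∧ S ⊆ U ∧ T ⊆ U := by
  induction h' with
  | base => exact ⟨S, h, subset_rfl, Set.union_subset hB (Set.subset_union_right.trans h.subset)⟩
  | step _ ho hf hg ih =>
    obtain ⟨U, hU, hSU, hTU⟩ := ih
    exact ⟨_, hU.step ho (hTU hf) (hTU hg), hSU.trans (Set.subset_insert _ _),
      Set.insert_subset_insert hTU⟩

/-- An `SLP` records exactly which functions are available, so it is not itself monotone in the
base; the program has to be replayed over `B'`. -/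
theorem Comp.mono (h : Comp ops B n T) (hB : B ⊆ B') (hn : n ≤ m) (hT : U ⊆ T) :
    Comp ops B' m U := by
  obtain ⟨k, hk, S, hS, hTS⟩ := h
  obtain ⟨V, hV, -, hSV⟩ := (SLP.base (ops := ops) (B := B')).trans hS
    (hB.trans Set.subset_union_left)
  exact ⟨_, by omega, V, hV, (hT.trans hTS).trans hSV⟩

theorem Comp.of_subset (h : T ⊆ B ∪ Set.range (Function.const X)) : Comp ops B n T :=
  ⟨0, n.zero_le, _, SLP.base, h⟩

theorem Comp.const (c : Y) : Comp ops B n {fun _ : X => c} :=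
  .of_subset (Set.singleton_subset_iff.2 (Or.inr ⟨c, rfl⟩))

theorem Comp.of_mem {f : X → Y} (h : f ∈ B) : Comp ops B n {f} :=
  .of_subset (Set.singleton_subset_iff.2 (Or.inl h))

theorem Comp.trans_union (h : Comp ops B n T) (h' : Comp ops (B ∪ T) m U) :
    Comp ops B (n + m) (T ∪ U) := by
  obtain ⟨k, hk, S, hS, hTS⟩ := h
  obtain ⟨k', hk', S', hS', hUS'⟩ := h'
  obtain ⟨V, hV, hSV, hV'⟩ := hS.trans hS'
    (Set.union_subset (Set.subset_union_left.trans hS.subset) hTS)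
  exact ⟨_, by omega, V, hV, Set.union_subset (hTS.trans hSV) (hUS'.trans hV')⟩

theorem Comp.trans (h : Comp ops B n T) (h' : Comp ops (B ∪ T) m U) : Comp ops B (n + m) U :=
  (h.trans_union h').mono subset_rfl le_rfl Set.subset_union_right

theorem Comp.union (h : Comp ops B n T) (h' : Comp ops B m U) : Comp ops B (n + m) (T ∪ U) :=
  h.trans_union (h'.mono Set.subset_union_left le_rfl subset_rfl)

theorem Comp.op {f g : X → Y} {o : Y → Y → Y} (ho : o ∈ ops) (hf : Comp ops B n {f})
    (hg : Comp ops B m {g}) : Comp ops B (n + m + 1) {fun x => o (f x) (g x)} := by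
  obtain ⟨k, hk, S, hS, hTS⟩ := hf.union hg
  exact ⟨k + 1, by omega, _, hS.step ho (hTS (Or.inl rfl)) (hTS (Or.inr rfl)),
    Set.singleton_subset_iff.2 (Set.mem_insert _ _)⟩

theorem Comp.biUnion {ι : Type*} (s : Finset ι) (T : ι → Set (X → Y))
    (h : ∀ i ∈ s, Comp ops B n (T i)) : Comp ops B (s.card * n) (⋃ i ∈ s, T i) := by
  classical
  induction s using Finset.induction_on with
  | empty => exact .of_subset (by simp)
  | insert i s hi ih =>
    have := (h i (Finset.mem_insert_self _ _)).union
      (ih fun j hj => h j (Finset.mem_insert_of_mem hj))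
    rw [Finset.card_insert_of_notMem hi, Finset.set_biUnion_insert]
    exact this.mono subset_rfl (by ring_nf; rfl) subset_rfl

theorem Comp.iUnion {ι : Type*} [Fintype ι] (T : ι → Set (X → Y))
    (h : ∀ i, Comp ops B n (T i)) : Comp ops B (Fintype.card ι * n) (⋃ i, T i) :=
  (Comp.biUnion Finset.univ T fun i _ => h i).mono subset_rfl le_rfl (by simp)

theorem Comp.chain (T : ℕ → Set (X → Y)) (k : ℕ) (h0 : Comp ops B n (T 0))
    (h : ∀ i < k, Comp ops (B ∪ T i) m (T (i + 1))) : Comp ops B (n + k * m) (T k) := by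
  induction k with
  | zero => exact h0.mono subset_rfl (by omega) subset_rfl
  | succ k ih =>
    exact ((ih fun i hi => h i (by omega)).trans (h k (by omega))).mono subset_rfl
      (by ring_nf; rfl) subset_rfl

/-- Accumulation of a sum, one summand at a time. -/
theorem Comp.accumulate {ι M : Type*} [AddCommMonoid M] (s : Finset ι) (f : ι → X → M)
    (enc : (X → M) → Set (X → Y)) (φ : X → M) (hφ : Comp ops B n (enc φ))
    (h : ∀ i ∈ s, ∀ ψ : X → M, Comp ops (B ∪ enc ψ) m (enc (ψ + f i))) :
    Comp ops B (n + s.card * m) (enc (φ + ∑ i ∈ s, f i)) := by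
  classical
  induction s using Finset.induction_on with
  | empty => simpa using hφ
  | insert i s hi ih =>
    have h1 := ih fun j hj => h j (Finset.mem_insert_of_mem hj)
    have h2 := h1.trans (h i (Finset.mem_insert_self _ _) _)
    rw [Finset.sum_insert hi, Finset.card_insert_of_notMem hi, add_comm (f i), ← add_assoc]
    exact h2.mono subset_rfl (by ring_nf; rfl) subset_rfl

end StraightLine

/-! ### Boolean arithmetic -/

section Boolean

variable {X : Type*} {B : Set (X → Bool)} {n m : ℕ}

/-- Computability with Boolean gates of two inputs. -/
abbrev BComp (B : Set (X → Bool)) (n : ℕ) (T : Set (X → Bool)) : Prop := Comp Set.univ B n T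

theorem BComp.op {f g : X → Bool} (o : Bool → Bool → Bool) (hf : BComp B n {f})
    (hg : BComp B m {g}) : BComp B (n + m + 1) {fun x => o (f x) (g x)} :=
  Comp.op (Set.mem_univ o) hf hg

theorem BComp.not {f : X → Bool} (hf : BComp B n {f}) : BComp B (n + 1) {fun x => !f x} := by
  have := BComp.op (fun a _ => !a) hf (Comp.const (n := 0) false)
  exact this

theorem BComp.all {ι : Type*} (s : Finset ι) (f : ι → X → Bool)
    (h : ∀ i ∈ s, BComp B n {f i}) : BComp B (s.card * (n + 1)) {fun x => decide (∀ i ∈ s, f i x)} := by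
  classical
  induction s using Finset.induction_on with
  | empty => simpa using Comp.const (ops := Set.univ) (B := B) (n := 0) true
  | insert i s hi ih =>
    have := BComp.op (fun a b => a && b) (h i (Finset.mem_insert_self _ _))
      (ih fun j hj => h j (Finset.mem_insert_of_mem hj))
    rw [Finset.card_insert_of_notMem hi]
    refine this.mono subset_rfl (by ring_nf; rfl) (Set.singleton_subset_iff.2 ?_)
    simp only [Set.mem_singleton_iff]
    funext x
    simp

/-- The bits of a family of bit vectors. -/
def bvBits {w : ℕ} (u : X → BitVec w) : Set (X → Bool) :=
  Set.range fun (i : ℕ) x => (u x).getLsbD i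

/-- A carry is the majority of two bits and the preceding carry, which takes four operations. All
carries are kept, because the bits of the sum need each of them. -/
theorem bcomp_carry {w : ℕ} (u v : X → BitVec w) (c : Bool) (hu : bvBits u ⊆ B) (hv : bvBits v ⊆ B)
    (k : ℕ) : BComp B (4 * k) (⋃ i ∈ Finset.range (k + 1), {fun x => BitVec.carry i (u x) (v x) c}) := by
  induction k with
  | zero => simpa using Comp.const (ops := Set.univ) (B := B) (n := 0) c
  | succ k ih =>
    have hu' : ∀ i, (fun x => (u x).getLsbD i) ∈ B := fun i => hu ⟨i, rfl⟩
    have hv' : ∀ i, (fun x => (v x).getLsbD i) ∈ B := fun i => hv ⟨i, rfl⟩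
    set T := ⋃ i ∈ Finset.range (k + 1), {fun x => BitVec.carry i (u x) (v x) c} with hT
    have hc : (fun x => BitVec.carry k (u x) (v x) c) ∈ B ∪ T :=
      Or.inr (Set.mem_biUnion (Finset.mem_coe.2 (Finset.self_mem_range_succ k)) rfl)
    have h1 : BComp (B ∪ T) 4
        {fun x => BitVec.carry (k + 1) (u x) (v x) c} := by
      have hu0 : BComp (B ∪ T) 0 {fun x => (u x).getLsbD k} := .of_mem (Or.inl (hu' k))
      have hv0 : BComp (B ∪ T) 0 {fun x => (v x).getLsbD k} := .of_mem (Or.inl (hv' k))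
      have hor := BComp.op (fun a b => a || b) hu0 hv0
      have hand := BComp.op (fun a b => a && b) hu0 hv0
      have h3 := BComp.op (fun a b => a && b) hor (Comp.of_mem (n := 0) hc)
      have h4 := BComp.op (fun a b => a || b) hand h3
      refine h4.mono subset_rfl (by omega) (Set.singleton_subset_iff.2 ?_)
      simp only [Set.mem_singleton_iff]
      funext x
      rw [BitVec.carry_succ]
      cases (u x).getLsbD k <;> cases (v x).getLsbD k <;>
        cases BitVec.carry k (u x) (v x) c <;> rfl
    refine (ih.trans_union h1).mono subset_rfl (by omega) ?_
    rw [Finset.range_add_one (n := k + 1), Finset.set_biUnion_insert, Set.union_comm]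

theorem bcomp_carry_top {w : ℕ} (u v : X → BitVec w) (c : Bool) (hu : bvBits u ⊆ B)
    (hv : bvBits v ⊆ B) : BComp B (4 * w) {fun x => BitVec.carry w (u x) (v x) c} :=
  (bcomp_carry u v c hu hv w).mono subset_rfl le_rfl (Set.singleton_subset_iff.2
    (Set.mem_biUnion (Finset.mem_coe.2 (Finset.self_mem_range_succ w)) rfl))

theorem bcomp_add {w : ℕ} (u v : X → BitVec w) (hu : bvBits u ⊆ B) (hv : bvBits v ⊆ B) :
    BComp B (6 * w) (bvBits fun x => u x + v x) := by
  have h1 := bcomp_carry u v false hu hv w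
  set T := ⋃ i ∈ Finset.range (w + 1), {fun x => BitVec.carry i (u x) (v x) false} with hT
  have h2 : BComp (B ∪ T) (w * 2)
      (⋃ i ∈ Finset.range w, {fun x => (u x + v x).getLsbD i}) := by
    have := Comp.biUnion (ops := Set.univ) (B := B ∪ T) (n := 2) (Finset.range w)
      (fun i => {fun x => (u x + v x).getLsbD i}) fun i hi => ?_
    · rwa [Finset.card_range] at this
    · have hi : i < w := Finset.mem_range.1 hi
      have hu0 : BComp (B ∪ T) 0 {fun x => (u x).getLsbD i} := .of_mem (Or.inl (hu ⟨i, rfl⟩))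
      have hv0 : BComp (B ∪ T) 0 {fun x => (v x).getLsbD i} := .of_mem (Or.inl (hv ⟨i, rfl⟩))
      have hc0 : BComp (B ∪ T) 0 {fun x => BitVec.carry i (u x) (v x) false} :=
        .of_mem (Or.inr (Set.mem_biUnion
          (Finset.mem_coe.2 (Finset.mem_range.2 (by omega : i < w + 1))) rfl))
      have hx := BComp.op xor (BComp.op xor hu0 hv0) hc0
      refine hx.mono subset_rfl (by omega) (Set.singleton_subset_iff.2 ?_)
      simp only [Set.mem_singleton_iff]
      funext x
      rw [BitVec.getLsbD_add hi, Bool.xor_assoc]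
  have h3 := (h1.trans h2).union (Comp.const (ops := Set.univ) (B := B) (n := 0) false)
  refine h3.mono subset_rfl (by omega) ?_
  rintro _ ⟨i, rfl⟩
  by_cases hi : i < w
  · exact Or.inl (Set.mem_biUnion (Finset.mem_coe.2 (Finset.mem_range.2 hi)) rfl)
  · refine Or.inr ?_
    simp only [Set.mem_singleton_iff]
    funext x
    exact BitVec.getLsbD_of_ge _ _ (by omega)

theorem bcomp_const_bv {w : ℕ} (d : BitVec w) : BComp B n (bvBits fun _ : X => d) :=
  .of_subset (by rintro _ ⟨i, rfl⟩; exact Or.inr ⟨_, rfl⟩)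

/-- Comparison by subtraction: `u < d` exactly if `u + ~~~d + 1` has no carry out of the top
position. -/
theorem bcomp_ult_const {w : ℕ} (u : X → BitVec w) (d : BitVec w) (hu : bvBits u ⊆ B) :
    BComp B (4 * w + 1) {fun x => (u x).ult d} := by
  have h1 := (bcomp_const_bv (B := B) (n := 0) (~~~d)).trans
    (bcomp_carry_top u (fun _ => ~~~d) true (hu.trans Set.subset_union_left)
      Set.subset_union_right)
  refine (BComp.not h1).mono subset_rfl (by omega) (Set.singleton_subset_iff.2 ?_)
  simp only [Set.mem_singleton_iff]
  funext x
  exact BitVec.ult_eq_not_carry _ _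

/-- This is free: each bit of the masked constant is either `c` itself or constantly zero. -/
theorem bcomp_mask {w : ℕ} (c : X → Bool) (d : BitVec w) (hc : c ∈ B) :
    BComp B n (bvBits fun x => if c x then d else 0) := by
  refine .of_subset ?_
  rintro _ ⟨i, rfl⟩
  cases hd : d.getLsbD i with
  | false =>
    refine Or.inr ⟨false, ?_⟩
    funext x
    simp only [Function.const_apply]
    split_ifs <;> simp [hd]
  | true =>
    refine Or.inl ?_
    convert hc using 1
    funext x
    by_cases h : c x = true
    · simp [h, hd]
    · simp [h]

/-- The bits of the canonical representatives of a family of residues modulo `p`. -/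
def zBits {p : ℕ} (v : X → ZMod p) : Set (X → Bool) :=
  Set.range fun (j : Fin (Nat.clog 2 p)) x => (v x).val.testBit j

/-- Conditional addition of a constant modulo `p`. -/
theorem bcomp_zmod_add {p : ℕ} [hp : Fact p.Prime] (v : X → ZMod p) (c : X → Bool) (d : ZMod p)
    (hv : zBits v ⊆ B) (hc : c ∈ B) :
    BComp B (40 * Nat.clog 2 p) (zBits fun x => v x + if c x then d else 0) := by
  have : NeZero p := ⟨hp.out.ne_zero⟩
  have hk : 1 ≤ Nat.clog 2 p := Nat.clog_pos one_lt_two hp.out.two_le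
  have hpk : p ≤ 2 ^ Nat.clog 2 p := Nat.le_pow_clog one_lt_two p
  set k := Nat.clog 2 p with hkdef
  -- One bit more than a residue needs, so that the sum of two residues does not overflow. The
  -- reduction compares `t` with `p` and, unless `t` is smaller, adds `2 ^ (k + 1) - p`, which
  -- subtracts `p` in this width.
  have hpw : 2 * p ≤ 2 ^ (k + 1) := by rw [pow_succ]; omega
  let u : X → BitVec (k + 1) := fun x => BitVec.ofNat (k + 1) (v x).val
  let t : X → BitVec (k + 1) := fun x => u x + if c x then BitVec.ofNat (k + 1) d.val else 0
  let l : X → Bool := fun x => (t x).ult (BitVec.ofNat (k + 1) p)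
  let r : X → BitVec (k + 1) := fun x =>
    t x + if !(l x) then BitVec.ofNat (k + 1) (2 ^ (k + 1) - p) else 0
  have hu : BComp B 0 (bvBits u) := by
    refine .of_subset ?_
    rintro _ ⟨i, rfl⟩
    rcases lt_trichotomy i k with hi | hi | hi
    · refine Or.inl (hv ⟨⟨i, hi⟩, ?_⟩)
      funext x
      simp only [u, BitVec.getLsbD_ofNat, show i < k + 1 by omega, decide_true, Bool.true_and]
    · refine Or.inr ⟨false, ?_⟩
      funext x
      have : (v x).val.testBit i = false :=
        Nat.testBit_lt_two_pow (((v x).val_lt.trans_le hpk).trans_le (by rw [hi]))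
      simp [u, BitVec.getLsbD_ofNat, this]
    · refine Or.inr ⟨false, ?_⟩
      funext x
      simp [u, BitVec.getLsbD_ofNat, show ¬ i < k + 1 by omega]
  have ht : BComp B (6 * (k + 1)) (bvBits t) := by
    have h1 := hu.union (bcomp_mask (n := 0) c (BitVec.ofNat (k + 1) d.val) hc)
    exact (h1.trans (bcomp_add _ _ (fun _ h => Or.inr (Or.inl h))
      fun _ h => Or.inr (Or.inr h))).mono subset_rfl (by omega) subset_rfl
  have hl : BComp (B ∪ bvBits t) (4 * (k + 1) + 2) {fun x => !(l x)} :=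
    BComp.not (bcomp_ult_const t _ Set.subset_union_right)
  have hr : BComp B (20 * (k + 1)) (bvBits r) := by
    have h1 := ht.trans_union hl
    have h2 : BComp (B ∪ (bvBits t ∪ {fun x => !(l x)})) 0
        (bvBits fun x => if !(l x) then BitVec.ofNat (k + 1) (2 ^ (k + 1) - p) else 0) :=
      bcomp_mask _ _ (Or.inr (Or.inr rfl))
    exact ((h1.trans_union h2).trans (bcomp_add _ _ (fun _ h => Or.inr (Or.inl (Or.inl h)))
      fun _ h => Or.inr (Or.inr h))).mono subset_rfl (by omega) subset_rfl
  refine hr.mono subset_rfl (by omega) ?_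
  rintro _ ⟨j, rfl⟩
  refine ⟨j, ?_⟩
  funext x
  have hval : (r x).toNat = (v x + if c x then d else 0).val := by
    have hvx := (v x).val_lt
    have hd := d.val_lt
    have htx : (t x).toNat = (v x).val + (if c x then d else 0 : ZMod p).val := by
      simp only [t, u]
      split_ifs
      · rw [BitVec.toNat_add, BitVec.toNat_ofNat, BitVec.toNat_ofNat, ← Nat.add_mod,
          Nat.mod_eq_of_lt (by omega)]
      · simp only [add_zero, BitVec.add_zero, ZMod.val_zero, BitVec.ofNat_eq_ofNat]
        rw [BitVec.toNat_ofNat, Nat.mod_eq_of_lt (by omega)]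
    have hd' := (if c x then d else 0 : ZMod p).val_lt
    rw [ZMod.val_add, ← htx]
    have hlx : l x = decide ((t x).toNat < p) := by
      simp only [l, BitVec.ult, BitVec.toNat_ofNat]
      rw [Nat.mod_eq_of_lt (by omega : p < 2 ^ (k + 1))]
    simp only [r, hlx]
    by_cases h : (t x).toNat < p
    · simp only [h, decide_true, Bool.not_true, Bool.false_eq_true, if_false,
        BitVec.ofNat_eq_ofNat, BitVec.add_zero]
      rw [Nat.mod_eq_of_lt h]
    · simp only [h, decide_false, Bool.not_false, if_true]
      rw [BitVec.toNat_add, BitVec.toNat_ofNat,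
        Nat.mod_eq_of_lt (by have := hp.out.pos; omega : 2 ^ (k + 1) - p < 2 ^ (k + 1)),
        show (t x).toNat + (2 ^ (k + 1) - p) = ((t x).toNat - p) + 2 ^ (k + 1) by omega,
        Nat.add_mod_right, Nat.mod_eq_of_lt (by omega), Nat.mod_eq_sub_mod (by omega),
        Nat.mod_eq_of_lt (by omega)]
  have : (r x).getLsbD j = (r x).toNat.testBit j := rfl
  simp only [this, hval]

end Boolean

/-! ### Field arithmetic with Boolean gates -/

/-- The number of bits of a field symbol. -/
abbrev symBits (p a : ℕ) : ℕ := a * Nat.clog 2 p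

theorem card_sym (p a : ℕ) : Fintype.card (Sym p a) = symBits p a := by simp [Sym, symBits]

section FieldBits

variable {X : Type*} {B : Set (X → Bool)} {n m : ℕ}
variable {p : ℕ} [hp : Fact p.Prime] {F : Type*} [Field F] [Algebra (ZMod p) F] {a : ℕ}
  (β : Module.Basis (Fin a) (ZMod p) F)

/-- The bits of the encoding of a family of field elements. -/
def fBits (φ : X → F) : Set (X → Bool) := Set.range fun r x => enc β (φ x) r

/-- The field element that is encoded by the bit string with one nonzero bit. -/
def symVal (r : Sym p a) : F := (2 : F) ^ (r.2 : ℕ) * β r.1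

theorem sum_testBit_two_pow {N k : ℕ} (h : N < 2 ^ k) :
    (∑ j : Fin k, if N.testBit j then 2 ^ (j : ℕ) else 0) = N := by
  rw [Fin.sum_univ_eq_sum_range (fun j => if N.testBit j then 2 ^ j else 0) k]
  have : ∀ k, (∑ j ∈ Finset.range k, if N.testBit j then 2 ^ j else 0) = N % 2 ^ k := by
    intro k
    induction k with
    | zero => simp [Nat.mod_one]
    | succ k ih =>
      rw [Finset.sum_range_succ, ih, pow_succ, Nat.mod_mul, Nat.testBit_eq_decide_div_mod_eq]
      rcases Nat.mod_two_eq_zero_or_one (N / 2 ^ k) with h | h <;> simp [h]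
  rw [this, Nat.mod_eq_of_lt h]

/-- A coordinate `z` acts on `β i` as the natural number `z.val`, which is the sum of its binary
digits. Hence sums are additive and products bilinear in the bits, and the Fourier kernel splits
into phases for pairs of bits. -/
theorem sum_symVal (x : F) : ∑ r : Sym p a, (if enc β x r then symVal β r else 0) = x := by
  have : NeZero p := ⟨hp.out.ne_zero⟩
  rw [Fintype.sum_prod_type]
  conv_rhs => rw [← β.sum_repr x]
  refine Finset.sum_congr rfl fun i _ => ?_
  have h : (β.repr x i).val < 2 ^ Nat.clog 2 p :=
    (β.repr x i).val_lt.trans_le (Nat.le_pow_clog one_lt_two p)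
  have h1 : ∀ z : ZMod p, z • β i = (z.val : F) * β i := fun z => by
    rw [Algebra.smul_def]
    congr 1
    conv_lhs => rw [← ZMod.natCast_zmod_val z]
    exact map_natCast _ _
  rw [h1]
  conv_rhs => rw [← sum_testBit_two_pow h]
  push_cast
  rw [Finset.sum_mul]
  refine Finset.sum_congr rfl fun j _ => ?_
  change (if (β.repr x i).val.testBit j = true then symVal β (i, j) else 0) = _
  split_ifs <;> simp [symVal]

theorem enc_injective : Function.Injective (enc β) := by
  intro x y h
  rw [← sum_symVal β x, ← sum_symVal β y, h]

theorem bcomp_add_const (φ : X → F) (c : X → Bool) (d : F) (hφ : fBits β φ ⊆ B) (hc : c ∈ B) :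
    BComp B (40 * symBits p a) (fBits β fun x => φ x + if c x then d else 0) := by
  have h := Comp.iUnion (ops := Set.univ) (B := B) (n := 40 * Nat.clog 2 p)
    (fun i : Fin a => zBits fun x => β.repr (φ x) i + if c x then β.repr d i else 0) fun i => by
      refine bcomp_zmod_add _ c _ ?_ hc
      rintro _ ⟨j, rfl⟩
      exact hφ ⟨(i, j), rfl⟩
  refine h.mono subset_rfl (by rw [Fintype.card_fin]; unfold symBits; ring_nf; rfl) ?_
  rintro _ ⟨⟨i, j⟩, rfl⟩
  refine Set.mem_iUnion.2 ⟨i, j, ?_⟩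
  funext x
  by_cases h : c x = true <;> simp [enc, h]

theorem bcomp_fBits_const (d : F) : BComp B n (fBits β fun _ : X => d) :=
  .of_subset (by rintro _ ⟨i, rfl⟩; exact Or.inr ⟨_, rfl⟩)

/-- The second summand is added as a series of constants, each controlled by one of its bits. So
addition modulo `p` is only ever needed for constants, at a cost quadratic in the number of bits. -/
theorem bcomp_fAdd (φ ψ : X → F) (hφ : fBits β φ ⊆ B) (hψ : fBits β ψ ⊆ B) :
    BComp B (40 * symBits p a ^ 2) (fBits β fun x => φ x + ψ x) := by
  have h := Comp.accumulate (ops := Set.univ) (B := B) (n := 0) (m := 40 * symBits p a) Finset.univ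
    (fun (r : Sym p a) x => if enc β (ψ x) r then symVal β r else 0) (fBits β) φ
    (.of_subset fun _ h => Or.inl (hφ h)) fun r _ θ =>
      bcomp_add_const β θ _ _ Set.subset_union_right (Or.inl (hψ ⟨r, rfl⟩))
  have e : (φ + ∑ r : Sym p a, fun x => if enc β (ψ x) r then symVal β r else 0) =
      fun x => φ x + ψ x := by
    funext x
    simp [Finset.sum_apply, sum_symVal]
  rw [e, Finset.card_univ, card_sym] at h
  exact h.mono subset_rfl (by ring_nf; rfl) subset_rfl

/-- By bilinearity in the bits: each pair of bits contributes a constant, added under the control of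
their conjunction. -/
theorem bcomp_fMul (φ ψ : X → F) (hφ : fBits β φ ⊆ B) (hψ : fBits β ψ ⊆ B) :
    BComp B (symBits p a ^ 2 * (40 * symBits p a + 1)) (fBits β fun x => φ x * ψ x) := by
  have h := Comp.accumulate (ops := Set.univ) (B := B) (n := 0) (m := 40 * symBits p a + 1)
    Finset.univ
    (fun (r : Sym p a × Sym p a) x => if (enc β (φ x) r.1 && enc β (ψ x) r.2) then
      symVal β r.1 * symVal β r.2 else 0) (fBits β) 0 (bcomp_fBits_const β 0) fun r _ θ => by
        have h1 := BComp.op (B := B ∪ fBits β θ) (n := 0) (m := 0) (fun a b => a && b)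
          (Comp.of_mem (Or.inl (hφ ⟨r.1, rfl⟩))) (Comp.of_mem (Or.inl (hψ ⟨r.2, rfl⟩)))
        exact (h1.trans (bcomp_add_const β θ _ _ (fun _ h => Or.inl (Or.inr h)) (Or.inr rfl))).mono
          subset_rfl (by omega) subset_rfl
  have e : ((0 : X → F) + ∑ r : Sym p a × Sym p a, fun x =>
      if (enc β (φ x) r.1 && enc β (ψ x) r.2) then symVal β r.1 * symVal β r.2 else 0) =
      fun x => φ x * ψ x := by
    funext x
    simp only [zero_add, Finset.sum_apply]
    rw [← Finset.univ_product_univ, Finset.sum_product]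
    conv_rhs => rw [← sum_symVal β (φ x), ← sum_symVal β (ψ x), Finset.sum_mul_sum]
    refine Finset.sum_congr rfl fun r _ => Finset.sum_congr rfl fun r' _ => ?_
    cases enc β (φ x) r <;> cases enc β (ψ x) r' <;> simp
  rw [e, Finset.card_univ, Fintype.card_prod, card_sym] at h
  exact h.mono subset_rfl (by ring_nf; rfl) subset_rfl

/-- Computability with field additions and multiplications. -/
abbrev FComp {X F : Type*} [Field F] (B : Set (X → F)) (n : ℕ) (T : Set (X → F)) : Prop :=
  Comp {(· + ·), (· * ·)} B n T

/-- The number of Boolean gates that suffice for a field operation. -/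
def opCost (p a : ℕ) : ℕ := 40 * symBits p a ^ 2 + symBits p a ^ 2 * (40 * symBits p a + 1)

/-- Each field operation is replaced by its Boolean program; field constants become constant bits,
which are free. -/
theorem FComp.toBComp {B T : Set (X → F)} (h : FComp B n T) :
    BComp (⋃ φ ∈ B, fBits β φ) (n * opCost p a) (⋃ φ ∈ T, fBits β φ) := by
  obtain ⟨k, hk, S, hS, hT⟩ := h
  have key : BComp (⋃ φ ∈ B, fBits β φ) (k * opCost p a) (⋃ φ ∈ S, fBits β φ) := by
    clear hT hk
    induction hS with
    | base =>
      refine .of_subset ?_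
      refine Set.iUnion₂_subset fun φ hφ => ?_
      rcases hφ with hφ | ⟨c, rfl⟩
      · exact (Set.subset_biUnion_of_mem (u := fun φ => fBits β φ) hφ).trans Set.subset_union_left
      · rintro _ ⟨r, rfl⟩
        exact Or.inr ⟨enc β c r, rfl⟩
    | @step k S f g o _ ho hf hg ih =>
      have hf' := (Set.subset_biUnion_of_mem (u := fun φ => fBits β φ) hf)
      have hg' := (Set.subset_biUnion_of_mem (u := fun φ => fBits β φ) hg)
      have h1 : BComp ((⋃ φ ∈ B, fBits β φ) ∪ (⋃ φ ∈ S, fBits β φ)) (opCost p a)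
          (fBits β fun x => o (f x) (g x)) := by
        rcases ho with rfl | rfl
        · exact (bcomp_fAdd β f g (hf'.trans Set.subset_union_right)
            (hg'.trans Set.subset_union_right)).mono subset_rfl (Nat.le_add_right _ _) subset_rfl
        · exact (bcomp_fMul β f g (hf'.trans Set.subset_union_right)
            (hg'.trans Set.subset_union_right)).mono subset_rfl (Nat.le_add_left _ _) subset_rfl
      refine (ih.trans_union h1).mono subset_rfl (by ring_nf; rfl) ?_
      rw [Set.biUnion_insert, Set.union_comm]
  exact key.mono subset_rfl (Nat.mul_le_mul_right _ hk) (Set.biUnion_subset_biUnion_left hT)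

end FieldBits

/-! ### Decoding Reed–Solomon codes: the key equation -/

section KeyEquation

open Polynomial

variable {F : Type*} [Field F]

/-- A pair of solutions `(a₁, b₁)`, `(a₂, b₂)` of a key equation, with a degree bound. -/
structure KeyState (F : Type*) [Field F] where
  /-- locator part of the first solution -/
  a₁ : F[X]
  /-- evaluator part of the first solution -/
  b₁ : F[X]
  /-- locator part of the second solution -/
  a₂ : F[X]
  /-- evaluator part of the second solution -/
  b₂ : F[X]
  /-- degree bound of the first solution -/
  d : ℕ

namespace KeyState

/-- The two unit vectors. -/
def init (F : Type*) [Field F] : KeyState F := ⟨1, 0, 0, 1, 0⟩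

/-- The discrepancy of the first solution. -/
def disc₁ (S : F[X]) (r : ℕ) (st : KeyState F) : F := (st.a₁ * S - st.b₁).coeff r

/-- The discrepancy of the second solution. -/
def disc₂ (S : F[X]) (r : ℕ) (st : KeyState F) : F := (st.a₂ * S - st.b₂).coeff r

/-- The first solution is the pivot. -/
def Pivot (S : F[X]) (r : ℕ) (st : KeyState F) : Prop :=
  st.disc₁ S r ≠ 0 ∧ (2 * st.d ≤ r + 1 ∨ st.disc₂ S r = 0)

open Classical in
/-- From solutions modulo `X ^ r` to solutions modulo `X ^ (r + 1)`. -/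
def step (S : F[X]) (r : ℕ) (st : KeyState F) : KeyState F :=
  if st.Pivot S r then
    ⟨X * st.a₁, X * st.b₁, C (st.disc₁ S r) * st.a₂ - C (st.disc₂ S r) * st.a₁,
      C (st.disc₁ S r) * st.b₂ - C (st.disc₂ S r) * st.b₁, st.d + 1⟩
  else
    ⟨C (st.disc₂ S r) * st.a₁ - C (st.disc₁ S r) * st.a₂,
      C (st.disc₂ S r) * st.b₁ - C (st.disc₁ S r) * st.b₂, X * st.a₂, X * st.b₂, st.d⟩

/-- The state after `r` steps. -/
def iter (S : F[X]) : ℕ → KeyState F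
  | 0 => init F
  | r + 1 => (iter S r).step S r

/-- The invariant of the iteration. -/
structure Inv (S : F[X]) (r : ℕ) (st : KeyState F) : Prop where
  sol₁ : X ^ r ∣ st.a₁ * S - st.b₁
  sol₂ : X ^ r ∣ st.a₂ * S - st.b₂
  det : ∃ c : F, c ≠ 0 ∧ st.a₁ * st.b₂ - st.a₂ * st.b₁ = C c * X ^ r
  deg_a₁ : ∀ k, st.d < k → st.a₁.coeff k = 0
  deg_b₁ : ∀ k, st.d ≤ k → st.b₁.coeff k = 0
  deg_a₂ : ∀ k, r + 1 < k + st.d → st.a₂.coeff k = 0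
  deg_b₂ : ∀ k, r + 1 ≤ k + st.d → st.b₂.coeff k = 0
  d_le : st.d ≤ r + 1

theorem inv_init (S : F[X]) : Inv S 0 (init F) where
  sol₁ := by simp
  sol₂ := by simp
  det := ⟨1, one_ne_zero, by simp [init]⟩
  deg_a₁ k hk := by
    have : k ≠ 0 := by simp only [init] at hk; omega
    simp [init, coeff_one, this]
  deg_b₁ k hk := by simp [init]
  deg_a₂ k hk := by simp [init]
  deg_b₂ k hk := by
    have : k ≠ 0 := by simp only [init] at hk; omega
    simp [init, coeff_one, this]
  d_le := by simp [init]

theorem X_pow_succ_dvd {f : F[X]} {r : ℕ} (h : X ^ r ∣ f) (h0 : f.coeff r = 0) :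
    X ^ (r + 1) ∣ f := by
  rw [X_pow_dvd_iff] at h ⊢
  intro k hk
  rcases Nat.lt_succ_iff_lt_or_eq.1 hk with h' | rfl
  exacts [h k h', h0]

theorem coeff_X_mul_eq_zero {f : F[X]} {d : ℕ} (h : ∀ k, d ≤ k → f.coeff k = 0) {k : ℕ}
    (hk : d + 1 ≤ k) : (X * f).coeff k = 0 := by
  obtain ⟨k, rfl⟩ : ∃ j, k = j + 1 := ⟨k - 1, by omega⟩
  rw [coeff_X_mul]
  exact h k (by omega)

/-- If both discrepancies vanished, `X ^ (r + 1)` would divide the determinant `C c * X ^ r`. -/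
theorem Inv.disc_ne {S : F[X]} {r : ℕ} {st : KeyState F} (h : Inv S r st) :
    st.disc₁ S r ≠ 0 ∨ st.disc₂ S r ≠ 0 := by
  by_contra! h0
  obtain ⟨c, hc, hdet⟩ := h.det
  have h1 := X_pow_succ_dvd h.sol₁ h0.1
  have h2 := X_pow_succ_dvd h.sol₂ h0.2
  have h3 : X ^ (r + 1) ∣ C c * X ^ r := by
    rw [← hdet]
    have := dvd_sub (h1.mul_left st.a₂) (h2.mul_left st.a₁)
    refine this.trans (dvd_of_eq ?_)
    ring
  have := (X_pow_dvd_iff.1 h3) r (Nat.lt_succ_self r)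
  simp [hc] at this

/-- The pivot is multiplied by `X`, and the other solution is combined with it so that its
discrepancy cancels. The pivot has nonzero discrepancy, which keeps the constant of the determinant
nonzero. The degree bounds of the two solutions are `d` and `r + 1 - d`. The bound of the pivot does
not exceed that of the other solution, unless the latter has discrepancy zero and nothing is mixed
into it; so the combination respects the bound of the other solution, and only the bound of the
pivot grows by one. -/
theorem Inv.step {S : F[X]} {r : ℕ} {st : KeyState F} (h : Inv S r st) :
    Inv S (r + 1) (st.step S r) := by
  obtain ⟨c, hc, hdet⟩ := h.det
  have hcomb : ∀ u v : F, u * st.disc₁ S r = v * st.disc₂ S r →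
      X ^ (r + 1) ∣ C u * (st.a₁ * S - st.b₁) - C v * (st.a₂ * S - st.b₂) := fun u v huv =>
    X_pow_succ_dvd (dvd_sub (h.sol₁.mul_left _) (h.sol₂.mul_left _))
      (by rw [coeff_sub, coeff_C_mul, coeff_C_mul]; exact sub_eq_zero.2 huv)
  by_cases hp : st.Pivot S r
  · simp only [KeyState.step, if_pos hp]
    have hd : ∀ k : ℕ, r + 1 < k + st.d → st.disc₂ S r = 0 ∨ st.d < k := fun k hk => by
      rcases hp.2 with h' | h'
      · right; omega
      · exact Or.inl h'
    have hd' : ∀ k : ℕ, r + 1 ≤ k + st.d → st.disc₂ S r = 0 ∨ st.d ≤ k := fun k hk => by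
      rcases hp.2 with h' | h'
      · right; omega
      · exact Or.inl h'
    constructor
    · rw [pow_succ', mul_assoc, ← mul_sub]
      exact mul_dvd_mul_left _ h.sol₁
    · have := hcomb (st.disc₂ S r) (st.disc₁ S r) (mul_comm _ _)
      rw [← dvd_neg] at this
      refine this.trans (dvd_of_eq ?_)
      ring
    · refine ⟨st.disc₁ S r * c, mul_ne_zero hp.1 hc, ?_⟩
      rw [C_mul, pow_succ']
      linear_combination (C (st.disc₁ S r) * X) * hdet
    · intro k hk
      exact coeff_X_mul_eq_zero (d := st.d + 1) (fun j hj => h.deg_a₁ j hj) hk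
    · intro k hk
      exact coeff_X_mul_eq_zero (d := st.d) (fun j hj => h.deg_b₁ j hj) hk
    · intro k hk
      simp only at hk
      rw [coeff_sub, coeff_C_mul, coeff_C_mul, h.deg_a₂ k (by omega)]
      rcases hd k (by omega) with h' | h'
      · simp [h']
      · simp [h.deg_a₁ k h']
    · intro k hk
      simp only at hk
      rw [coeff_sub, coeff_C_mul, coeff_C_mul, h.deg_b₂ k (by omega)]
      rcases hd' k (by omega) with h' | h'
      · simp [h']
      · simp [h.deg_b₁ k h']
    · have := h.d_le
      simp only
      omega
  · simp only [KeyState.step, if_neg hp]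
    have hp' : st.disc₁ S r = 0 ∨ (r + 1 < 2 * st.d ∧ st.disc₂ S r ≠ 0) := by
      by_contra! h'
      refine hp ⟨h'.1, ?_⟩
      by_contra! h''
      exact h''.2 (h'.2 h''.1)
    have hne : st.disc₂ S r ≠ 0 := by
      rcases hp' with h' | h'
      · exact h.disc_ne.resolve_left (not_not.2 h')
      · exact h'.2
    have hd : ∀ k : ℕ, st.d ≤ k → st.disc₁ S r = 0 ∨ r + 1 < k + st.d := fun k hk => by
      rcases hp' with h' | h'
      · exact Or.inl h'
      · right; omega
    constructor
    · have := hcomb (st.disc₂ S r) (st.disc₁ S r) (mul_comm _ _)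
      refine this.trans (dvd_of_eq ?_)
      ring
    · rw [pow_succ', mul_assoc, ← mul_sub]
      exact mul_dvd_mul_left _ h.sol₂
    · refine ⟨st.disc₂ S r * c, mul_ne_zero hne hc, ?_⟩
      rw [C_mul, pow_succ']
      linear_combination (C (st.disc₂ S r) * X) * hdet
    · intro k hk
      simp only at hk
      rw [coeff_sub, coeff_C_mul, coeff_C_mul, h.deg_a₁ k hk]
      rcases hd k hk.le with h' | h'
      · simp [h']
      · simp [h.deg_a₂ k h']
    · intro k hk
      simp only at hk
      rw [coeff_sub, coeff_C_mul, coeff_C_mul, h.deg_b₁ k hk]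
      rcases hd k hk with h' | h'
      · simp [h']
      · simp [h.deg_b₂ k h'.le]
    · intro k hk
      simp only at hk
      have := h.d_le
      exact coeff_X_mul_eq_zero (d := r + 2 - st.d) (fun j hj => h.deg_a₂ j (by omega)) (by omega)
    · intro k hk
      simp only at hk
      have := h.d_le
      exact coeff_X_mul_eq_zero (d := r + 1 - st.d) (fun j hj => h.deg_b₂ j (by omega)) (by omega)
    · have := h.d_le
      simp only
      omega

theorem inv_iter (S : F[X]) (r : ℕ) : Inv S r (iter S r) := by
  induction r with
  | zero => exact inv_init S
  | succ r ih => exact ih.step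

open Classical in
/-- The locator part of the solution with the smaller degree bound. -/
def outA (n : ℕ) (st : KeyState F) : F[X] := if 2 * st.d ≤ n + 1 then st.a₁ else st.a₂

open Classical in
/-- The evaluator part of the solution with the smaller degree bound. -/
def outB (n : ℕ) (st : KeyState F) : F[X] := if 2 * st.d ≤ n + 1 then st.b₁ else st.b₂

/-- The two degree bounds add up to `n + 1`, so the smaller is at most half of it. The determinant
is a nonzero multiple of `X ^ n`, so the two parts of either solution have no common root except
possibly `0`. -/
theorem Inv.out {S : F[X]} {n : ℕ} {st : KeyState F} (h : Inv S n st) :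
    X ^ n ∣ st.outA n * S - st.outB n ∧
    (∀ z : F, z ≠ 0 → (st.outA n).eval z = 0 → (st.outB n).eval z ≠ 0) ∧
    ∃ D, 2 * D ≤ n + 1 ∧ (∀ k, D < k → (st.outA n).coeff k = 0) ∧
      ∀ k, D ≤ k → (st.outB n).coeff k = 0 := by
  obtain ⟨c, hc, hdet⟩ := h.det
  have hev : ∀ z : F, z ≠ 0 → st.a₁.eval z * st.b₂.eval z - st.a₂.eval z * st.b₁.eval z ≠ 0 :=
    fun z hz => by
      have := congrArg (eval z) hdet
      simp only [eval_sub, eval_mul, eval_C, eval_pow, eval_X] at this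
      rw [this]
      exact mul_ne_zero hc (pow_ne_zero _ hz)
  unfold outA outB
  have := h.d_le
  split_ifs with hd
  · refine ⟨h.sol₁, fun z hz h0 h1 => hev z hz (by simp [h0, h1]), st.d, hd, h.deg_a₁, h.deg_b₁⟩
  · refine ⟨h.sol₂, fun z hz h0 h1 => hev z hz (by simp [h0, h1]), n + 1 - st.d, by omega,
      fun k hk => h.deg_a₂ k (by omega), fun k hk => h.deg_b₂ k (by omega)⟩

end KeyState

theorem coeff_mul_eq_zero_of_le {A B : F[X]} {D t : ℕ} (hA : ∀ k, D < k → A.coeff k = 0)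
    (hB : ∀ k, t ≤ k → B.coeff k = 0) {k : ℕ} (hk : D + t ≤ k) : (A * B).coeff k = 0 := by
  rw [coeff_mul]
  refine Finset.sum_eq_zero fun ij hij => ?_
  rw [Finset.HasAntidiagonal.mem_antidiagonal] at hij
  by_cases h : D < ij.1
  · rw [hA _ h, zero_mul]
  · rw [hB _ (by omega), mul_zero]

/-- The syndrome polynomial. -/
def syndPoly {n : ℕ} (s : Fin n → F) : F[X] := ∑ j : Fin n, C (s j) * X ^ (j : ℕ)

/-- The error locator polynomial. -/
def locator (E : Finset Fˣ) : F[X] := ∏ y ∈ E, (1 - C (y : F) * X)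

theorem natDegree_locator_le (E : Finset Fˣ) : (locator E).natDegree ≤ E.card := by
  refine (natDegree_prod_le _ _).trans ?_
  rw [Finset.card_eq_sum_ones]
  refine Finset.sum_le_sum fun y _ => ?_
  refine (natDegree_sub_le _ _).trans (max_le (by simp) ?_)
  exact (natDegree_C_mul_le _ _).trans (natDegree_X_le)

theorem coeff_locator_eq_zero (E : Finset Fˣ) {k : ℕ} (hk : E.card < k) :
    (locator E).coeff k = 0 :=
  coeff_eq_zero_of_natDegree_lt ((natDegree_locator_le E).trans_lt hk)

variable [Fintype F] [DecidableEq F]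

/-- The error evaluator polynomial. -/
def evaluator (E : Finset Fˣ) (e : Fˣ → F) : F[X] :=
  ∑ y ∈ E, C (e y) * locator (E.erase y)

theorem coeff_evaluator_eq_zero (E : Finset Fˣ) (e : Fˣ → F) {k : ℕ} (hk : E.card ≤ k) :
    (evaluator E e).coeff k = 0 := by
  rw [evaluator, finsetSum_coeff]
  refine Finset.sum_eq_zero fun y hy => ?_
  have := Finset.card_erase_lt_of_mem hy
  rw [coeff_C_mul, coeff_locator_eq_zero _ (by omega), mul_zero]

/-- The syndrome polynomial is a combination of the truncated geometric series `∑ (yX)^j`, and the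
factor `1 - yX` of the locator turns each of them into `1 - (yX)^n`. -/
theorem locator_mul_syndPoly (n : ℕ) (E : Finset Fˣ) (e : Fˣ → F) (he : ∀ y, y ∉ E → e y = 0) :
    X ^ n ∣ locator E * syndPoly (syndrome n e) - evaluator E e := by
  have h1 : syndPoly (syndrome n e) =
      ∑ y ∈ E, C (e y) * ∑ j ∈ Finset.range n, (C (y : F) * X) ^ j := by
    have h2 : ∀ j : Fin n, syndrome n e j = ∑ y ∈ E, e y * (y : F) ^ (j : ℕ) := fun j =>
      (Finset.sum_subset (Finset.subset_univ E) fun y _ hy => by rw [he y hy, zero_mul]).symm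
    simp only [syndPoly, h2, map_sum, Finset.sum_mul, Finset.mul_sum]
    rw [Finset.sum_comm]
    refine Finset.sum_congr rfl fun y _ => ?_
    rw [← Fin.sum_univ_eq_sum_range (fun j => C (e y) * (C (y : F) * X) ^ j) n]
    refine Finset.sum_congr rfl fun j _ => ?_
    rw [mul_pow, C_mul, C_pow, mul_assoc]
  rw [h1, evaluator, Finset.mul_sum, ← Finset.sum_sub_distrib]
  refine Finset.dvd_sum fun y hy => ?_
  have h3 : locator E = (1 - C (y : F) * X) * locator (E.erase y) :=
    (Finset.mul_prod_erase E (fun y : Fˣ => (1 - C (y : F) * X : F[X])) hy).symm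
  have h4 := mul_neg_geom_sum (C (y : F) * X) n
  refine ⟨-C (e y) * locator (E.erase y) * C (y : F) ^ n, ?_⟩
  rw [h3]
  rw [mul_pow] at h4
  linear_combination (C (e y) * locator (E.erase y)) * h4

theorem eval_locator_ne_zero (E : Finset Fˣ) (y : Fˣ) (hy : y ∉ E) :
    (locator E).eval ((y⁻¹ : Fˣ) : F) ≠ 0 := by
  rw [locator, eval_prod]
  refine Finset.prod_ne_zero_iff.2 fun z hz h => hy ?_
  simp only [eval_sub, eval_one, eval_mul, eval_C, eval_X] at h
  have h' : z * y⁻¹ = 1 := Units.ext (by rw [Units.val_mul, Units.val_one]; exact (sub_eq_zero.1 h).symm)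
  rwa [← mul_inv_eq_one.1 h']

/-- The error values, from the solution of the key equation. -/
theorem error_value {n : ℕ} {a b : F[X]} {D : ℕ} (e : Fˣ → F) (he : 2 * weight e ≤ n)
    (hsol : X ^ n ∣ a * syndPoly (syndrome n e) - b)
    (hab : ∀ z : F, z ≠ 0 → a.eval z = 0 → b.eval z ≠ 0) (hD : 2 * D ≤ n + 1)
    (ha : ∀ k, D < k → a.coeff k = 0) (hb : ∀ k, D ≤ k → b.coeff k = 0) (y : Fˣ) :
    (1 - a.eval ((y⁻¹ : Fˣ) : F) ^ (Fintype.card F - 1)) * (-(y : F) * b.eval ((y⁻¹ : Fˣ) : F) *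
      (a.derivative.eval ((y⁻¹ : Fˣ) : F))⁻¹) = e y := by
  set E : Finset Fˣ := Finset.univ.filter fun y => e y ≠ 0 with hE
  have heE : ∀ y, y ∉ E → e y = 0 := fun y hy => by simpa [hE] using hy
  have hcard : 2 * E.card ≤ n := he
  set Λ := locator E with hΛ
  set Ω := evaluator E e with hΩ
  -- Both pairs solve the key equation, so the cross products agree modulo `X ^ n`. From `2 * D ≤ n
  -- + 1` and `2 * E.card ≤ n` it follows that `D + E.card ≤ n`, by integrality; hence neither
  -- product has a coefficient of index `n` or more, and they are equal.
  have hkey : a * Ω = b * Λ := by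
    rw [← sub_eq_zero]
    have h1 : X ^ n ∣ a * Ω - b * Λ := by
      have h2 := dvd_sub (hsol.mul_left Λ) ((locator_mul_syndPoly n E e heE).mul_left a)
      refine h2.trans (dvd_of_eq ?_)
      ring
    ext k
    rw [coeff_zero]
    by_cases hk : k < n
    · exact X_pow_dvd_iff.1 h1 k hk
    · rw [coeff_sub, coeff_mul_eq_zero_of_le ha
        (fun j hj => coeff_evaluator_eq_zero E e hj) (by omega), mul_comm b,
        coeff_mul_eq_zero_of_le (fun j hj => coeff_locator_eq_zero E hj) hb (by omega), sub_zero]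
  set z : F := ((y⁻¹ : Fˣ) : F) with hz
  have hz0 : z ≠ 0 := Units.ne_zero _
  have hyz : (y : F) * z = 1 := by rw [hz, ← Units.val_mul, mul_inv_cancel, Units.val_one]
  have hqc : 1 < Fintype.card F := Fintype.one_lt_card
  have hev := congrArg (eval z) hkey
  rw [eval_mul, eval_mul] at hev
  by_cases hy : y ∈ E
  · have hK : (locator (E.erase y)).eval z ≠ 0 :=
      eval_locator_ne_zero _ _ (Finset.notMem_erase y E)
    have hfac : Λ = (1 - C (y : F) * X) * locator (E.erase y) :=
      (Finset.mul_prod_erase E (fun y : Fˣ => (1 - C (y : F) * X : F[X])) hy).symm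
    have hΛ0 : Λ.eval z = 0 := by rw [hfac]; simp [hyz]
    have hΛ' : Λ.derivative.eval z = -(y : F) * (locator (E.erase y)).eval z := by
      rw [hfac]; simp [hyz]
    have hΩz : Ω.eval z = e y * (locator (E.erase y)).eval z := by
      rw [hΩ, evaluator, eval_finsetSum, Finset.sum_eq_single_of_mem y hy]
      · simp
      · intro w _ hwy
        have : (locator (E.erase w)).eval z = 0 := by
          rw [locator, eval_prod]
          exact Finset.prod_eq_zero (Finset.mem_erase.2 ⟨hwy.symm, hy⟩) (by simp [hyz])
        simp [this]
    have hey : e y ≠ 0 := by simpa [hE] using hy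
    have haz : a.eval z = 0 := by
      rw [hΛ0, mul_zero] at hev
      exact (mul_eq_zero.1 hev).resolve_right (by rw [hΩz]; exact mul_ne_zero hey hK)
    have hbz := hab z hz0 haz
    -- Forney's formula: `a` and `Λ` both vanish at `z`, so differentiating `a * Ω = b * Λ` leaves
    -- `a'(z) Ω(z) = b(z) Λ'(z)`, and the common factor `locator (E.erase y)` cancels.
    have hder := congrArg (fun f => eval z (derivative f)) hkey
    simp only [derivative_mul, eval_add, eval_mul, haz, hΛ0, hΛ', hΩz, zero_mul, mul_zero,
      add_zero, zero_add] at hder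
    have h5 : a.derivative.eval z * e y = -(y : F) * b.eval z := by
      refine mul_right_cancel₀ hK ?_
      linear_combination hder
    have h6 : a.derivative.eval z ≠ 0 := by
      intro h0
      rw [h0, zero_mul] at h5
      exact mul_ne_zero (neg_ne_zero.2 y.ne_zero) hbz h5.symm
    rw [haz, zero_pow (by omega), sub_zero, one_mul, ← h5]
    field_simp
  · have hΛ0 : Λ.eval z ≠ 0 := eval_locator_ne_zero _ _ hy
    -- Off the error positions `Λ` does not vanish, so a root of `a` would also be a root of `b`.
    -- Hence `1 - a(z) ^ (q - 1)` is the indicator of an error at `y`.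
    have haz : a.eval z ≠ 0 := by
      intro h0
      rw [h0, zero_mul] at hev
      exact hab z hz0 h0 ((mul_eq_zero.1 hev.symm).resolve_right hΛ0)
    rw [FiniteField.pow_card_sub_one_eq_one _ haz, sub_self, zero_mul, heE y hy]

end KeyEquation

/-! ### The cost of decoding, in field operations -/

section FieldPrograms

open Polynomial

variable {X F : Type*} [Field F] {B : Set (X → F)} {n m : ℕ}

theorem FComp.const (c : F) : FComp B n {fun _ : X => c} := Comp.const c

theorem FComp.of_mem {f : X → F} (h : f ∈ B) : FComp B n {f} := Comp.of_mem h

theorem FComp.add {f g : X → F} (hf : FComp B n {f}) (hg : FComp B m {g}) :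
    FComp B (n + m + 1) {fun x => f x + g x} := Comp.op (o := (· + ·)) (by simp) hf hg

theorem FComp.mul {f g : X → F} (hf : FComp B n {f}) (hg : FComp B m {g}) :
    FComp B (n + m + 1) {fun x => f x * g x} := Comp.op (o := (· * ·)) (by simp) hf hg

theorem FComp.sub {f g : X → F} (hf : FComp B n {f}) (hg : FComp B m {g}) :
    FComp B (n + m + 2) {fun x => f x - g x} := by
  have := hf.add ((FComp.const (n := 0) (-1 : F)).mul hg)
  simp only [neg_one_mul, ← sub_eq_add_neg] at this
  exact this.mono subset_rfl (by omega) subset_rfl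

theorem FComp.one_sub {f : X → F} (hf : FComp B n {f}) : FComp B (n + 2) {fun x => 1 - f x} :=
  ((FComp.const (n := 0) (1 : F)).sub hf).mono subset_rfl (by omega) subset_rfl

/-- Branching by arithmetic: in the applications `c` has only the values `0` and `1`. -/
theorem FComp.select {f g c : X → F} {k : ℕ} (hc : FComp B k {c}) (hf : FComp B n {f})
    (hg : FComp B m {g}) :
    FComp B (2 * k + n + m + 5) {fun x => c x * f x + (1 - c x) * g x} :=
  ((hc.mul hf).add ((FComp.one_sub hc).mul hg)).mono subset_rfl (by omega) subset_rfl

theorem FComp.sum {ι : Type*} (s : Finset ι) (f : ι → X → F) (h : ∀ i ∈ s, FComp B n {f i}) :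
    FComp B (s.card * (n + 1)) {fun x => ∑ i ∈ s, f i x} := by
  have := Comp.accumulate (ops := {(· + ·), (· * ·)}) (B := B) (n := 0) (m := n + 1) s f
    (fun φ => {φ}) 0 (Comp.const 0) fun i hi ψ =>
      (FComp.add (FComp.of_mem (n := 0) (Or.inr rfl)) ((h i hi).mono Set.subset_union_left le_rfl
        subset_rfl)).mono subset_rfl (by omega) subset_rfl
  refine this.mono subset_rfl (by omega) (Set.singleton_subset_iff.2 ?_)
  simp only [Set.mem_singleton_iff]
  funext x
  simp

/-- Repeated squaring, with at most two multiplications for each halving of the exponent. -/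
theorem FComp.pow {f : X → F} (hf : f ∈ B) (k : ℕ) :
    FComp B (2 * Nat.log 2 k) {fun x => f x ^ k} := by
  induction k using Nat.strong_induction_on with
  | _ k ih =>
    rcases Nat.lt_or_ge k 2 with hk | hk
    · interval_cases k
      · simpa using Comp.const (1 : F)
      · simpa using Comp.of_mem hf
    · have h1 := ih (k / 2) (by omega)
      have hlog : Nat.log 2 k = Nat.log 2 (k / 2) + 1 := by
        rw [Nat.log_of_one_lt_of_le one_lt_two hk]
      have h2 : FComp (B ∪ {fun x => f x ^ (k / 2)}) 2 {fun x => f x ^ k} := by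
        have hm : FComp (B ∪ {fun x => f x ^ (k / 2)}) 0 {fun x => f x ^ (k / 2)} :=
          .of_mem (Or.inr rfl)
        have hf' : FComp (B ∪ {fun x => f x ^ (k / 2)}) 0 {f} := .of_mem (Or.inl hf)
        rcases Nat.mod_two_eq_zero_or_one k with hk2 | hk2
        · refine (hm.mul hm).mono subset_rfl (by omega) (Set.singleton_subset_iff.2 ?_)
          simp only [Set.mem_singleton_iff, ← pow_add]
          rw [show k / 2 + k / 2 = k by omega]
        · refine ((hm.mul hm).mul hf').mono subset_rfl (by omega) (Set.singleton_subset_iff.2 ?_)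
          simp only [Set.mem_singleton_iff, ← pow_add, ← pow_succ]
          rw [show k / 2 + k / 2 + 1 = k by omega]
      exact (h1.trans h2).mono subset_rfl (by omega) subset_rfl

/-- The data of the state after `r` steps: the coefficients of the polynomials, and the degree bound
in unary. -/
def keySet (S : X → F[X]) (r : ℕ) : Set (X → F) :=
  ⋃ k : ℕ, {fun x => (KeyState.iter (S x) r).a₁.coeff k, fun x => (KeyState.iter (S x) r).b₁.coeff k,
    fun x => (KeyState.iter (S x) r).a₂.coeff k, fun x => (KeyState.iter (S x) r).b₂.coeff k,
    fun x => if (KeyState.iter (S x) r).d = k then 1 else 0}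

theorem keySet_zero (S : X → F[X]) : FComp B n (keySet S 0) := by
  refine .of_subset ?_
  refine Set.iUnion_subset fun k => ?_
  rintro _ (rfl | rfl | rfl | rfl | rfl)
  · exact Or.inr ⟨(1 : F[X]).coeff k, rfl⟩
  · exact Or.inr ⟨(0 : F[X]).coeff k, rfl⟩
  · exact Or.inr ⟨(0 : F[X]).coeff k, rfl⟩
  · exact Or.inr ⟨(1 : F[X]).coeff k, rfl⟩
  · exact Or.inr ⟨if 0 = k then 1 else 0, rfl⟩

theorem fcomp_coeff_mul_sub (S : X → F[X]) (hS : ∀ k, (fun x => (S x).coeff k) ∈ B)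
    (a b : X → F[X]) (ha : ∀ k, (fun x => (a x).coeff k) ∈ B)
    (hb : ∀ k, (fun x => (b x).coeff k) ∈ B) (r : ℕ) :
    FComp B (2 * r + 4) {fun x => (a x * S x - b x).coeff r} := by
  have h := (FComp.sum (Finset.HasAntidiagonal.antidiagonal r) (fun (ij : ℕ × ℕ) x => (a x).coeff ij.1 * (S x).coeff ij.2)
    fun ij _ => FComp.mul (FComp.of_mem (n := 0) (ha ij.1)) (FComp.of_mem (n := 0) (hS ij.2))).sub
    (FComp.of_mem (n := 0) (hb r))
  rw [Finset.Nat.card_antidiagonal] at h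
  simpa only [coeff_sub, coeff_mul] using h.mono subset_rfl (by omega : _ ≤ 2 * r + 4) subset_rfl

theorem KeyState.Inv.coeff_eq_zero {S : F[X]} {r : ℕ} {st : KeyState F} (h : st.Inv S r) {k : ℕ}
    (hk : r + 1 < k) : st.a₁.coeff k = 0 ∧ st.b₁.coeff k = 0 ∧ st.a₂.coeff k = 0 ∧
      st.b₂.coeff k = 0 ∧ st.d ≠ k := by
  have := h.d_le
  exact ⟨h.deg_a₁ k (by omega), h.deg_b₁ k (by omega), h.deg_a₂ k (by omega), h.deg_b₂ k (by omega),
    by omega⟩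

/-- This is the use of the unary representation of `d`: the indicator of a threshold is a sum of
indicators of values. -/
theorem fcomp_threshold (S : X → F[X]) (r t : ℕ) (hB : keySet S r ⊆ B) :
    FComp B (t + 1) {fun x => if 2 * (KeyState.iter (S x) r).d ≤ t then 1 else 0} := by
  have h := FComp.sum (B := B) (n := 0) (Finset.range (t / 2 + 1))
    (fun k x => if (KeyState.iter (S x) r).d = k then 1 else 0)
    fun k _ => Comp.of_mem (hB (Set.mem_iUnion.2 ⟨k, by simp⟩))
  rw [Finset.card_range] at h
  refine h.mono subset_rfl (by omega) (Set.singleton_subset_iff.2 ?_)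
  simp only [Set.mem_singleton_iff]
  funext x
  rw [Finset.sum_ite_eq]
  simp only [Finset.mem_range]
  congr 1
  rw [eq_iff_iff]
  omega

theorem fcomp_shift (f : X → F[X]) (hf : ∀ k, (fun x => (f x).coeff k) ∈ B) (k : ℕ) :
    FComp B 0 {fun x => (Polynomial.X * f x).coeff k} := by
  cases k with
  | zero => simpa using Comp.const (0 : F)
  | succ k => simpa using Comp.of_mem (hf k)

variable [Fintype F] [DecidableEq F]

/-- Nonzero elements have `(q - 1)`-th power `1`, so `1 - f ^ (q - 1)` tests for zero without
branching. -/
theorem FComp.isZero {f : X → F} (hf : f ∈ B) :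
    FComp B (2 * Nat.log 2 (Fintype.card F) + 2) {fun x => if f x = 0 then 1 else 0} := by
  have hq : 1 < Fintype.card F := Fintype.one_lt_card
  refine (FComp.one_sub (FComp.pow hf (Fintype.card F - 1))).mono subset_rfl ?_
    (Set.singleton_subset_iff.2 ?_)
  · have := Nat.log_mono_right (b := 2) (Nat.sub_le (Fintype.card F) 1)
    omega
  · simp only [Set.mem_singleton_iff]
    funext x
    split_ifs with h
    · rw [h, zero_pow (by omega), sub_zero]
    · rw [FiniteField.pow_card_sub_one_eq_one _ h, sub_self]

/-- Inversion is the power `q - 2`; the exponent has to be positive for `0⁻¹ = 0` to come out right.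
-/
theorem FComp.inv {f : X → F} (hq : 3 ≤ Fintype.card F) (hf : f ∈ B) :
    FComp B (2 * Nat.log 2 (Fintype.card F)) {fun x => (f x)⁻¹} := by
  refine (FComp.pow hf (Fintype.card F - 2)).mono subset_rfl ?_ (Set.singleton_subset_iff.2 ?_)
  · have := Nat.log_mono_right (b := 2) (Nat.sub_le (Fintype.card F) 2)
    omega
  · simp only [Set.mem_singleton_iff]
    funext x
    by_cases h : f x = 0
    · rw [h, zero_pow (by omega), inv_zero]
    · refine inv_eq_of_mul_eq_one_right ?_
      rw [← pow_succ', show Fintype.card F - 2 + 1 = Fintype.card F - 1 by omega,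
        FiniteField.pow_card_sub_one_eq_one _ h]

-- The pivot test is arithmetized: products of indicators are conjunctions, and `1 - ·` is negation.
-- The disjunction in `Pivot` is expressed through both.
open Classical in
theorem fcomp_pivot (S : X → F[X]) (hS : ∀ k, (fun x => (S x).coeff k) ∈ B) (r : ℕ)
    (hB : keySet S r ⊆ B) :
    FComp B (5 * r + 4 * Nat.log 2 (Fintype.card F) + 24)
      {fun x => (KeyState.iter (S x) r).disc₁ (S x) r, fun x => (KeyState.iter (S x) r).disc₂ (S x) r,
        fun x => if (KeyState.iter (S x) r).Pivot (S x) r then 1 else 0} := by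
  have hk : ∀ k, (fun x => (KeyState.iter (S x) r).a₁.coeff k) ∈ B ∧
      (fun x => (KeyState.iter (S x) r).b₁.coeff k) ∈ B ∧
      (fun x => (KeyState.iter (S x) r).a₂.coeff k) ∈ B ∧
      (fun x => (KeyState.iter (S x) r).b₂.coeff k) ∈ B := fun k =>
    ⟨hB (Set.mem_iUnion.2 ⟨k, by simp⟩), hB (Set.mem_iUnion.2 ⟨k, by simp⟩),
      hB (Set.mem_iUnion.2 ⟨k, by simp⟩), hB (Set.mem_iUnion.2 ⟨k, by simp⟩)⟩
  have h1 := fcomp_coeff_mul_sub S hS _ _ (fun k => (hk k).1) (fun k => (hk k).2.1) r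
  have h2 := fcomp_coeff_mul_sub S hS _ _ (fun k => (hk k).2.2.1) (fun k => (hk k).2.2.2) r
  have h12 := h1.union h2
  set T : Set (X → F) := _ ∪ _ with hT
  have h3 : FComp (B ∪ T) (r + 4 * Nat.log 2 (Fintype.card F) + 16)
      {fun x => if (KeyState.iter (S x) r).Pivot (S x) r then 1 else 0} := by
    have z1 := FComp.isZero (B := B ∪ T) (Or.inr (Or.inl rfl))
    have z2 := FComp.isZero (B := B ∪ T) (Or.inr (Or.inr rfl))
    have h : FComp (B ∪ T) _ _ := (fcomp_threshold S r (r + 1) hB).mono Set.subset_union_left le_rfl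
      subset_rfl
    refine ((z1.one_sub).mul ((h.one_sub.mul z2.one_sub).one_sub)).mono subset_rfl (by omega)
      (Set.singleton_subset_iff.2 ?_)
    simp only [Set.mem_singleton_iff, KeyState.Pivot, KeyState.disc₁, KeyState.disc₂]
    funext x
    by_cases c1 : ((KeyState.iter (S x) r).a₁ * S x - (KeyState.iter (S x) r).b₁).coeff r = 0 <;>
      by_cases c2 : ((KeyState.iter (S x) r).a₂ * S x - (KeyState.iter (S x) r).b₂).coeff r = 0 <;>
        by_cases c3 : 2 * (KeyState.iter (S x) r).d ≤ r + 1 <;> simp [c1, c2, c3, -coeff_sub]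
  refine (h12.trans_union h3).mono subset_rfl (by omega) ?_
  rintro _ (rfl | rfl | rfl)
  · exact Or.inl (Or.inl rfl)
  · exact Or.inl (Or.inr rfl)
  · exact Or.inr rfl

/-- Once the discrepancies and the pivot are known, each new coefficient takes `O(1)` operations.
Only the indices below `n + 2` matter, as the degree bounds make all other coefficients constantly
zero. -/
theorem fcomp_key_step (S : X → F[X]) (hS : ∀ k, (fun x => (S x).coeff k) ∈ B) {r : ℕ} (hr : r < n)
    (hB : keySet S r ⊆ B) :
    FComp B (105 * n + 4 * Nat.log 2 (Fintype.card F) + 124) (keySet S (r + 1)) := by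
  classical
  have hk : ∀ k, (fun x => (KeyState.iter (S x) r).a₁.coeff k) ∈ B ∧
      (fun x => (KeyState.iter (S x) r).b₁.coeff k) ∈ B ∧
      (fun x => (KeyState.iter (S x) r).a₂.coeff k) ∈ B ∧
      (fun x => (KeyState.iter (S x) r).b₂.coeff k) ∈ B ∧
      (fun x => if (KeyState.iter (S x) r).d = k then (1 : F) else 0) ∈ B := fun k =>
    ⟨hB (Set.mem_iUnion.2 ⟨k, by simp⟩), hB (Set.mem_iUnion.2 ⟨k, by simp⟩),
      hB (Set.mem_iUnion.2 ⟨k, by simp⟩), hB (Set.mem_iUnion.2 ⟨k, by simp⟩),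
      hB (Set.mem_iUnion.2 ⟨k, by simp⟩)⟩
  have hpiv := fcomp_pivot S hS r hB
  set T : Set (X → F) := {fun x => (KeyState.iter (S x) r).disc₁ (S x) r,
    fun x => (KeyState.iter (S x) r).disc₂ (S x) r,
    fun x => if (KeyState.iter (S x) r).Pivot (S x) r then 1 else 0} with hT
  have hΔ1 : FComp (B ∪ T) 0 {fun x => (KeyState.iter (S x) r).disc₁ (S x) r} :=
    .of_mem (Or.inr (by simp [hT]))
  have hΔ2 : FComp (B ∪ T) 0 {fun x => (KeyState.iter (S x) r).disc₂ (S x) r} :=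
    .of_mem (Or.inr (by simp [hT]))
  have hπ : FComp (B ∪ T) 0 {fun x => if (KeyState.iter (S x) r).Pivot (S x) r then (1 : F) else 0} :=
    .of_mem (Or.inr (by simp [hT]))
  have hmem : ∀ {f : X → F}, f ∈ B → FComp (B ∪ T) 0 {f} := fun hf => .of_mem (Or.inl hf)
  have hmono : FComp (B ∪ T) ((Finset.range (n + 2)).card * 50) (⋃ k ∈ Finset.range (n + 2),
      {fun x => (KeyState.iter (S x) (r + 1)).a₁.coeff k,
        fun x => (KeyState.iter (S x) (r + 1)).b₁.coeff k,
        fun x => (KeyState.iter (S x) (r + 1)).a₂.coeff k,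
        fun x => (KeyState.iter (S x) (r + 1)).b₂.coeff k,
        fun x => if (KeyState.iter (S x) (r + 1)).d = k then 1 else 0}) := by
    refine Comp.biUnion _ _ fun k _ => ?_
    have c1 : FComp (B ∪ T) 10 {fun x => (KeyState.iter (S x) (r + 1)).a₁.coeff k} := by
      have := FComp.select hπ (fcomp_shift _ (fun k => Or.inl (hk k).1) k)
        ((hΔ2.mul (hmem (hk k).1)).sub (hΔ1.mul (hmem (hk k).2.2.1)))
      refine this.mono subset_rfl (by omega) (Set.singleton_subset_iff.2 ?_)
      simp only [Set.mem_singleton_iff, KeyState.iter, KeyState.step]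
      funext x
      split_ifs <;> simp
    have c2 : FComp (B ∪ T) 10 {fun x => (KeyState.iter (S x) (r + 1)).b₁.coeff k} := by
      have := FComp.select hπ (fcomp_shift _ (fun k => Or.inl (hk k).2.1) k)
        ((hΔ2.mul (hmem (hk k).2.1)).sub (hΔ1.mul (hmem (hk k).2.2.2.1)))
      refine this.mono subset_rfl (by omega) (Set.singleton_subset_iff.2 ?_)
      simp only [Set.mem_singleton_iff, KeyState.iter, KeyState.step]
      funext x
      split_ifs <;> simp
    have c3 : FComp (B ∪ T) 10 {fun x => (KeyState.iter (S x) (r + 1)).a₂.coeff k} := by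
      have := FComp.select hπ ((hΔ1.mul (hmem (hk k).2.2.1)).sub (hΔ2.mul (hmem (hk k).1)))
        (fcomp_shift _ (fun k => Or.inl (hk k).2.2.1) k)
      refine this.mono subset_rfl (by omega) (Set.singleton_subset_iff.2 ?_)
      simp only [Set.mem_singleton_iff, KeyState.iter, KeyState.step]
      funext x
      split_ifs <;> simp
    have c4 : FComp (B ∪ T) 10 {fun x => (KeyState.iter (S x) (r + 1)).b₂.coeff k} := by
      have := FComp.select hπ ((hΔ1.mul (hmem (hk k).2.2.2.1)).sub (hΔ2.mul (hmem (hk k).2.1)))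
        (fcomp_shift _ (fun k => Or.inl (hk k).2.2.2.1) k)
      refine this.mono subset_rfl (by omega) (Set.singleton_subset_iff.2 ?_)
      simp only [Set.mem_singleton_iff, KeyState.iter, KeyState.step]
      funext x
      split_ifs <;> simp
    have c5 : FComp (B ∪ T) 10
        {fun x => if (KeyState.iter (S x) (r + 1)).d = k then (1 : F) else 0} := by
      have hprev : FComp (B ∪ T) 0
          {fun x => if (KeyState.iter (S x) r).d + 1 = k then (1 : F) else 0} := by
        cases k with
        | zero => simpa using Comp.const (0 : F)
        | succ k => simpa using hmem (hk k).2.2.2.2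
      refine (FComp.select hπ hprev (hmem (hk k).2.2.2.2)).mono subset_rfl (by omega)
        (Set.singleton_subset_iff.2 ?_)
      simp only [Set.mem_singleton_iff, KeyState.iter, KeyState.step]
      funext x
      by_cases hp : (KeyState.iter (S x) r).Pivot (S x) r <;> simp [hp]
    refine (c1.union (c2.union (c3.union (c4.union c5)))).mono subset_rfl (by omega) ?_
    rintro _ (rfl | rfl | rfl | rfl | rfl)
    · exact Or.inl rfl
    · exact Or.inr (Or.inl rfl)
    · exact Or.inr (Or.inr (Or.inl rfl))
    · exact Or.inr (Or.inr (Or.inr (Or.inl rfl)))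
    · exact Or.inr (Or.inr (Or.inr (Or.inr rfl)))
  have h0 : FComp B 0 {fun _ : X => (0 : F)} := Comp.const 0
  refine ((hpiv.trans hmono).union h0).mono subset_rfl ?_ ?_
  · rw [Finset.card_range]
    nlinarith
  · refine Set.iUnion_subset fun k => ?_
    by_cases hkn : k < n + 2
    · exact fun f hf => Or.inl (Set.mem_iUnion₂.2 ⟨k, Finset.mem_range.2 hkn, hf⟩)
    · have hz := fun x => (KeyState.inv_iter (S x) (r + 1)).coeff_eq_zero (k := k) (by omega)
      rintro _ (rfl | rfl | rfl | rfl | rfl)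
      all_goals
        refine Or.inr (Set.mem_singleton_iff.2 (funext fun x => ?_))
        obtain ⟨h1, h2, h3, h4, h5⟩ := hz x
        first | assumption | exact if_neg h5

/-- The number of field operations of the decoder. -/
def decodeCost (m n q : ℕ) : ℕ :=
  n * (105 * n + 4 * Nat.log 2 q + 124) + (13 * n + 20) + m * (6 * n + 4 * Nat.log 2 q + 24)

/-- The key equation takes `n` steps of `O(n + log q)` operations. Then the chosen solution and its
derivative are evaluated at each of the `m` points and inserted into the formula of `error_value`,
the only place where the bound on the weight enters. -/
theorem fcomp_decode (hq : 3 ≤ Fintype.card F) {n : ℕ} (hn : 1 ≤ n) (e : X → Fˣ → F)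
    (he : ∀ x, 2 * weight (e x) ≤ n)
    (hB : ∀ j, (fun x => syndrome n (e x) j) ∈ B) :
    FComp B (decodeCost (Fintype.card Fˣ) n (Fintype.card F)) (⋃ y : Fˣ, {fun x => e x y}) := by
  classical
  set S : X → F[X] := fun x => syndPoly (syndrome n (e x)) with hSdef
  have hS : ∀ {B' : Set (X → F)}, B ∪ Set.range (Function.const X) ⊆ B' →
      ∀ k, (fun x => (S x).coeff k) ∈ B' := by
    intro B' hB' k
    refine hB' ?_
    by_cases hk : k < n
    · refine Or.inl ?_
      convert hB ⟨k, hk⟩ using 1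
      funext x
      simp only [hSdef, syndPoly, finsetSum_coeff, coeff_C_mul, coeff_X_pow]
      rw [Finset.sum_eq_single ⟨k, hk⟩]
      · simp
      · intro j _ hj
        have : k ≠ j := fun h => hj (Fin.ext h.symm)
        simp [this]
      · simp
    · refine Or.inr ⟨0, ?_⟩
      funext x
      simp only [hSdef, syndPoly, finsetSum_coeff, coeff_C_mul, coeff_X_pow]
      refine (Finset.sum_eq_zero fun j _ => ?_).symm
      have : k ≠ j := by have := j.2; omega
      simp [this]
  -- The coefficients of the syndrome polynomial of index `n` and above are the constant zero, which
  -- is free but need not be a member of `B`. With the constants adjoined, all coefficients are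
  -- members.
  set B1 := B ∪ Set.range (Function.const X) with hB1
  have hconst : FComp B 0 B1 := .of_subset subset_rfl
  have hiter : FComp B (n * (105 * n + 4 * Nat.log 2 (Fintype.card F) + 124)) (B1 ∪ keySet S n) := by
    have := Comp.chain (ops := {(· + ·), (· * ·)}) (B := B) (n := 0)
      (fun r => B1 ∪ keySet S r) n (hconst.union (keySet_zero (n := 0) S)) fun r hr =>
        (((Comp.of_subset (n := 0) (B := B ∪ (B1 ∪ keySet S r)) (T := B1)
          (fun _ h => Or.inl (Or.inr (Or.inl h)))).union
          (fcomp_key_step (B := B ∪ (B1 ∪ keySet S r)) S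
          (hS fun _ h => Or.inr (Or.inl h)) hr fun _ h => Or.inr (Or.inr h))).mono subset_rfl
            le_rfl subset_rfl)
    exact this.mono subset_rfl (by simp) subset_rfl
  set B2 := B ∪ (B1 ∪ keySet S n) with hB2
  have hk : ∀ k, (fun x => (KeyState.iter (S x) n).a₁.coeff k) ∈ B2 ∧
      (fun x => (KeyState.iter (S x) n).b₁.coeff k) ∈ B2 ∧
      (fun x => (KeyState.iter (S x) n).a₂.coeff k) ∈ B2 ∧
      (fun x => (KeyState.iter (S x) n).b₂.coeff k) ∈ B2 := fun k =>
    ⟨Or.inr (Or.inr (Set.mem_iUnion.2 ⟨k, by simp⟩)),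
      Or.inr (Or.inr (Set.mem_iUnion.2 ⟨k, by simp⟩)),
      Or.inr (Or.inr (Set.mem_iUnion.2 ⟨k, by simp⟩)),
      Or.inr (Or.inr (Set.mem_iUnion.2 ⟨k, by simp⟩))⟩
  have hout : ∀ x, _ := fun x => (KeyState.inv_iter (S x) n).out
  have hcoef : ∀ x k, n + 2 ≤ k → ((KeyState.iter (S x) n).outA n).coeff k = 0 ∧
      ((KeyState.iter (S x) n).outB n).coeff k = 0 := fun x k hk => by
    obtain ⟨-, -, D, hD, hA, hB⟩ := hout x
    exact ⟨hA k (by omega), hB k (by omega)⟩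
  set a : X → F[X] := fun x => (KeyState.iter (S x) n).outA n with ha
  set b : X → F[X] := fun x => (KeyState.iter (S x) n).outB n with hb
  have hsel : FComp B2 (13 * n + 20) ((⋃ k ∈ Finset.range (n + 2),
      {fun x => (a x).coeff k}) ∪ (⋃ k ∈ Finset.range (n + 2), {fun x => (b x).coeff k})) := by
    have hthr := fcomp_threshold S n (n + 1) (B := B2) fun _ h => Or.inr (Or.inr h)
    set T : Set (X → F) := {_} with hT
    have hc : FComp (B2 ∪ T) 0 T := .of_subset fun _ h => Or.inl (Or.inr h)
    have h1 := Comp.biUnion (ops := {(· + ·), (· * ·)}) (B := B2 ∪ T) (n := 5)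
      (Finset.range (n + 2)) (fun k => {fun x => (a x).coeff k}) fun k _ => by
        refine (FComp.select hc (FComp.of_mem (n := 0) (Or.inl (hk k).1))
          (FComp.of_mem (n := 0) (Or.inl (hk k).2.2.1))).mono subset_rfl (by omega)
          (Set.singleton_subset_iff.2 ?_)
        simp only [Set.mem_singleton_iff, ha, KeyState.outA]
        funext x
        split_ifs <;> simp
    have h2 := Comp.biUnion (ops := {(· + ·), (· * ·)}) (B := B2 ∪ T) (n := 5)
      (Finset.range (n + 2)) (fun k => {fun x => (b x).coeff k}) fun k _ => by
        refine (FComp.select hc (FComp.of_mem (n := 0) (Or.inl (hk k).2.1))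
          (FComp.of_mem (n := 0) (Or.inl (hk k).2.2.2))).mono subset_rfl (by omega)
          (Set.singleton_subset_iff.2 ?_)
        simp only [Set.mem_singleton_iff, hb, KeyState.outB]
        funext x
        split_ifs <;> simp
    rw [Finset.card_range] at h1 h2
    exact (hthr.trans (h1.union h2)).mono subset_rfl (by omega) subset_rfl
  set T : Set (X → F) := _ ∪ _ with hT
  have hvals : FComp (B2 ∪ T)
      (Fintype.card Fˣ * (6 * n + 4 * Nat.log 2 (Fintype.card F) + 24)) (⋃ y : Fˣ, {fun x => e x y}) := by
    refine Comp.iUnion _ fun y => ?_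
    set z : F := ((y⁻¹ : Fˣ) : F) with hz
    have hdeg : ∀ f : F[X], (∀ k, n + 2 ≤ k → f.coeff k = 0) → f.natDegree < n + 2 := fun f hf => by
      by_contra! h
      have h0 : f ≠ 0 := by rintro rfl; simp at h
      exact h0 (leadingCoeff_eq_zero.1 (hf _ h))
    have hdot : ∀ (f : X → F[X]) (c : ℕ → F), (∀ k, k < n + 2 → (fun x => (f x).coeff k) ∈ B2 ∪ T) →
        FComp (B2 ∪ T) (2 * (n + 2)) {fun x => ∑ k ∈ Finset.range (n + 2), (f x).coeff k * c k} := by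
      intro f c hf
      have := FComp.sum (Finset.range (n + 2)) (fun k x => (f x).coeff k * c k) fun k hk =>
        FComp.mul (FComp.of_mem (n := 0) (hf k (Finset.mem_range.1 hk))) (FComp.const (n := 0) (c k))
      rw [Finset.card_range] at this
      exact this.mono subset_rfl (by omega) subset_rfl
    have haT : ∀ k, k < n + 2 → (fun x => (a x).coeff k) ∈ B2 ∪ T := fun k hk =>
      Or.inr (Or.inl (Set.mem_biUnion (Finset.mem_coe.2 (Finset.mem_range.2 hk)) rfl))
    have hbT : ∀ k, k < n + 2 → (fun x => (b x).coeff k) ∈ B2 ∪ T := fun k hk =>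
      Or.inr (Or.inr (Set.mem_biUnion (Finset.mem_coe.2 (Finset.mem_range.2 hk)) rfl))
    have h1 : FComp (B2 ∪ T) (2 * (n + 2)) {fun x => (a x).eval z} := by
      have := hdot a (fun k => z ^ k) haT
      convert this using 4 with x
      exact eval_eq_sum_range' (hdeg _ fun k hk => (hcoef x k hk).1) z
    have h2 : FComp (B2 ∪ T) (2 * (n + 2)) {fun x => (b x).eval z} := by
      have := hdot b (fun k => z ^ k) hbT
      convert this using 4 with x
      exact eval_eq_sum_range' (hdeg _ fun k hk => (hcoef x k hk).2) z
    have h3 : FComp (B2 ∪ T) (2 * (n + 2)) {fun x => (a x).derivative.eval z} := by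
      have := hdot a (fun k => (k : F) * z ^ (k - 1)) haT
      convert this using 4 with x
      rw [derivative_eval, sum_over_range' _ _ _ (hdeg _ fun k hk => (hcoef x k hk).1)]
      · simp only [mul_assoc, ha]
      · simp
    have h123 := h1.union (h2.union h3)
    set U : Set (X → F) := {fun x => (a x).eval z} ∪
      ({fun x => (b x).eval z} ∪ {fun x => (a x).derivative.eval z}) with hU
    have g1 := FComp.pow (B := B2 ∪ T ∪ U) (f := fun x => (a x).eval z) (Or.inr (Or.inl rfl)) (Fintype.card F - 1)
    have g2 : FComp (B2 ∪ T ∪ U) 0 {fun x => (b x).eval z} := .of_mem (Or.inr (Or.inr (Or.inl rfl)))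
    have g3 := FComp.inv (B := B2 ∪ T ∪ U) (f := fun x => (a x).derivative.eval z) hq (Or.inr (Or.inr (Or.inr rfl)))
    have g := g1.one_sub.mul (((FComp.const (n := 0) (-(y : F))).mul g2).mul g3)
    refine (h123.trans g).mono subset_rfl ?_ (Set.singleton_subset_iff.2 ?_)
    · have := Nat.log_mono_right (b := 2) (Nat.sub_le (Fintype.card F) 1)
      omega
    · simp only [Set.mem_singleton_iff]
      funext x
      obtain ⟨h1, h2, D, hD, hA, hB⟩ := hout x
      exact (error_value (e x) (he x) h1 h2 hD hA hB y).symm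
  exact (hiter.trans (hsel.trans hvals)).mono subset_rfl
    (by unfold decodeCost; omega) subset_rfl

/-- The scalar `c` is `1` for the update of the syndrome, and `-1` for the recovery of the old value
from the new one. -/
theorem fcomp_syndrome {n : ℕ} (e : X → Fˣ → F) (s : X → Fin n → F)
    (he : ∀ y, (fun x => e x y) ∈ B) (hs : ∀ j, (fun x => s x j) ∈ B) (c : F) :
    FComp B (n * (3 * Fintype.card Fˣ + 2)) (⋃ j : Fin n, {fun x => s x j + c * syndrome n (e x) j}) := by
  have := Comp.iUnion (ops := {(· + ·), (· * ·)}) (B := B) (n := 3 * Fintype.card Fˣ + 2)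
    (fun j : Fin n => {fun x => s x j + c * syndrome n (e x) j}) fun j => by
      have h1 := FComp.sum (B := B) Finset.univ (fun (y : Fˣ) x => e x y * (y : F) ^ (j : ℕ))
        fun y _ => FComp.mul (FComp.of_mem (n := 0) (he y)) (FComp.const (n := 0) ((y : F) ^ (j : ℕ)))
      refine (FComp.add (FComp.of_mem (n := 0) (hs j)) ((FComp.const (n := 0) c).mul h1)).mono
        subset_rfl ?_ subset_rfl
      rw [Finset.card_univ]
      omega
  rwa [Fintype.card_fin] at this

end FieldPrograms

/-! ### Circuits with clean ancillas -/

section Impl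

variable {W W' W'' ι J : Type*}

theorem emb_emb (f : W ↪ W') (g : W' ↪ W'') {env : W' → Bool} {env' env'' : W'' → Bool}
    (h : ∀ w, w ∉ Set.range f → env'' (g w) = env w)
    (h' : ∀ w, w ∉ Set.range g → env'' w = env' w) (ψ : QState W) :
    emb g env' (emb f env ψ) = emb (f.trans g) env'' ψ := by
  classical
  funext t
  simp only [emb, ← ite_and]
  congr 1
  rw [eq_iff_iff]
  constructor
  · rintro ⟨h1, h2⟩ w hw
    by_cases hg : w ∈ Set.range g
    · obtain ⟨v, rfl⟩ := hg
      have hv : v ∉ Set.range f := fun ⟨i, hi⟩ => hw ⟨i, by simp [hi]⟩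
      rw [h v hv]
      exact h2 v hv
    · rw [h' w hg, h1 w hg]
  · intro h1
    refine ⟨fun w hw => ?_, fun w hw => ?_⟩
    · rw [← h' w hw]
      exact h1 w fun ⟨i, hi⟩ => hw ⟨f i, hi⟩
    · rw [← h w hw]
      exact h1 (g w) fun ⟨i, hi⟩ => hw ⟨i, g.injective hi⟩

/-- The state `ψ` together with ancillas in the state `|0⟩`. -/
def ext (ψ : QState W) : QState (W ⊕ ℕ) := emb Function.Embedding.inl (fun _ => false) ψ

theorem ext_ket (s : W → Bool) : ext (ket s) = ket (Sum.elim s fun _ => false) := by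
  refine emb_ket _ (fun i => rfl) ?_
  rintro (w | k) hw
  · exact absurd ⟨w, rfl⟩ hw
  · rfl

theorem ext_sum (s : Finset ι) (ψ : ι → QState W) : ext (∑ i ∈ s, ψ i) = ∑ i ∈ s, ext (ψ i) :=
  emb_sum _ _ _ _

theorem ext_smul (a : ℂ) (ψ : QState W) : ext (a • ψ) = a • ext ψ := emb_smul _ _ _ _

theorem ext_add (ψ φ : QState W) : ext (ψ + φ) = ext ψ + ext φ := emb_add _ _ _ _

/-- Some circuit with at most `N` gates and clean ancillas maps each `ψ i` to `φ i`. -/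
def Impl (N : ℕ) (ψ φ : ι → QState W) : Prop :=
  ∃ c : Circuit (W ⊕ ℕ), c.length ≤ N ∧ ∀ i, c.run (ext (ψ i)) = ext (φ i)

variable {N M : ℕ} {ψ φ χ : ι → QState W}

theorem Impl.mono (h : Impl N ψ φ) (hN : N ≤ M) : Impl M ψ φ := by
  obtain ⟨c, hc, h⟩ := h
  exact ⟨c, hc.trans hN, h⟩

theorem Impl.refl : Impl N ψ ψ := ⟨[], Nat.zero_le _, fun _ => rfl⟩

theorem Impl.comp (h : Impl N ψ φ) (h' : Impl M φ χ) : Impl (N + M) ψ χ := by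
  obtain ⟨c, hc, h⟩ := h
  obtain ⟨d, hd, h'⟩ := h'
  refine ⟨c ++ d, by rw [List.length_append]; omega, fun i => ?_⟩
  rw [Circuit.run_append, h, h']

theorem Impl.symm (h : Impl N ψ φ) : Impl N φ ψ := by
  obtain ⟨c, hc, h⟩ := h
  exact ⟨c.inv, by rwa [Circuit.length_inv], fun i => by rw [← h i, Circuit.run_inv_run]⟩

theorem Impl.reindex (h : Impl N ψ φ) (f : J → ι) :
    Impl N (fun j => ψ (f j)) (fun j => φ (f j)) := by
  obtain ⟨c, hc, h⟩ := h
  exact ⟨c, hc, fun j => h (f j)⟩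

theorem Impl.congr {ψ' φ' : ι → QState W} (h : Impl N ψ φ) (hψ : ∀ i, ψ' i = ψ i)
    (hφ : ∀ i, φ' i = φ i) : Impl N ψ' φ' := by
  obtain rfl : ψ' = ψ := funext hψ
  obtain rfl : φ' = φ := funext hφ
  exact h

/-- By linearity, constructions need only be checked on basis states. -/
theorem Impl.sum (h : Impl N ψ φ) (s : J → Finset ι) (a : J → ι → ℂ) :
    Impl N (fun j => ∑ i ∈ s j, a j i • ψ i) (fun j => ∑ i ∈ s j, a j i • φ i) := by
  obtain ⟨c, hc, h⟩ := h
  refine ⟨c, hc, fun j => ?_⟩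
  simp only [ext_sum, ext_smul, Circuit.run_sum, Circuit.run_smul, h]

theorem sum_ket [Fintype W] [DecidableEq W] (ψ : QState W) : ∑ s, ψ s • ket s = ψ := by
  funext t
  simp [Finset.sum_apply, ket_apply]

theorem Impl.total [Fintype W] [DecidableEq W] {φ : (W → Bool) → QState W} (h : Impl N ket φ) :
    Impl N (fun ψ => ψ) (fun ψ : QState W => ∑ s, ψ s • φ s) :=
  (h.sum (fun _ => Finset.univ) fun ψ => ψ).congr (fun ψ => (sum_ket ψ).symm) fun _ => rfl

theorem Impl.gate (g : Gate W) (ψ : ι → QState W) : Impl 1 ψ (fun i => g.apply (ψ i)) :=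
  ⟨[g.relabel Function.Embedding.inl], le_rfl, fun _ => Gate.apply_relabel _ _ _ _⟩

theorem Impl.circuit (c : Circuit W) (ψ : ι → QState W) :
    Impl c.length ψ (fun i => c.run (ψ i)) :=
  ⟨c.relabel Function.Embedding.inl, by rw [Circuit.length_relabel],
    fun i => Circuit.run_relabel _ _ _ _⟩

/-- Adding further qubits. -/
theorem Impl.emb (h : Impl N ψ φ) (f : W ↪ W') :
    Impl N (fun i : ι × (W' → Bool) => emb f i.2 (ψ i.1)) (fun i => DQI.emb f i.2 (φ i.1)) := by
  obtain ⟨c, hc, h⟩ := h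
  let g : W ⊕ ℕ ↪ W' ⊕ ℕ := f.sumMap (Function.Embedding.refl ℕ)
  have key : ∀ (env : W' → Bool) (ψ : QState W),
      ext (DQI.emb f env ψ) = DQI.emb g (Sum.elim env fun _ => false) (ext ψ) := fun env ψ => by
    rw [ext, ext, emb_emb f _ (env'' := Sum.elim env fun _ => false),
      emb_emb _ g (env'' := Sum.elim env fun _ => false)]
    · rfl
    · rintro (w | k) hw
      · exact absurd ⟨w, rfl⟩ hw
      · rfl
    · exact fun _ _ => rfl
    · exact fun _ _ => rfl
    · rintro (w | k) hw
      · exact absurd ⟨w, rfl⟩ hw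
      · rfl
  refine ⟨c.relabel g, by rwa [Circuit.length_relabel], fun i => ?_⟩
  rw [key, Circuit.run_relabel, h, key]

/-- Regarding qubits as ancillas. -/
theorem Impl.hide {Z : Type*} [Countable Z]
    (h : Impl N (fun i => DQI.emb (Function.Embedding.inl : W ↪ W ⊕ Z) (fun _ => false) (ψ i))
      (fun i => DQI.emb Function.Embedding.inl (fun _ => false) (φ i))) : Impl N ψ φ := by
  obtain ⟨c, hc, h⟩ := h
  obtain ⟨f, hf⟩ := exists_injective_nat Z
  -- The hidden qubits become the even ancillas, the former ancillas the odd ones.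
  let g : (W ⊕ Z) ⊕ ℕ ↪ W ⊕ ℕ :=
    ⟨Sum.elim (Sum.elim Sum.inl fun z => Sum.inr (2 * f z)) fun k => Sum.inr (2 * k + 1), by
      rintro ((w | z) | k) ((w' | z') | k') h <;> simp at h ⊢
      · exact h
      · exact hf h
      · omega
      · omega
      · exact h⟩
  have key : ∀ ψ : QState W, ext ψ = DQI.emb g (fun _ => false)
      (ext (DQI.emb (Function.Embedding.inl : W ↪ W ⊕ Z) (fun _ => false) ψ)) := fun ψ => by
    rw [ext, ext, emb_emb _ _ (env'' := fun _ => false) (fun _ _ => rfl) (fun _ _ => rfl),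
      emb_emb _ _ (env'' := fun _ => false) (fun _ _ => rfl) (fun _ _ => rfl)]
    rfl
  refine ⟨c.relabel g, by rwa [Circuit.length_relabel], fun i => ?_⟩
  rw [key, Circuit.run_relabel, h, ← key]

end Impl

/-! ### Boolean functions on circuits -/

section Compile

variable {W X ι : Type*}

/-- The unitary matrix with the given entries. -/
def mkUnitary (a b c d : ℂ) (h₁ : a * star a + b * star b = 1) (h₂ : a * star c + b * star d = 0)
    (h₃ : c * star c + d * star d = 1) : Matrix.unitaryGroup Bool ℂ :=
  ⟨Matrix.of fun i j => if i then (if j then d else c) else (if j then b else a), by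
    have h₂' : c * star a + d * star b = 0 := by
      have := congrArg star h₂
      simpa [mul_comm] using this
    rw [Matrix.mem_unitaryGroup_iff]
    ext i j
    rw [Matrix.mul_apply, Fintype.sum_bool, add_comm]
    cases i <;> cases j <;> simpa [Matrix.star_apply, Matrix.one_apply]⟩

section mkUnitary

variable {a b c d : ℂ} {h₁ : a * star a + b * star b = 1} {h₂ : a * star c + b * star d = 0}
  {h₃ : c * star c + d * star d = 1}

theorem mkUnitary_apply (i j : Bool) : (mkUnitary a b c d h₁ h₂ h₃ : Matrix Bool Bool ℂ) i j =
    if i then (if j then d else c) else (if j then b else a) := rfl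

end mkUnitary

/-- The Pauli gate that exchanges `|0⟩` and `|1⟩`. -/
def pauliX : Matrix.unitaryGroup Bool ℂ := mkUnitary 0 1 1 0 (by simp) (by simp) (by simp)

theorem pauliX_ket (i : W) (s : W → Bool) :
    (Gate.one pauliX i).apply (ket s) = ket (setBit s i (!s i)) := by
  rw [Gate.one_ket]
  cases h : s i <;> simp [pauliX, mkUnitary_apply]

/-- Every `o` is a polynomial over `𝔽₂` in two variables, with a constant, two linear terms and a
product: at most one Pauli gate, two CNOTs and one Toffoli. The inputs may coincide, in which case a
CNOT takes the place of the Toffoli. -/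
theorem exists_flip_circuit (o : Bool → Bool → Bool) (v w t : W) (hv : v ≠ t) (hw : w ≠ t) :
    ∃ c : Circuit W, c.length ≤ 4 ∧ ∀ s,
      c.run (ket s) = ket (setBit s t (xor (s t) (o (s v) (s w)))) := by
  classical
  have hflip : ∀ (c : Circuit W) (h : (W → Bool) → Bool), (∀ s b, h (setBit s t b) = h s) →
      (∀ s, c.run (ket s) = ket (setBit s t (xor (s t) (h s)))) → ∀ z : Bool, ∃ c' : Circuit W,
      c'.length ≤ c.length ∧
        ∀ s, c'.run (ket s) = ket (setBit s t (xor (s t) (z && h s))) := by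
    intro c h _ hc z
    cases z
    · exact ⟨[], by simp, fun s => by simp⟩
    · exact ⟨c, le_rfl, fun s => by simpa using hc s⟩
  have hset : ∀ (i : W) (_ : i ≠ t) (s : W → Bool) (b : Bool), setBit s t b i = s i :=
    fun i hi s b => setBit_of_ne s hi b
  obtain ⟨c0, hl0, h0⟩ := hflip [Gate.one pauliX t] (fun _ => true) (by simp)
    (fun s => by simp [pauliX_ket]) (o false false)
  have hcn : ∀ (i : W) (hi : i ≠ t) (s : W → Bool),
      Circuit.run [Gate.cnot i t hi] (ket s) = ket (setBit s t (xor (s t) (s i))) := fun i hi s => by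
    rw [Circuit.run_cons, Circuit.run_nil]
    exact Gate.cnot_ket hi (by simp) fun j hj => setBit_of_ne s hj _
  obtain ⟨c1, hl1, h1⟩ := hflip [Gate.cnot v t hv] (fun s => s v) (by simp [hset v hv])
    (hcn v hv) (xor (o false false) (o true false))
  obtain ⟨c2, hl2, h2⟩ := hflip [Gate.cnot w t hw] (fun s => s w) (by simp [hset w hw])
    (hcn w hw) (xor (o false false) (o false true))
  have h3' : ∃ c : Circuit W, c.length ≤ 1 ∧
      ∀ s, c.run (ket s) = ket (setBit s t (xor (s t) (s v && s w))) := by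
    by_cases hvw : v = w
    · subst hvw
      exact ⟨[Gate.cnot v t hv], le_rfl, fun s => by rw [hcn v hv, Bool.and_self]⟩
    · refine ⟨[Gate.toffoli v w t hvw hv hw], le_rfl, fun s => ?_⟩
      rw [Circuit.run_cons, Circuit.run_nil]
      exact Gate.toffoli_ket hvw hv hw (by simp) fun j hj => setBit_of_ne s hj _
  obtain ⟨c3', hl3', h3'⟩ := h3'
  obtain ⟨c3, hl3, h3⟩ := hflip c3' (fun s => s v && s w) (by simp [hset v hv, hset w hw]) h3'
    (xor (xor (o false false) (o true false)) (xor (o false true) (o true true)))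
  refine ⟨c0 ++ (c1 ++ (c2 ++ c3)), ?_, fun s => ?_⟩
  · simp only [List.length_append, List.length_singleton] at *
    omega
  · simp only [Circuit.run_append, h0, h1, h2, h3, setBit_self, setBit_setBit, hset v hv, hset w hw]
    congr 2
    cases s v <;> cases s w <;> cases s t <;> cases o false false <;> cases o true false <;>
      cases o false true <;> cases o true true <;> rfl

/-- The values of the qubits in `R`. -/
def wireFuns (u : X → W → Bool) (R : Set W) : Set (X → Bool) := (fun w x => u x w) '' R

/-- Each operation writes to a fresh ancilla. The circuit is described on all strings that agree
with `u x` on `R`, not just on `u x`: it must still be possible to uncompute after the other qubits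
have changed. -/
theorem SLP.compile {u : X → W → Bool} {R : Set W} {n : ℕ} {S : Set (X → Bool)}
    (h : SLP Set.univ (wireFuns u R) n S) :
    ∃ (c : Circuit (W ⊕ ℕ)) (z : X → ℕ → Bool), c.length ≤ 4 * n + 1 ∧
      (∀ x i, n + 2 ≤ i → z x i = false) ∧
      (∀ x s, (∀ w ∈ R, s w = u x w) →
        c.run (ket (Sum.elim s fun _ => false)) = ket (Sum.elim s (z x))) ∧
      ∀ f ∈ S, ∃ w : W ⊕ ℕ, (∀ i, w = Sum.inl i → i ∈ R) ∧ (∀ i, w = Sum.inr i → i < n + 2) ∧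
        ∀ x, f x = Sum.elim (u x) (z x) w := by
  classical
  induction h with
  | base =>
    -- Ancillas 0 and 1 hold the two constants; this is the offset `2` in the count of ancillas and
    -- the extra gate in `4 * n + 1`.
    refine ⟨[Gate.one pauliX (Sum.inr 1)], fun _ i => decide (i = 1), le_rfl, ?_, ?_, ?_⟩
    · intro x i hi
      simp only [decide_eq_false_iff_not]
      omega
    · intro x s _
      rw [Circuit.run_cons, Circuit.run_nil, pauliX_ket]
      congr 1
      rw [setBit_eq_iff]
      refine ⟨rfl, ?_⟩
      rintro (w | k) hk
      · rfl
      · have : k ≠ 1 := fun h => hk (by rw [h])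
        simp [this]
    · rintro f (⟨w, hw, rfl⟩ | ⟨b, rfl⟩)
      · exact ⟨Sum.inl w, fun i hi => by rw [← Sum.inl.inj hi]; exact hw,
          fun i hi => (nomatch hi), fun x => rfl⟩
      · cases b
        · exact ⟨Sum.inr 0, fun i hi => (nomatch hi), fun i hi => by rw [← Sum.inr.inj hi]; omega,
            fun x => rfl⟩
        · exact ⟨Sum.inr 1, fun i hi => (nomatch hi), fun i hi => by rw [← Sum.inr.inj hi]; omega,
            fun x => rfl⟩
  | @step n S f g o _ _ hf hg ih =>
    obtain ⟨c, z, hl, hz, hrun, hS⟩ := ih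
    obtain ⟨v, hvR, hvn, hv⟩ := hS f hf
    obtain ⟨w, hwR, hwn, hw⟩ := hS g hg
    have hne : ∀ v : W ⊕ ℕ, (∀ i, v = Sum.inr i → i < n + 2) → v ≠ Sum.inr (n + 2) :=
      fun v hv h => absurd (hv _ h) (lt_irrefl _)
    obtain ⟨d, hdl, hd⟩ := exists_flip_circuit o v w (Sum.inr (n + 2)) (hne v hvn) (hne w hwn)
    have hval : ∀ x s, (∀ w ∈ R, s w = u x w) → ∀ v : W ⊕ ℕ, (∀ i, v = Sum.inl i → i ∈ R) →
        Sum.elim s (z x) v = Sum.elim (u x) (z x) v := by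
      rintro x s hs (v | v) hv
      · exact hs v (hv v rfl)
      · rfl
    refine ⟨c ++ d, fun x => Function.update (z x) (n + 2) (o (f x) (g x)), ?_, ?_, ?_, ?_⟩
    · rw [List.length_append]
      omega
    · intro x i hi
      simp only
      rw [Function.update_of_ne (by omega)]
      exact hz x i (by omega)
    · intro x s hs
      rw [Circuit.run_append, hrun x s hs, hd, hval x s hs v hvR, hval x s hs w hwR, ← hv, ← hw]
      congr 1
      rw [setBit_eq_iff]
      refine ⟨by simp [hz x (n + 2) le_rfl], ?_⟩
      rintro (j | j) hj
      · rfl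
      · have : j ≠ n + 2 := fun h => hj (by rw [h])
        simp [this]
    · rintro f' (rfl | hf')
      · exact ⟨Sum.inr (n + 2), fun i hi => (nomatch hi),
          fun i hi => by rw [← Sum.inr.inj hi]; omega, fun x => by simp⟩
      · obtain ⟨v', hv'R, hv'n, hv'⟩ := hS f' hf'
        refine ⟨v', hv'R, fun i hi => (hv'n i hi).trans (by omega), fun x => ?_⟩
        rw [hv']
        rcases v' with v' | v'
        · rfl
        · have := hv'n v' rfl
          simp only [Sum.elim_inr]
          rw [Function.update_of_ne (by omega)]

/-- Computing, acting on the results, and uncomputing. -/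
theorem impl_conj {u : X → W → Bool} {R : Set W} {n k : ℕ} {T : Set (X → Bool)}
    (h : BComp (wireFuns u R) n T) (φ : X → QState W)
    (hmid : ∀ z : X → ℕ → Bool,
      (∀ f ∈ T, ∃ w : W ⊕ ℕ, (∀ i, w = Sum.inl i → i ∈ R) ∧ ∀ x, f x = Sum.elim (u x) (z x) w) →
      ∃ d : Circuit (W ⊕ ℕ), d.length ≤ k ∧ ∀ x, ∃ (s : Finset (W → Bool)) (a : (W → Bool) → ℂ),
        (∀ t ∈ s, ∀ w ∈ R, t w = u x w) ∧ φ x = ∑ t ∈ s, a t • ket t ∧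
        d.run (ket (Sum.elim (u x) (z x))) = ∑ t ∈ s, a t • ket (Sum.elim t (z x))) :
    Impl (8 * n + 2 + k) (fun x => ket (u x)) φ := by
  obtain ⟨m, hm, S, hS, hTS⟩ := h
  obtain ⟨c, z, hl, -, hrun, hw⟩ := hS.compile
  obtain ⟨d, hd, hrun'⟩ := hmid z fun f hf => by
    obtain ⟨w, h1, -, h2⟩ := hw f (hTS hf)
    exact ⟨w, h1, h2⟩
  refine ⟨c ++ (d ++ c.inv), ?_, fun x => ?_⟩
  · simp only [List.length_append, Circuit.length_inv]
    omega
  · obtain ⟨s, a, hs, hφ, hd⟩ := hrun' x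
    rw [Circuit.run_append, Circuit.run_append, ext_ket, hrun x (u x) fun _ _ => rfl, hd, hφ,
      Circuit.run_sum, ext_sum]
    refine Finset.sum_congr rfl fun t ht => ?_
    -- The middle circuit has left the qubits in `R` alone, so every resulting string carries the
    -- same computed ancillas, and `c.inv` clears them.
    rw [Circuit.run_smul, ext_smul, ext_ket, ← hrun x t (hs t ht), Circuit.run_inv_run]

open Classical in
/-- Adding Boolean functions of the qubits in `R` to the qubits in `V`. -/
theorem impl_xor {u : X → W → Bool} {R : Set W} {n : ℕ} (V : Finset W) (hV : ∀ v ∈ V, v ∉ R)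
    (f : W → X → Bool) (h : BComp (wireFuns u R) n (f '' V)) :
    Impl (8 * n + 2 + V.card) (fun x => ket (u x))
      (fun x => ket fun w => if w ∈ V then xor (u x w) (f w x) else u x w) := by
  refine impl_conj h _ fun z hz => ?_
  have key : ∀ V' ⊆ V, ∃ d : Circuit (W ⊕ ℕ), d.length ≤ V'.card ∧
      ∀ x, d.run (ket (Sum.elim (u x) (z x))) =
        ket (Sum.elim (fun w => if w ∈ V' then xor (u x w) (f w x) else u x w) (z x)) := by
    intro V'
    induction V' using Finset.induction_on with
    | empty => exact fun _ => ⟨[], le_rfl, fun x => by simp⟩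
    | insert v V' hv ih =>
      intro hVV
      obtain ⟨d, hd, hrun⟩ := ih ((Finset.subset_insert _ _).trans hVV)
      have hvV := hVV (Finset.mem_insert_self _ _)
      obtain ⟨w, hwR, hw⟩ := hz (f v) ⟨v, hvV, rfl⟩
      have hne : w ≠ Sum.inl v := fun h => hV v hvV (hwR v h)
      refine ⟨d ++ [Gate.cnot w (Sum.inl v) hne], ?_, fun x => ?_⟩
      · rw [List.length_append, Finset.card_insert_of_notMem hv, List.length_singleton]
        omega
      · rw [Circuit.run_append, hrun, Circuit.run_cons, Circuit.run_nil]
        refine Gate.cnot_ket hne ?_ ?_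
        · simp only [Sum.elim_inl, Finset.mem_insert, true_or, if_true, hv, if_false, hw x]
          congr 1
          rcases w with w | w
          · have hw' : w ∉ V' := fun h =>
              hV w (hVV (Finset.mem_insert_of_mem h)) (hwR w rfl)
            simp [hw']
          · rfl
        · rintro (i | i) hi
          · have : i ≠ v := fun h => hi (by rw [h])
            simp [this]
          · rfl
  obtain ⟨d, hd, hrun⟩ := key V subset_rfl
  refine ⟨d, hd, fun x => ⟨{_}, fun _ => 1, ?_, by rw [Finset.sum_singleton, one_smul], ?_⟩⟩
  · intro t ht w hw
    rw [Finset.mem_singleton.1 ht]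
    have : w ∉ V := fun h => hV w h hw
    simp [this]
  · rw [hrun, Finset.sum_singleton, one_smul]

/-- The gate `diag (1, ζ)`. -/
def phaseGate (ζ : ℂ) (hζ : ‖ζ‖ = 1) : Matrix.unitaryGroup Bool ℂ :=
  ⟨Matrix.diagonal fun b => if b then ζ else 1, by
    rw [Matrix.mem_unitaryGroup_iff, Matrix.star_eq_conjTranspose, Matrix.diagonal_conjTranspose,
      Matrix.diagonal_mul_diagonal, ← Matrix.diagonal_one]
    congr 1
    funext b
    cases b
    · simp
    · simp [Complex.mul_conj, Complex.normSq_eq_norm_sq, hζ]⟩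

theorem phaseGate_ket (ζ : ℂ) (hζ : ‖ζ‖ = 1) (i : W) (s : W → Bool) :
    (Gate.one (phaseGate ζ hζ) i).apply (ket s) = (if s i then ζ else 1) • ket s := by
  have h : setBit s i (s i) = s := setBit_eq_self s i
  rw [Gate.one_ket]
  cases hs : s i <;> rw [hs] at h <;> simp [phaseGate, h]

/-- A phase that is controlled by a Boolean function. -/
theorem impl_phase {u : X → W → Bool} {n : ℕ} (f : X → Bool)
    (h : BComp (wireFuns u Set.univ) n {f}) (ζ : ℂ) (hζ : ‖ζ‖ = 1) :
    Impl (8 * n + 3) (fun x => ket (u x)) (fun x => (if f x then ζ else 1) • ket (u x)) := by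
  refine impl_conj (k := 1) h _ fun z hz => ?_
  obtain ⟨w, -, hw⟩ := hz f rfl
  refine ⟨[Gate.one (phaseGate ζ hζ) w], le_rfl, fun x => ⟨{u x}, fun _ => if f x then ζ else 1,
    fun t ht w _ => by rw [Finset.mem_singleton.1 ht], by rw [Finset.sum_singleton], ?_⟩⟩
  rw [Circuit.run_cons, Circuit.run_nil, phaseGate_ket, ← hw, Finset.sum_singleton]

/-- A conjugate `V X V⁻¹` of the Pauli gate can be controlled by replacing `X` with a CNOT, while
`V⁻¹` and `V` stay uncontrolled and cancel if the control is off. Such a conjugate is Hermitian, so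
its diagonal entry `r` has to be real. -/
theorem exists_reflection (r : ℝ) (α : ℂ) (h : r ^ 2 + ‖α‖ ^ 2 = 1) :
    ∃ V : Matrix.unitaryGroup Bool ℂ, ∀ b, ((V * pauliX * V⁻¹ : Matrix.unitaryGroup Bool ℂ) :
      Matrix Bool Bool ℂ) b false = if b then α else (r : ℂ) := by
  -- With `r = cos t`, these are the cosine and the sine of `t / 2`.
  obtain ⟨c, s, hcs, hr, hα⟩ : ∃ c s : ℝ, c ^ 2 + s ^ 2 = 1 ∧ c ^ 2 - s ^ 2 = r ∧ 2 * c * s = ‖α‖ := by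
    have hr1 : -1 ≤ r ∧ r ≤ 1 := abs_le.1 (abs_le_one_iff_mul_self_le_one.2 (by nlinarith [sq_nonneg ‖α‖]))
    have e : Real.arccos r = 2 * (Real.arccos r / 2) := by ring
    refine ⟨Real.cos (Real.arccos r / 2), Real.sin (Real.arccos r / 2), Real.cos_sq_add_sin_sq _, ?_, ?_⟩
    · conv_rhs => rw [← Real.cos_arccos hr1.1 hr1.2, e, Real.cos_two_mul']
    · rw [mul_assoc, mul_comm (Real.cos _), ← mul_assoc, ← Real.sin_two_mul, ← e, Real.sin_arccos,
        ← h, add_sub_cancel_left, Real.sqrt_sq (norm_nonneg _)]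
  obtain ⟨e, he, hαe⟩ : ∃ e : ℂ, ‖e‖ = 1 ∧ α = e * ‖α‖ := by
    by_cases h0 : α = 0
    · exact ⟨1, by simp, by simp [h0]⟩
    · have h0' : (‖α‖ : ℂ) ≠ 0 := by exact_mod_cast norm_ne_zero_iff.2 h0
      exact ⟨α / ‖α‖, by simp [h0], by field_simp⟩
  have hee : e * star e = 1 := by
    rw [Complex.star_def, Complex.mul_conj, Complex.normSq_eq_norm_sq, he]
    simp
  have h2 : ((Real.sqrt 2 : ℝ) : ℂ) ^ 2 = 2 := by
    rw [← Complex.ofReal_pow, Real.sq_sqrt (by norm_num)]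
    norm_num
  set q : ℂ := ((Real.sqrt 2 : ℝ) : ℂ)⁻¹ with hq
  have hqq : q * q = 1 / 2 := by
    rw [hq, ← mul_inv, ← pow_two, h2, one_div]
  have hqs : star q = q := by rw [hq, Complex.star_def, map_inv₀, Complex.conj_ofReal]
  have hcs' : (c : ℂ) ^ 2 + (s : ℂ) ^ 2 = 1 := by exact_mod_cast hcs
  have hcc : star (c : ℂ) = c := Complex.conj_ofReal c
  have hss : star (s : ℂ) = s := Complex.conj_ofReal s
  -- The matrix is `R * H`, with `H` the Hadamard matrix and `R` the rotation with rows `(c, -s)`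
  -- and `(e s, e c)`. Since `H X H = Z`, the conjugate is `R Z R⁻¹`, whose first column is `(c² -
  -- s², 2 e c s)`.
  refine ⟨mkUnitary (q * (c - s)) (q * (c + s)) (q * (e * (c + s))) (q * (e * (s - c))) ?_ ?_ ?_,
    fun b => ?_⟩
  · simp only [star_mul', star_add, star_sub, hqs, hcc, hss]
    linear_combination (2 * ((c : ℂ) ^ 2 + (s : ℂ) ^ 2)) * hqq + hcs'
  · simp only [star_mul', star_add, star_sub, hqs, hcc, hss]
    ring
  · simp only [star_mul', star_add, star_sub, hqs, hcc, hss]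
    linear_combination (2 * ((c : ℂ) ^ 2 + (s : ℂ) ^ 2) * (e * star e)) * hqq +
      (e * star e) * hcs' + hee
  have hr' : (c : ℂ) ^ 2 - (s : ℂ) ^ 2 = r := by exact_mod_cast hr
  have hα' : 2 * (c : ℂ) * s = ‖α‖ := by exact_mod_cast hα
  have hco : ∀ U : Matrix.unitaryGroup Bool ℂ, ((U * pauliX * U⁻¹ : Matrix.unitaryGroup Bool ℂ) :
      Matrix Bool Bool ℂ) b false = (U : Matrix Bool Bool ℂ) b false *
        star ((U : Matrix Bool Bool ℂ) false true) + (U : Matrix Bool Bool ℂ) b true *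
        star ((U : Matrix Bool Bool ℂ) false false) := fun U => by
    have : ((U * pauliX * U⁻¹ : Matrix.unitaryGroup Bool ℂ) : Matrix Bool Bool ℂ) =
      (U : Matrix Bool Bool ℂ) * (pauliX : Matrix Bool Bool ℂ) * star (U : Matrix Bool Bool ℂ) := rfl
    rw [this]
    simp [Matrix.mul_apply, pauliX, mkUnitary_apply, Matrix.star_apply]
  rw [hco, hαe, ← hr', ← hα']
  cases b <;>
    simp only [mkUnitary_apply, star_mul', star_add, star_sub, hqs, hcc, hss, if_true,
      Bool.false_eq_true, if_false]
  · linear_combination (2 * ((c : ℂ) ^ 2 - (s : ℂ) ^ 2)) * hqq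
  · linear_combination (4 * e * c * s) * hqq

/-- A reflection of one qubit, applied to `|0⟩`, that is controlled by a Boolean function of other
qubits. -/
theorem impl_ctrl {u : X → W → Bool} {R : Set W} {n : ℕ} (v : W) (hv : v ∉ R) (f : X → Bool)
    (h : BComp (wireFuns u R) n {f}) (hu : ∀ x, f x = true → u x v = false) (r : ℝ) (α : ℂ)
    (hα : r ^ 2 + ‖α‖ ^ 2 = 1) :
    Impl (8 * n + 5) (fun x => ket (u x))
      (fun x => if f x then (r : ℂ) • ket (u x) + α • ket (setBit (u x) v true) else ket (u x)) := by
  classical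
  obtain ⟨V, hV⟩ := exists_reflection r α hα
  refine impl_conj (k := 3) h _ fun z hz => ?_
  obtain ⟨w, hwR, hw⟩ := hz f rfl
  have hne : w ≠ Sum.inl v := fun h => hv (hwR v h)
  set d : Circuit (W ⊕ ℕ) := [Gate.one V⁻¹ (Sum.inl v), Gate.cnot w (Sum.inl v) hne,
    Gate.one V (Sum.inl v)] with hd
  have h0 : ∀ s : W ⊕ ℕ → Bool, s w = false → d.run (ket s) = ket s := by
    intro s hs
    have hc : ∀ b, (Gate.cnot w (Sum.inl v) hne).apply (ket (setBit s (Sum.inl v) b)) =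
        ket (setBit s (Sum.inl v) b) := fun b =>
      Gate.cnot_ket hne (by rw [setBit_of_ne s hne, hs, Bool.xor_false]) fun _ _ => rfl
    have h1 : (Gate.cnot w (Sum.inl v) hne).apply ((Gate.one V⁻¹ (Sum.inl v)).apply (ket s)) =
        (Gate.one V⁻¹ (Sum.inl v)).apply (ket s) := by
      rw [Gate.one_ket, Fintype.sum_bool, Gate.apply_add, Gate.apply_smul, Gate.apply_smul, hc, hc]
    rw [hd, Circuit.run_cons, Circuit.run_cons, Circuit.run_cons, Circuit.run_nil, h1]
    have := (Gate.one V⁻¹ (Sum.inl v)).apply_inv_apply (ket s)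
    rwa [Gate.inv, inv_inv] at this
  have hmul : ∀ (U U' : Matrix.unitaryGroup Bool ℂ) (i : W ⊕ ℕ) (ψ : QState (W ⊕ ℕ)),
      (Gate.one U i).apply ((Gate.one U' i).apply ψ) = (Gate.one (U * U') i).apply ψ := by
    intro U U' i ψ
    funext s
    have : ((U * U' : Matrix.unitaryGroup Bool ℂ) : Matrix Bool Bool ℂ) =
      (U : Matrix Bool Bool ℂ) * (U' : Matrix Bool Bool ℂ) := rfl
    simp only [Gate.apply_one, setBit_self, setBit_setBit, this, Matrix.mul_apply, Fintype.sum_bool]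
    ring
  have h1 : ∀ s : W ⊕ ℕ → Bool, s w = true → s (Sum.inl v) = false →
      d.run (ket s) = (r : ℂ) • ket s + α • ket (setBit s (Sum.inl v) true) := by
    intro s hs hsv
    have hc : ∀ b, (Gate.cnot w (Sum.inl v) hne).apply (ket (setBit s (Sum.inl v) b)) =
        (Gate.one pauliX (Sum.inl v)).apply (ket (setBit s (Sum.inl v) b)) := fun b => by
      rw [pauliX_ket]
      refine Gate.cnot_ket hne ?_ fun j hj => setBit_of_ne _ hj _
      rw [setBit_of_ne s hne, hs, setBit_self, setBit_self, Bool.xor_true]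
    have h2 : (Gate.cnot w (Sum.inl v) hne).apply ((Gate.one V⁻¹ (Sum.inl v)).apply (ket s)) =
        (Gate.one pauliX (Sum.inl v)).apply ((Gate.one V⁻¹ (Sum.inl v)).apply (ket s)) := by
      rw [Gate.one_ket, Fintype.sum_bool, Gate.apply_add, Gate.apply_smul, Gate.apply_smul, hc, hc,
        Gate.apply_add, Gate.apply_smul, Gate.apply_smul]
    rw [hd, Circuit.run_cons, Circuit.run_cons, Circuit.run_cons, Circuit.run_nil, h2, hmul, hmul,
      Gate.one_ket, hsv, Fintype.sum_bool, hV, hV]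
    have : setBit s (Sum.inl v) false = s := by rw [← hsv, setBit_eq_self]
    rw [this, add_comm]
    simp
  refine ⟨d, le_rfl, fun x => ?_⟩
  cases hf : f x with
  | false =>
    refine ⟨{u x}, fun _ => 1, fun t ht w _ => by rw [Finset.mem_singleton.1 ht], by simp, ?_⟩
    rw [h0 _ (by rw [← hw, hf])]
    simp
  | true =>
    have hne' : u x ≠ setBit (u x) v true := fun h => by
      have := congrFun h v
      rw [setBit_self, hu x hf] at this
      exact Bool.false_ne_true this
    refine ⟨{u x, setBit (u x) v true}, fun t => if t = u x then (r : ℂ) else α, ?_, ?_, ?_⟩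
    · intro t ht i hi
      have hiv : i ≠ v := fun h => hv (h ▸ hi)
      rcases Finset.mem_insert.1 ht with rfl | ht
      · rfl
      · rw [Finset.mem_singleton.1 ht, setBit_of_ne _ hiv]
    · rw [Finset.sum_pair hne', if_pos rfl]
      simp only [if_true, if_neg hne'.symm]
    · rw [h1 _ (by rw [← hw, hf]) (hu x hf), Finset.sum_pair hne']
      simp only [if_true, if_neg hne'.symm]
      congr 3
      rw [setBit_eq_iff]
      refine ⟨by simp, ?_⟩
      rintro (j | j) hj
      · have : j ≠ v := fun h => hj (by rw [h])
        simp [setBit_of_ne _ this]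
      · rfl

end Compile

/-! ### State preparation -/

section Prep

variable {R E : Type*}

/-- A flag and a register, and an auxiliary qubit. -/
def prepBits (t b : Bool) (ρ : R → Bool) : Option R ⊕ Unit → Bool :=
  Sum.elim (fun w => w.elim t ρ) fun _ => b

/-- Moving part of the amplitude from the flag to a pattern in the register. -/
theorem impl_prep_step [Fintype R] (ρ : R → Bool) (hρ : ρ ≠ fun _ => false) (r : ℝ) (α : ℂ)
    (hα : r ^ 2 + ‖α‖ ^ 2 = 1) :
    ∃ c : Circuit ((Option R ⊕ Unit) ⊕ ℕ), c.length ≤ 30 * (Fintype.card R + 1) ∧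
      c.run (ext (ket (prepBits true false fun _ => false))) =
        (r : ℂ) • ext (ket (prepBits true false fun _ => false)) +
          α • ext (ket (prepBits false false ρ)) ∧
      ∀ ρ', ρ' ≠ ρ → c.run (ext (ket (prepBits false false ρ'))) =
        ext (ket (prepBits false false ρ')) := by
  classical
  let X := Bool × Bool × (R → Bool)
  let u : X → (Option R ⊕ Unit) → Bool := fun x => prepBits x.1 x.2.1 x.2.2
  -- The first of three parts: if the flag is set, the auxiliary qubit is rotated to `r|0⟩ + α|1⟩`.
  obtain ⟨c1, hl1, h1⟩ := impl_ctrl (X := {x : X // x.1 = true → x.2.1 = false})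
    (u := fun x => u x) (R := {Sum.inl none}) (n := 0) (Sum.inr ()) (by simp) (fun x => x.1.1)
    (Comp.of_mem ⟨_, rfl, rfl⟩) (fun x hx => x.2 hx) r α hα
  -- The second part: if the auxiliary qubit is set, the flag is cleared and the pattern `ρ` is
  -- written to the register, which is still zero.
  let V2 : Finset (Option R ⊕ Unit) :=
    insert (Sum.inl none) ((Finset.univ.filter fun i => ρ i = true).image fun i => Sum.inl (some i))
  have hV2 : ∀ v ∈ V2, v ∉ ({Sum.inr ()} : Set (Option R ⊕ Unit)) := by
    intro v hv
    rcases Finset.mem_insert.1 hv with rfl | hv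
    · simp
    · obtain ⟨i, -, rfl⟩ := Finset.mem_image.1 hv
      simp
  obtain ⟨c2, hl2, h2⟩ := impl_xor (X := X) (u := u) (R := {Sum.inr ()}) (n := 0) V2 hV2
    (fun _ x => x.2.1) (.of_subset (by
      rintro _ ⟨v, -, rfl⟩
      exact Or.inl ⟨Sum.inr (), rfl, rfl⟩))
  have h3c : BComp (wireFuns u {w | ∃ i, w = Sum.inl (some i)}) (Fintype.card R * 2)
      {fun x : X => decide (∀ i ∈ Finset.univ, (x.2.2 i == ρ i) = true)} := by
    have h := BComp.all (B := wireFuns u {w | ∃ i, w = Sum.inl (some i)}) (n := 1) Finset.univ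
      (fun i (x : X) => x.2.2 i == ρ i) fun i _ => ?_
    · convert h
      exact Finset.card_univ.symm
    have hm : BComp (wireFuns u {w | ∃ i, w = Sum.inl (some i)}) 0 {fun x : X => x.2.2 i} :=
      .of_mem ⟨Sum.inl (some i), ⟨i, rfl⟩, rfl⟩
    exact BComp.op (fun a _ => a == ρ i) hm hm
  -- The third part: the auxiliary qubit is cleared by the test whether the register holds `ρ`. The
  -- branch with the flag still set has register zero, and earlier patterns differ from `ρ`, so the
  -- test fails there; this needs `ρ ≠ 0`.
  obtain ⟨c3, hl3, h3⟩ := impl_xor (X := X) (u := u) {Sum.inr ()} (by simp)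
    (fun _ x => decide (∀ i ∈ Finset.univ, (x.2.2 i == ρ i) = true))
    (h3c.mono subset_rfl le_rfl (by simp))
  have g1 : ∀ ρ', c1.run (ext (ket (prepBits false false ρ'))) = ext (ket (prepBits false false ρ')) :=
    fun ρ' => h1 ⟨(false, false, ρ'), by simp⟩
  have g1' : c1.run (ext (ket (prepBits true false fun _ : R => false))) =
      (r : ℂ) • ext (ket (prepBits true false fun _ => false)) +
        α • ext (ket (prepBits true true fun _ => false)) := by
    refine (h1 ⟨(true, false, fun _ => false), by simp⟩).trans ?_
    simp only [if_true, ext_add, ext_smul]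
    congr 4
    rw [setBit_eq_iff]
    refine ⟨rfl, ?_⟩
    rintro ((_ | i) | i) hi
    · rfl
    · rfl
    · exact absurd rfl hi
  have g2 : ∀ t ρ', c2.run (ext (ket (prepBits t false ρ'))) = ext (ket (prepBits t false ρ')) :=
    fun t ρ' => by
      refine (h2 (t, false, ρ')).trans ?_
      simp only [Bool.xor_false, ite_self, u]
  have g2' : c2.run (ext (ket (prepBits true true fun _ : R => false))) =
      ext (ket (prepBits false true ρ)) := by
    refine (h2 (true, true, fun _ => false)).trans ?_
    refine congrArg (fun s => ext (ket s)) ?_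
    funext w
    rcases w with (_ | i) | i
    · simp [V2, u, prepBits]
    · cases hi : ρ i <;> simp [V2, u, prepBits, hi]
    · simp [V2, u, prepBits]
  have g3 : ∀ t ρ', ρ' ≠ ρ → c3.run (ext (ket (prepBits t false ρ'))) =
      ext (ket (prepBits t false ρ')) := fun t ρ' hne => by
    refine (h3 (t, false, ρ')).trans ?_
    refine congrArg (fun s => ext (ket s)) ?_
    funext w
    have : ¬ ∀ i, ρ' i = ρ i := fun h => hne (funext h)
    rcases w with w | w
    · simp [u]
    · simp [u, this]
  have g3' : c3.run (ext (ket (prepBits false true ρ))) = ext (ket (prepBits false false ρ)) := by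
    refine (h3 (false, true, ρ)).trans ?_
    refine congrArg (fun s => ext (ket s)) ?_
    funext w
    rcases w with w | w
    · simp [u, prepBits]
    · simp [u, prepBits]
  refine ⟨c1 ++ (c2 ++ c3), ?_, ?_, fun ρ' hne => ?_⟩
  · have hV : V2.card ≤ Fintype.card R + 1 := by
      refine (Finset.card_insert_le _ _).trans (Nat.succ_le_succ ?_)
      exact Finset.card_image_le.trans (Finset.card_le_univ _)
    simp only [List.length_append, Finset.card_singleton] at *
    omega
  · simp only [Circuit.run_append, g1', Circuit.run_add, Circuit.run_smul, g2, g2', g3 _ _ hρ.symm,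
      g3']
  · simp only [Circuit.run_append, g1, g2, g3 _ _ hne]

/-- Preparation of an arbitrary superposition of nonzero patterns, from a flag. -/
theorem impl_prep [Fintype R] [Fintype E] (ρ : E → R → Bool) (hρ : ∀ e, ρ e ≠ fun _ => false)
    (hinj : Function.Injective ρ) (α : E → ℂ) (hα : ∑ e, ‖α e‖ ^ 2 = 1) :
    Impl (Fintype.card E * (30 * (Fintype.card R + 1)))
      (fun t : Bool => ket fun w : Option R => w.elim t fun _ => false)
      (fun t => if t then ∑ e, α e • ket (fun w : Option R => w.elim false (ρ e))
        else ket fun w : Option R => w.elim false fun _ => false) := by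
  classical
  have key : ∀ s : Finset E, ∃ c : Circuit ((Option R ⊕ Unit) ⊕ ℕ),
      c.length ≤ s.card * (30 * (Fintype.card R + 1)) ∧
      c.run (ext (ket (prepBits false false fun _ => false))) =
        ext (ket (prepBits false false fun _ => false)) ∧
      c.run (ext (ket (prepBits true false fun _ => false))) =
        ∑ e ∈ s, α e • ext (ket (prepBits false false (ρ e))) +
        (Real.sqrt (1 - ∑ e ∈ s, ‖α e‖ ^ 2) : ℂ) • ext (ket (prepBits true false fun _ => false)) := by
    intro s
    induction s using Finset.induction_on with
    | empty => exact ⟨[], by simp, by simp, by simp⟩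
    | insert e s he ih =>
      obtain ⟨c, hl, h0, h1⟩ := ih
      set A := ∑ e ∈ s, ‖α e‖ ^ 2 with hA
      have hle : ‖α e‖ ^ 2 + A ≤ 1 := by
        rw [hA, ← hα, ← Finset.sum_insert (f := fun e => ‖α e‖ ^ 2) he]
        exact Finset.sum_le_univ_sum_of_nonneg fun _ => by positivity
      -- The flag still has amplitude `√(1 - A)`, so the new pattern takes the relative share `α e /
      -- √(1 - A)`. If nothing is left, then `α e = 0` and the trivial rotation will do.
      obtain ⟨r, β, hrβ, hr, hβ⟩ : ∃ (r : ℝ) (β : ℂ), r ^ 2 + ‖β‖ ^ 2 = 1 ∧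
          Real.sqrt (1 - A) * r = Real.sqrt (1 - (‖α e‖ ^ 2 + A)) ∧
          (Real.sqrt (1 - A) : ℂ) * β = α e := by
        by_cases h : 1 - A = 0
        · refine ⟨1, 0, by simp, ?_, ?_⟩
          · rw [h, Real.sqrt_zero, zero_mul, Real.sqrt_eq_zero_of_nonpos]
            nlinarith [sq_nonneg ‖α e‖]
          · have : ‖α e‖ ^ 2 = 0 := le_antisymm (by linarith) (sq_nonneg _)
            simp [norm_eq_zero.1 (pow_eq_zero_iff two_ne_zero |>.1 this)]
        · have hpos : 0 < 1 - A :=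
            lt_of_le_of_ne (by nlinarith [sq_nonneg ‖α e‖]) (Ne.symm h)
          have hs : 0 < Real.sqrt (1 - A) := Real.sqrt_pos.2 hpos
          have hs' : (Real.sqrt (1 - A) : ℂ) ≠ 0 := by exact_mod_cast hs.ne'
          refine ⟨Real.sqrt (1 - (‖α e‖ ^ 2 + A)) / Real.sqrt (1 - A),
            α e / (Real.sqrt (1 - A) : ℂ), ?_, ?_, ?_⟩
          · rw [norm_div, Complex.norm_real, Real.norm_of_nonneg hs.le, div_pow, div_pow,
              Real.sq_sqrt hpos.le, Real.sq_sqrt (by linarith), ← add_div, div_eq_one_iff_eq h]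
            ring
          · field_simp
          · field_simp
      obtain ⟨d, hdl, hd1, hd0⟩ := impl_prep_step (ρ e) (hρ e) r β hrβ
      refine ⟨c ++ d, ?_, ?_, ?_⟩
      · rw [List.length_append, Finset.card_insert_of_notMem he]
        linarith
      · rw [Circuit.run_append, h0, hd0 _ (hρ e).symm]
      · rw [Circuit.run_append, h1, Circuit.run_add, Circuit.run_sum, Circuit.run_smul, hd1,
          Finset.sum_insert he, Finset.sum_insert he, smul_add, smul_smul, smul_smul, hβ,
          ← Complex.ofReal_mul, hr]
        have : ∑ i ∈ s, d.run (α i • ext (ket (prepBits false false (ρ i)))) =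
            ∑ i ∈ s, α i • ext (ket (prepBits false false (ρ i))) :=
          Finset.sum_congr rfl fun i hi => by
            rw [Circuit.run_smul, hd0 _ (hinj.ne fun h => he (h ▸ hi))]
        rw [this]
        abel
  have hket : ∀ (t : Bool) (σ : R → Bool), emb (Function.Embedding.inl : Option R ↪ Option R ⊕ Unit)
      (fun _ => false) (ket fun w : Option R => w.elim t σ) = ket (prepBits t false σ) := fun t σ => by
    refine emb_ket _ (fun i => rfl) ?_
    rintro (w | k) hw
    · exact absurd ⟨w, rfl⟩ hw
    · rfl
  obtain ⟨c, hl, h0, h1⟩ := key Finset.univ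
  refine Impl.hide (Z := Unit) ⟨c, hl, fun t => ?_⟩
  cases t
  · simp only [Bool.false_eq_true, if_false, hket, h0]
  · simp only [if_true, hket, h1, hα, sub_self, Real.sqrt_zero, Complex.ofReal_zero, zero_smul,
      add_zero, emb_sum, emb_smul, ext_sum, ext_smul]

end Prep

/-! ### Weighted Dicke states -/

section Dicke

variable {Y : Type*} [DecidableEq Y] {ℓ : ℕ}

/-- A mask, and a counter in one-hot encoding. -/
def dickeBits (ℓ k : ℕ) (S : Finset Y) : Y ⊕ Fin (ℓ + 1) → Bool :=
  Sum.elim (fun y => decide (y ∈ S)) fun i => decide ((i : ℕ) = k)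

/-- The counter passes one unit to the qubit `y`, if it has the value `k`. -/
theorem dicke_substep (y : Y) (k : ℕ) (hk : k + 1 ≤ ℓ) (r : ℝ) (α : ℂ) (hα : r ^ 2 + ‖α‖ ^ 2 = 1) :
    ∃ c : Circuit ((Y ⊕ Fin (ℓ + 1)) ⊕ ℕ), c.length ≤ 7 ∧
      (∀ S, y ∉ S → c.run (ext (ket (dickeBits ℓ (k + 1) S))) =
        (r : ℂ) • ext (ket (dickeBits ℓ (k + 1) S)) + α • ext (ket (dickeBits ℓ k (insert y S)))) ∧
      (∀ j S, j ≠ k + 1 → y ∉ S → c.run (ext (ket (dickeBits ℓ j S))) = ext (ket (dickeBits ℓ j S))) ∧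
      ∀ j S, j < k → c.run (ext (ket (dickeBits ℓ j S))) = ext (ket (dickeBits ℓ j S)) := by
  classical
  let i1 : Fin (ℓ + 1) := ⟨k + 1, by omega⟩
  let i0 : Fin (ℓ + 1) := ⟨k, by omega⟩
  have h10 : i1 ≠ i0 := by simp [i1, i0]
  obtain ⟨c1, hl1, h1⟩ := impl_ctrl (W := Y ⊕ Fin (ℓ + 1))
    (X := {x : ℕ × Finset Y // x.1 = k + 1 → y ∉ x.2})
    (u := fun x => dickeBits ℓ x.1.1 x.1.2) (R := {Sum.inr i1}) (n := 0) (Sum.inl y) (by simp)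
    (fun x => decide (k + 1 = x.1.1)) (Comp.of_mem ⟨_, rfl, rfl⟩)
    (fun x hx => by simpa [dickeBits] using x.2 (of_decide_eq_true hx).symm) r α hα
  let t1 : Gate (Y ⊕ Fin (ℓ + 1)) :=
    -- If `y` is set and the counter shows `k + 1`, this gate also sets position `k`, and `t2` then
    -- clears position `k + 1`.
    .toffoli (Sum.inr i1) (Sum.inl y) (Sum.inr i0) (by simp) (by simp [h10]) (by simp)
  let t2 : Gate (Y ⊕ Fin (ℓ + 1)) :=
    .toffoli (Sum.inr i0) (Sum.inl y) (Sum.inr i1) (by simp) (by simp [h10.symm]) (by simp)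
  let c2 : Circuit (Y ⊕ Fin (ℓ + 1)) := [t1, t2]
  have hfix : ∀ j S, (y ∉ S ∨ j < k) → c2.run (ket (dickeBits ℓ j S)) = ket (dickeBits ℓ j S) := by
    intro j S hj
    have e1 : t1.apply (ket (dickeBits ℓ j S)) = ket (dickeBits ℓ j S) := by
      refine Gate.toffoli_ket _ _ _ ?_ fun _ _ => rfl
      rcases hj with hj | hj
      · simp [dickeBits, hj]
      · simp [dickeBits, i1, show ¬ k + 1 = j by omega]
    have e2 : t2.apply (ket (dickeBits ℓ j S)) = ket (dickeBits ℓ j S) := by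
      refine Gate.toffoli_ket _ _ _ ?_ fun _ _ => rfl
      rcases hj with hj | hj
      · simp [dickeBits, hj]
      · simp [dickeBits, i0, show ¬ k = j by omega]
    rw [Circuit.run_cons, Circuit.run_cons, Circuit.run_nil, e1, e2]
  have hmove : ∀ S, c2.run (ket (dickeBits ℓ (k + 1) (insert y S))) =
      ket (dickeBits ℓ k (insert y S)) := by
    intro S
    have e1 : t1.apply (ket (dickeBits ℓ (k + 1) (insert y S))) =
        ket (Sum.elim (fun z => decide (z ∈ insert y S))
          fun i : Fin (ℓ + 1) => decide ((i : ℕ) = k + 1 ∨ (i : ℕ) = k)) := by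
      refine Gate.toffoli_ket _ _ _ ?_ ?_
      · simp [dickeBits, i1, i0]
      · rintro (z | i) hi
        · rfl
        · have : (i : ℕ) ≠ k := fun h => hi (congrArg Sum.inr (Fin.ext h))
          simp [dickeBits, this]
    have e2 : t2.apply (ket (Sum.elim (fun z => decide (z ∈ insert y S))
          fun i : Fin (ℓ + 1) => decide ((i : ℕ) = k + 1 ∨ (i : ℕ) = k))) =
        ket (dickeBits ℓ k (insert y S)) := by
      refine Gate.toffoli_ket _ _ _ ?_ ?_
      · simp [dickeBits, i1, i0]
      · rintro (z | i) hi
        · rfl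
        · have : (i : ℕ) ≠ k + 1 := fun h => hi (congrArg Sum.inr (Fin.ext h))
          simp [dickeBits, this]
    rw [Circuit.run_cons, Circuit.run_cons, Circuit.run_nil, e1, e2]
  have hrel : ∀ ψ, (c2.relabel Function.Embedding.inl).run (ext ψ) = ext (c2.run ψ) :=
    fun ψ => Circuit.run_relabel _ _ _ _
  refine ⟨c1 ++ c2.relabel Function.Embedding.inl, ?_, ?_, ?_, ?_⟩
  · rw [List.length_append, Circuit.length_relabel]
    simp only [c2, List.length_cons, List.length_nil]
    omega
  · intro S hS
    have e := h1 ⟨(k + 1, S), fun _ => hS⟩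
    simp only [decide_true, if_true] at e
    have e2 : setBit (dickeBits ℓ (k + 1) S) (Sum.inl y) true = dickeBits ℓ (k + 1) (insert y S) := by
      rw [setBit_eq_iff]
      refine ⟨by simp [dickeBits], ?_⟩
      rintro (z | i) hz
      · have : z ≠ y := fun h => hz (congrArg Sum.inl h)
        simp [dickeBits, this]
      · rfl
    rw [Circuit.run_append, e, e2, ext_add, ext_smul, ext_smul, Circuit.run_add, Circuit.run_smul,
      Circuit.run_smul, hrel, hrel, hfix _ _ (Or.inl hS), hmove]
  · intro j S hj hS
    have e := h1 ⟨(j, S), fun _ => hS⟩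
    simp only [decide_eq_true_eq, if_neg hj.symm] at e
    rw [Circuit.run_append, e, hrel, hfix _ _ (Or.inl hS)]
  · intro j S hj
    have hj' : j ≠ k + 1 := by omega
    have e := h1 ⟨(j, S), fun h => absurd h hj'⟩
    simp only [decide_eq_true_eq, if_neg hj'.symm] at e
    rw [Circuit.run_append, e, hrel, hfix _ _ (Or.inr hj)]

/-- In a uniform subset with `k` elements of the `M` remaining sites, `y` included, the site `y` is
a member with probability `k / M`. At `k = 0` the truncated `k - 1` is harmless, as its coefficient
vanishes. -/
theorem dicke_step (y : Y) (M : ℕ) (hM : 1 ≤ M) :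
    ∃ c : Circuit ((Y ⊕ Fin (ℓ + 1)) ⊕ ℕ), c.length ≤ ℓ * 7 ∧
      ∀ k S, k ≤ ℓ → k ≤ M → y ∉ S → c.run (ext (ket (dickeBits ℓ k S))) =
        (Real.sqrt ((M - k : ℕ) / M) : ℂ) • ext (ket (dickeBits ℓ k S)) +
          (Real.sqrt (k / M) : ℂ) • ext (ket (dickeBits ℓ (k - 1) (insert y S))) := by
  have hM0 : (0 : ℝ) < M := by exact_mod_cast hM
  -- The counter values are treated in increasing order. A branch that has passed a unit to `y` then
  -- shows a value too small for all later substeps, so `y` receives at most one unit.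
  have key : ∀ j, j ≤ ℓ → j ≤ M → ∃ c : Circuit ((Y ⊕ Fin (ℓ + 1)) ⊕ ℕ), c.length ≤ j * 7 ∧
      (∀ k S, k ≤ j → y ∉ S → c.run (ext (ket (dickeBits ℓ k S))) =
        (Real.sqrt ((M - k : ℕ) / M) : ℂ) • ext (ket (dickeBits ℓ k S)) +
          (Real.sqrt (k / M) : ℂ) • ext (ket (dickeBits ℓ (k - 1) (insert y S)))) ∧
      ∀ k S, j < k → y ∉ S → c.run (ext (ket (dickeBits ℓ k S))) = ext (ket (dickeBits ℓ k S)) := by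
    intro j
    induction j with
    | zero =>
      refine fun _ _ => ⟨[], by simp, fun k S hk _ => ?_, fun k S _ _ => by simp⟩
      obtain rfl : k = 0 := by omega
      simp [div_self hM0.ne']
    | succ j ih =>
      intro hj hjM
      obtain ⟨c, hl, h1, h2⟩ := ih (by omega) (by omega)
      have hsum : Real.sqrt ((M - (j + 1) : ℕ) / M) ^ 2 + ‖(Real.sqrt ((j + 1 : ℕ) / M) : ℂ)‖ ^ 2 = 1 := by
        rw [Complex.norm_real, Real.norm_of_nonneg (Real.sqrt_nonneg _),
          Real.sq_sqrt (by positivity), Real.sq_sqrt (by positivity), ← add_div, ← Nat.cast_add,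
          show M - (j + 1) + (j + 1) = M by omega, div_self hM0.ne']
      obtain ⟨d, hdl, d1, d2, d3⟩ := dicke_substep (ℓ := ℓ) y j hj _ _ hsum
      refine ⟨c ++ d, by rw [List.length_append]; omega, fun k S hk hS => ?_, fun k S hk hS => ?_⟩
      · rcases Nat.lt_or_ge j k with hjk | hjk
        · obtain rfl : k = j + 1 := by omega
          rw [Circuit.run_append, h2 _ _ hjk hS, d1 _ hS, Nat.add_sub_cancel]
        · rw [Circuit.run_append, h1 _ _ hjk hS, Circuit.run_add, Circuit.run_smul,
            Circuit.run_smul, d2 _ _ (by omega) hS]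
          rcases Nat.eq_zero_or_pos k with rfl | hk0
          · simp
          · rw [d3 _ _ (by omega)]
      · rw [Circuit.run_append, h2 _ _ (by omega) hS, d2 _ _ (by omega) hS]
  obtain ⟨c, hl, h1, -⟩ := key (min ℓ M) (min_le_left _ _) (min_le_right _ _)
  exact ⟨c, hl.trans (Nat.mul_le_mul_right _ (min_le_left _ _)),
    fun k S hk hkM hS => h1 k S (le_min hk hkM) hS⟩

/-- Subsets of `insert y U` are split by membership of `y`; the conditional amplitudes of
`dicke_step` turn the binomial coefficients for `U` into the one for `insert y U`. -/
theorem dicke_unload (U : Finset Y) :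
    ∃ c : Circuit ((Y ⊕ Fin (ℓ + 1)) ⊕ ℕ), c.length ≤ U.card * (ℓ * 7) ∧
      ∀ k S, k ≤ ℓ → k ≤ U.card → Disjoint S U → c.run (ext (ket (dickeBits ℓ k S))) =
        ∑ S' ∈ U.powersetCard k, (1 / Real.sqrt (U.card.choose k) : ℂ) •
          ext (ket (dickeBits ℓ 0 (S ∪ S'))) := by
  induction U using Finset.induction_on with
  | empty =>
    refine ⟨[], by simp, fun k S _ hk _ => ?_⟩
    obtain rfl : k = 0 := by simpa using hk
    simp
  | insert y U hy ih =>
    obtain ⟨c, hl, h⟩ := ih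
    obtain ⟨d, hdl, hd⟩ := dicke_step (ℓ := ℓ) y (U.card + 1) (by omega)
    refine ⟨d ++ c, ?_, fun k S hk hkU hS => ?_⟩
    · rw [List.length_append, Finset.card_insert_of_notMem hy]
      linarith
    rw [Finset.card_insert_of_notMem hy] at hkU ⊢
    rw [Finset.disjoint_insert_right] at hS
    have hM0 : (0 : ℝ) < (U.card + 1 : ℕ) := by positivity
    rw [Circuit.run_append, hd k S hk hkU hS.1, Circuit.run_add, Circuit.run_smul, Circuit.run_smul]
    rcases k with _ | k
    · rw [h 0 S (by omega) (by omega) hS.2]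
      simp [div_self (by positivity : (U.card : ℝ) + 1 ≠ 0)]
    -- Here `x` is the conditional probability and `a`, `b` are the binomial coefficients before and
    -- after; for `x = 0` the quotient `1 / √a` degenerates, and that case is excluded at each use.
    have hch : ∀ (a b : ℕ) (x : ℝ), 0 < b → 0 ≤ x → x * b = a →
        (Real.sqrt x : ℂ) * (1 / Real.sqrt (a : ℝ)) = 1 / Real.sqrt (b : ℝ) ∨ x = 0 := by
      intro a b x hb hx hab
      rcases hx.eq_or_lt with h0 | h0
      · exact Or.inr h0.symm
      · left
        rw [← hab, Real.sqrt_mul hx]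
        have h1 : (Real.sqrt x : ℂ) ≠ 0 := by exact_mod_cast (Real.sqrt_pos.2 h0).ne'
        push_cast
        field_simp
    have hchoose : 0 < (U.card + 1).choose (k + 1) := Nat.choose_pos hkU
    have hdisj : Disjoint (Finset.powersetCard (k + 1) U)
        ((Finset.powersetCard k U).image (insert y)) := by
      rw [Finset.disjoint_left]
      intro A hA hA'
      obtain ⟨B, -, rfl⟩ := Finset.mem_image.1 hA'
      exact hy ((Finset.mem_powersetCard.1 hA).1 (Finset.mem_insert_self _ _))
    have hinj : Set.InjOn (insert y) (Finset.powersetCard k U : Set (Finset Y)) := by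
      intro A hA B hB hAB
      have hA' : y ∉ A := fun h => hy ((Finset.mem_powersetCard.1 hA).1 h)
      have hB' : y ∉ B := fun h => hy ((Finset.mem_powersetCard.1 hB).1 h)
      rw [← Finset.erase_insert hA', ← Finset.erase_insert hB']
      exact congrArg (Finset.erase · y) hAB
    rw [Finset.powersetCard_succ_insert hy, Finset.sum_union hdisj, Finset.sum_image hinj]
    congr 1
    · rcases Nat.lt_or_ge U.card (k + 1) with hlt | hge
      · have : U.card + 1 - (k + 1) = 0 := by omega
        rw [Finset.powersetCard_eq_empty.2 hlt, Finset.sum_empty, this]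
        simp
      · rw [h (k + 1) S hk hge hS.2, Finset.smul_sum]
        refine Finset.sum_congr rfl fun S' _ => ?_
        rw [smul_smul]
        congr 1
        have hx0 : (0 : ℝ) < ((U.card + 1 - (k + 1) : ℕ) : ℝ) / (U.card + 1 : ℕ) := by
          by_cases h0 : U.card + 1 - (k + 1) = 0
          · omega
          · exact div_pos (by exact_mod_cast Nat.pos_of_ne_zero h0) hM0
        refine (hch (U.card.choose (k + 1)) _ _ hchoose hx0.le ?_).resolve_right hx0.ne'
        rw [div_mul_eq_mul_div, div_eq_iff hM0.ne']
        have := Nat.choose_mul_succ_eq U.card (k + 1)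
        exact_mod_cast (by rw [mul_comm, ← this])
    · rw [Nat.add_sub_cancel, h k (insert y S) (by omega) (by omega)
        (Finset.disjoint_insert_left.2 ⟨hy, hS.2⟩), Finset.smul_sum]
      refine Finset.sum_congr rfl fun S' _ => ?_
      rw [smul_smul, Finset.insert_union, ← Finset.union_insert]
      congr 1
      have hx0 : (0 : ℝ) < ((k + 1 : ℕ) : ℝ) / (U.card + 1 : ℕ) := by positivity
      refine (hch (U.card.choose k) _ _ hchoose hx0.le ?_).resolve_right hx0.ne'
      rw [div_mul_eq_mul_div, div_eq_iff hM0.ne']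
      have := Nat.add_one_mul_choose_eq U.card k
      exact_mod_cast (by rw [mul_comm, ← this, mul_comm])

/-- Preparation of a weighted Dicke state. -/
theorem impl_dicke [Fintype Y] (hℓ : ℓ ≤ Fintype.card Y) (w : Fin (ℓ + 1) → ℂ)
    (hw : ∑ k, ‖w k‖ ^ 2 = 1) :
    Impl ((ℓ + 1) * (30 * (ℓ + 2)) + Fintype.card Y * (ℓ * 7) + 2)
      (fun _ : Unit => ket fun _ : Y => false)
      (fun _ => ∑ k : Fin (ℓ + 1), (w k / (Real.sqrt ((Fintype.card Y).choose k) : ℂ)) •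
        ∑ S ∈ (Finset.univ : Finset Y).powersetCard (k : ℕ), ket fun y => decide (y ∈ S)) := by
  let R := Fin (ℓ + 1)
  let K : Bool → (R → Bool) → Finset Y → QState (Y ⊕ Option R) := fun t ρ S =>
    ket (Sum.elim (fun y => decide (y ∈ S)) fun w => w.elim t ρ)
  have hK : ∀ S, emb (Function.Embedding.inl : Y ↪ Y ⊕ Option R) (fun _ => false)
      (ket fun y => decide (y ∈ S)) = K false (fun _ => false) S := fun S => by
    refine emb_ket _ (fun i => rfl) ?_
    rintro (w | (_ | i)) hw
    · exact absurd ⟨w, rfl⟩ hw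
    · rfl
    · rfl
  -- The flag is set, exchanged for the one-hot counter with amplitudes `w k`, and the counter is
  -- unloaded into the mask. It then shows `0` in every branch, so one Pauli gate clears it.
  have s1 : Impl 1 (fun _ : Unit => K false (fun _ => false) ∅)
      (fun _ => K true (fun _ => false) ∅) := by
    refine (Impl.gate (Gate.one pauliX (Sum.inr none)) _).congr (fun _ => rfl) fun _ => ?_
    rw [pauliX_ket]
    refine congrArg ket ?_
    rw [eq_setBit_iff]
    refine ⟨rfl, ?_⟩
    rintro (w | (_ | i)) hw
    · rfl
    · exact absurd rfl hw
    · rfl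
  have s2 : Impl ((ℓ + 1) * (30 * (ℓ + 2))) (fun _ : Unit => K true (fun _ => false) ∅)
      (fun _ => ∑ k : R, w k • K false (fun i => decide ((i : ℕ) = k)) ∅) := by
    have h := (impl_prep (fun (k i : R) => decide ((i : ℕ) = k))
      (fun k h => by simpa using congrFun h k)
      (fun k k' h => Fin.ext (by simpa using congrFun h k)) w hw).emb
        (Function.Embedding.inr : Option R ↪ Y ⊕ Option R)
    have hemb : ∀ (t : Bool) (ρ : R → Bool), emb (Function.Embedding.inr : Option R ↪ Y ⊕ Option R)
        (fun _ => false) (ket fun w => w.elim t ρ) = K t ρ ∅ := fun t ρ => by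
      refine emb_ket _ (fun i => rfl) ?_
      rintro (w | i) hw
      · simp
      · exact absurd ⟨i, rfl⟩ hw
    refine ((h.reindex fun _ : Unit => (true, fun _ => false)).mono ?_).congr ?_ ?_
    · rw [Fintype.card_fin]
    · exact fun _ => (hemb true _).symm
    · exact fun _ => by simp only [if_true, emb_sum, emb_smul, hemb]
  have hmove : ∀ S, emb (Function.Embedding.sumMap (Function.Embedding.refl Y) Function.Embedding.some :
      Y ⊕ R ↪ Y ⊕ Option R) (fun _ => false) (ket (dickeBits ℓ 0 S)) =
        K false (fun i => decide ((i : ℕ) = 0)) S := fun S => by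
    refine emb_ket _ ?_ ?_
    · rintro (y | i) <;> rfl
    · rintro (y | (_ | i)) hw
      · exact absurd ⟨Sum.inl y, rfl⟩ hw
      · rfl
      · exact absurd ⟨Sum.inr i, rfl⟩ hw
  have s3 : Impl (Fintype.card Y * (ℓ * 7))
      (fun k : R => K false (fun i => decide ((i : ℕ) = k)) ∅)
      (fun k => ∑ S ∈ (Finset.univ : Finset Y).powersetCard (k : ℕ),
        (1 / Real.sqrt ((Fintype.card Y).choose k) : ℂ) • K false (fun i => decide ((i : ℕ) = 0)) S) := by
    obtain ⟨c, hl, h⟩ := dicke_unload (ℓ := ℓ) (Finset.univ : Finset Y)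
    have h' : Impl (Fintype.card Y * (ℓ * 7)) (fun k : R => ket (dickeBits ℓ k (∅ : Finset Y)))
        (fun k => ∑ S ∈ (Finset.univ : Finset Y).powersetCard (k : ℕ),
          (1 / Real.sqrt ((Fintype.card Y).choose k) : ℂ) • ket (dickeBits ℓ 0 S)) := by
      refine ⟨c, hl, fun k => ?_⟩
      have hk : (k : ℕ) ≤ ℓ := Nat.lt_succ_iff.1 k.2
      rw [h k ∅ hk (hk.trans hℓ) (Finset.disjoint_empty_left _), ext_sum]
      simp only [ext_smul, Finset.empty_union, Finset.card_univ]
    refine ((h'.emb (Function.Embedding.sumMap (Function.Embedding.refl Y)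
      Function.Embedding.some)).reindex fun k : R => (k, fun _ => false)).congr ?_ ?_
    · intro k
      refine (emb_ket _ ?_ ?_).symm
      · rintro (y | i) <;> rfl
      · rintro (y | (_ | i)) hw
        · exact absurd ⟨Sum.inl y, rfl⟩ hw
        · rfl
        · exact absurd ⟨Sum.inr i, rfl⟩ hw
    · intro k
      simp only [emb_sum, emb_smul]
      exact Finset.sum_congr rfl fun S _ => by rw [← hmove S]
  have s4 : Impl 1 (fun S : Finset Y => K false (fun i => decide ((i : ℕ) = 0)) S)
      (fun S => K false (fun _ => false) S) := by
    refine (Impl.gate (Gate.one pauliX (Sum.inr (some 0))) _).congr (fun _ => rfl) fun S => ?_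
    rw [pauliX_ket]
    refine congrArg ket ?_
    rw [eq_setBit_iff]
    refine ⟨by simp, ?_⟩
    rintro (w | (_ | i)) hw
    · rfl
    · rfl
    · have : i ≠ 0 := fun h => hw (congrArg (fun i => Sum.inr (some i)) h)
      simpa using this
  have s34 := s3.comp (s4.sum (fun k : R => (Finset.univ : Finset Y).powersetCard (k : ℕ))
    fun k _ => (1 / Real.sqrt ((Fintype.card Y).choose k) : ℂ))
  have s234 := s2.comp (s34.sum (fun _ : Unit => Finset.univ) fun _ k => w k)
  refine Impl.hide (Z := Option R) (((s1.comp s234).mono ?_).congr ?_ ?_)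
  · omega
  · intro _
    rw [← hK]
    simp
  · intro _
    simp only [emb_sum, emb_smul, hK, Finset.smul_sum, smul_smul, mul_one_div]
    rfl

end Dicke

/-! ### Independent circuits -/

section Tensor

variable {W J Y : Type*} [Fintype J] [DecidableEq J] [Fintype Y] [DecidableEq Y]

/-- Circuits that each act on one component of a family of states. -/
theorem run_flatMap_tensor (K : (J → Option Y) → QState W) (c : J → Circuit W) (α : J → Y → ℂ)
    (h : ∀ j v, v j = none → (c j).run (K v) = ∑ y, α j y • K (Function.update v j (some y))) :
    Circuit.run ((Finset.univ : Finset J).toList.flatMap c) (K fun _ => none) =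
      ∑ u : J → Y, (∏ j, α j (u j)) • K fun j => some (u j) := by
  -- The value `none` marks a component that has not been processed. The state `ψ s` is the product
  -- state in which exactly the components in `s` have been.
  let t : Finset J → J → Finset (Option Y) := fun s j =>
    if j ∈ s then Finset.univ.image some else {none}
  let α' : J → Option Y → ℂ := fun j o => o.elim 1 (α j)
  let ψ : Finset J → QState W := fun s =>
    ∑ v ∈ Fintype.piFinset (t s), (∏ j, α' j (v j)) • K v
  have step : ∀ s j, j ∉ s → (c j).run (ψ s) = ψ (insert j s) := by
    intro s j hj
    have hnone : ∀ v ∈ Fintype.piFinset (t s), v j = none := fun v hv => by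
      simpa [t, hj] using Fintype.mem_piFinset.1 hv j
    simp only [ψ, Circuit.run_sum, Circuit.run_smul]
    rw [Finset.sum_congr rfl fun v hv => by rw [h j v (hnone v hv), Finset.smul_sum],
      ← Finset.sum_product']
    refine Finset.sum_bij' (fun x _ => Function.update x.1 j (some x.2))
      (fun v hv => (Function.update v j none, (v j).get (by
        have := Fintype.mem_piFinset.1 hv j
        simp only [t, Finset.mem_insert_self, if_true, Finset.mem_image] at this
        obtain ⟨y, -, hy⟩ := this
        simp [← hy]))) ?_ ?_ ?_ ?_ ?_
    · rintro ⟨v, y⟩ hv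
      have hv := Fintype.mem_piFinset.1 (Finset.mem_product.1 hv).1
      refine Fintype.mem_piFinset.2 fun i => ?_
      rcases eq_or_ne i j with rfl | hij
      · simp [t]
      · simpa [t, hij] using hv i
    · intro v hv
      have hv := Fintype.mem_piFinset.1 hv
      refine Finset.mem_product.2 ⟨Fintype.mem_piFinset.2 fun i => ?_, Finset.mem_univ _⟩
      rcases eq_or_ne i j with rfl | hij
      · simp [t, hj]
      · simpa [t, hij] using hv i
    · rintro ⟨v, y⟩ hv
      have := hnone v (Finset.mem_product.1 hv).1
      ext1
      · simp [← this]
      · simp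
    · intro v hv
      simp
    · rintro ⟨v, y⟩ hv
      have := hnone v (Finset.mem_product.1 hv).1
      rw [smul_smul]
      congr 1
      rw [← Finset.mul_prod_erase _ _ (Finset.mem_univ j),
        ← Finset.mul_prod_erase _ (fun i => α' i (Function.update v j (some y) i)) (Finset.mem_univ j)]
      simp only [Function.update_self, this, α', Option.elim_none, Option.elim_some, one_mul]
      rw [mul_comm]
      congr 1
      refine Finset.prod_congr rfl fun i hi => ?_
      rw [Function.update_of_ne (Finset.ne_of_mem_erase hi)]
  have key : ∀ (l : List J), l.Nodup → ∀ s, (∀ j ∈ l, j ∉ s) →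
      (Circuit.run (l.flatMap c) (ψ s) = ψ (s ∪ l.toFinset)) := by
    intro l
    induction l with
    | nil => intro _ s _; simp
    | cons j l ih =>
      intro hl s hs
      rw [List.nodup_cons] at hl
      rw [List.flatMap_cons, Circuit.run_append, step s j (hs j List.mem_cons_self),
        ih hl.2 (insert j s) fun i hi => by
          rw [Finset.mem_insert, not_or]
          exact ⟨fun h => hl.1 (h ▸ hi), hs i (List.mem_cons_of_mem _ hi)⟩]
      congr 1
      ext i
      simp only [Finset.mem_union, Finset.mem_insert, List.mem_toFinset, List.mem_cons]
      tauto
  have h0 : ψ ∅ = K fun _ => none := by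
    have : Fintype.piFinset (t ∅) = {fun _ => none} := by
      ext v
      simp [t, funext_iff]
    simp [ψ, this, α']
  have h1 := key _ (Finset.nodup_toList (Finset.univ : Finset J)) ∅ (fun _ _ => Finset.notMem_empty _)
  rw [h0, Finset.toList_toFinset, Finset.empty_union] at h1
  rw [h1]
  have : Fintype.piFinset (t Finset.univ) = Finset.univ.image fun (u : J → Y) j => some (u j) := by
    ext v
    simp only [t, Finset.mem_univ, if_true, Fintype.mem_piFinset, Finset.mem_image, true_and]
    refine ⟨fun hv => ?_, ?_⟩
    · choose u hu using hv
      exact ⟨u, funext hu⟩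
    · rintro ⟨u, rfl⟩ j
      exact ⟨u j, rfl⟩
  simp only [ψ]
  rw [this, Finset.sum_image]
  · rfl
  · intro u _ u' _ huu
    funext j
    exact Option.some_injective _ (congrFun huu j)

theorem length_flatMap_le {J : Type*} [Fintype J] (c : J → Circuit W) {N : ℕ} (h : ∀ j, (c j).length ≤ N) :
    ((Finset.univ : Finset J).toList.flatMap c).length ≤ Fintype.card J * N := by
  rw [List.length_flatMap]
  refine (List.sum_le_card_nsmul _ N fun x hx => ?_).trans_eq (by simp)
  obtain ⟨j, -, rfl⟩ := List.mem_map.1 hx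
  exact h j

end Tensor

/-! ### Amplitude amplification -/

section Amplify

variable {W ι : Type*}

/-- A diagonal operator. -/
def diag (ω : (W → Bool) → ℂ) (ψ : QState W) : QState W := fun s => ω s * ψ s

theorem diag_ket (ω : (W → Bool) → ℂ) (s : W → Bool) : diag ω (ket s) = ω s • ket s := by
  classical
  funext t
  simp only [diag, Pi.smul_apply, smul_eq_mul, ket_apply]
  split_ifs with h
  · rw [h]
  · simp

theorem diag_sum (ω : (W → Bool) → ℂ) (s : Finset ι) (ψ : ι → QState W) :
    diag ω (∑ i ∈ s, ψ i) = ∑ i ∈ s, diag ω (ψ i) := by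
  funext t
  simp [diag, Finset.sum_apply, Finset.mul_sum]

theorem diag_smul (ω : (W → Bool) → ℂ) (a : ℂ) (ψ : QState W) :
    diag ω (a • ψ) = a • diag ω ψ := by
  funext t
  simp only [diag, Pi.smul_apply, smul_eq_mul]
  ring

variable [Fintype W] [DecidableEq W]

theorem Impl.diag {N : ℕ} {ω : (W → Bool) → ℂ} (h : Impl N ket fun s => ω s • ket s) :
    Impl N (fun ψ => ψ) (DQI.diag ω) := by
  refine h.total.congr (fun _ => rfl) fun ψ => ?_
  conv_lhs => rw [← sum_ket ψ]
  simp only [diag_sum, diag_smul, diag_ket]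

/-- The reflection that negates the basis states with the property `f`. -/
def reflect (f : (W → Bool) → Bool) : QState W → QState W := diag fun s => if f s then -1 else 1

/-- Amplitude amplification with `2 * j + 1` applications of `V`, if the angle is such that it is
exact. -/
theorem impl_amplify {N₁ N₂ N₃ : ℕ} {V : QState W → QState W} (hV : Impl N₁ (fun ψ => ψ) V)
    {V' : QState W → QState W} (hVV' : ∀ ψ, V (V' ψ) = ψ) (hV'V : ∀ ψ, V' (V ψ) = ψ)
    (hadd : ∀ (a b : ℂ) ψ φ, V (a • ψ + b • φ) = a • V ψ + b • V φ)
    {good start : (W → Bool) → Bool}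
    (hgood : Impl N₂ (fun ψ => ψ) (reflect good))
    (hstart : Impl N₃ (fun ψ => ψ) (reflect fun s => !start s))
    (j : ℕ) (hj : 0 < j) (ψ G : ι → QState W)
    (hψ : ∀ i s, start s = false → ψ i s = 0) (hG : ∀ i s, good s = false → G i s = 0)
    (h1 : ∀ i s, good s = true → V (ψ i) s = Real.sin (Real.pi / (2 * (2 * j + 1))) * G i s)
    (h2 : ∀ i s, start s = true → V' (G i) s = Real.sin (Real.pi / (2 * (2 * j + 1))) * ψ i s) :
    Impl (N₁ + j * (N₂ + N₁ + N₃ + N₁)) ψ G := by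
  set θ := Real.pi / (2 * (2 * j + 1)) with hθ
  have hV'add : ∀ (a b : ℂ) ψ φ, V' (a • ψ + b • φ) = a • V' ψ + b • V' φ := fun a b ψ φ => by
    rw [← hV'V (a • V' ψ + b • V' φ), hadd, hVV', hVV']
  have hV'i : Impl N₁ (fun ψ => ψ) V' :=
    (hV.symm.reindex V').congr (fun ψ => (hVV' ψ).symm) fun ψ => rfl
  have hQ : Impl (N₂ + N₁ + N₃ + N₁) (fun ψ => ψ)
      (fun ψ => V (reflect (fun s => !start s) (V' (reflect good ψ)))) := by
    refine ((hgood.comp (hV'i.reindex _)).comp (hstart.reindex _)).comp (hV.reindex _)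
  -- For each `i`, the iterate `Q` preserves the span of `V (ψ i)` and `G i`, and its matrix there
  -- depends only on the angle `θ`.
  set Q := fun ψ => V (reflect (fun s => !start s) (V' (reflect good ψ))) with hQdef
  have hR : ∀ i, reflect good (V (ψ i)) = (1 : ℂ) • V (ψ i) + (-(2 * Real.sin θ) : ℂ) • G i := by
    intro i
    funext s
    simp only [reflect, DQI.diag, Pi.add_apply, Pi.smul_apply, smul_eq_mul]
    cases hs : good s
    · rw [hG i s hs]; simp
    · have := h1 i s hs
      rw [this]; simp; ring
  have hRG : ∀ i, reflect good (G i) = (-1 : ℂ) • G i := by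
    intro i
    funext s
    simp only [reflect, DQI.diag, Pi.smul_apply, smul_eq_mul]
    cases hs : good s
    · rw [hG i s hs]; simp
    · simp
  have hS : ∀ i, reflect (fun s => !start s) (ψ i) = ψ i := by
    intro i
    funext s
    simp only [reflect, DQI.diag]
    rcases Bool.eq_false_or_eq_true (start s) with hs | hs
    · simp [hs]
    · rw [hψ i s hs]; simp
  have hSG : ∀ i, reflect (fun s => !start s) (V' (G i)) =
      (2 * Real.sin θ : ℂ) • ψ i + (-1 : ℂ) • V' (G i) := by
    intro i
    funext s
    simp only [reflect, DQI.diag, Pi.add_apply, Pi.smul_apply, smul_eq_mul]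
    rcases Bool.eq_false_or_eq_true (start s) with hs | hs
    · rw [h2 i s hs]; simp [hs]; ring
    · rw [hψ i s hs]; simp [hs]
  have hradd : ∀ (f : (W → Bool) → Bool) (a b : ℂ) ψ φ,
      reflect f (a • ψ + b • φ) = a • reflect f ψ + b • reflect f φ := fun f a b ψ φ => by
    funext s
    simp only [reflect, DQI.diag, Pi.add_apply, Pi.smul_apply, smul_eq_mul]
    ring
  have hQadd : ∀ (a b : ℂ) ψ φ, Q (a • ψ + b • φ) = a • Q ψ + b • Q φ := fun a b ψ φ => by
    simp only [hQdef, hradd, hV'add, hadd]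
  have hQG : ∀ i, Q (G i) = (-(2 * Real.sin θ) : ℂ) • V (ψ i) + (1 : ℂ) • G i := fun i => by
    have e : (-1 : ℂ) • G i = (-1 : ℂ) • G i + (0 : ℂ) • G i := by simp
    simp only [hQdef]
    rw [hRG, e, hV'add, hradd, hadd, hSG, hadd, hVV']
    module
  have hQV : ∀ i, Q (V (ψ i)) = (1 - 4 * Real.sin θ ^ 2 : ℂ) • V (ψ i) +
      (2 * Real.sin θ : ℂ) • G i := fun i => by
    simp only [hQdef]
    rw [hR, hV'add, hV'V, hradd, hS, hSG, hadd, hadd, hVV']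
    module
  have hiter : ∀ k : ℕ, Impl (N₁ + k * (N₂ + N₁ + N₃ + N₁)) ψ (fun i => Q^[k] (V (ψ i))) := by
    intro k
    induction k with
    | zero => simpa using hV.reindex ψ
    | succ k ih =>
      refine ((ih.comp (hQ.reindex _)).mono ?_).congr (fun _ => rfl) fun i => ?_
      · linarith
      · rw [Function.iterate_succ_apply']
  -- The usual rotation by `2θ`, in the basis of `V (ψ i)` and `G i`, which is not orthogonal. The
  -- factor `cos θ` clears denominators.
  have hval : ∀ (k : ℕ) i, (Real.cos θ : ℂ) • Q^[k] (V (ψ i)) =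
      (Real.cos ((2 * k + 1) * θ) : ℂ) • V (ψ i) + (Real.sin (2 * k * θ) : ℂ) • G i := by
    intro k i
    induction k with
    | zero => simp
    | succ k ih =>
      have e1 : Real.sin (2 * (k + 1 : ℕ) * θ) =
          2 * Real.sin θ * Real.cos ((2 * k + 1) * θ) + Real.sin (2 * k * θ) := by
        have a1 : 2 * ((k + 1 : ℕ) : ℝ) * θ = (2 * k + 1) * θ + θ := by push_cast; ring
        have a2 : 2 * (k : ℝ) * θ = (2 * k + 1) * θ - θ := by ring
        rw [a1, a2, Real.sin_add, Real.sin_sub]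
        ring
      have e2 : Real.cos ((2 * (k + 1 : ℕ) + 1) * θ) =
          (1 - 4 * Real.sin θ ^ 2) * Real.cos ((2 * k + 1) * θ) -
            2 * Real.sin θ * Real.sin (2 * k * θ) := by
        have a1 : (2 * ((k + 1 : ℕ) : ℝ) + 1) * θ = 2 * (k + 1 : ℕ) * θ + θ := by ring
        have a2 : (2 * (k : ℝ) + 1) * θ = 2 * (k + 1 : ℕ) * θ - θ := by push_cast; ring
        have e3 : Real.cos ((2 * (k + 1 : ℕ) + 1) * θ) = Real.cos ((2 * k + 1) * θ) -
            2 * Real.sin θ * Real.sin (2 * (k + 1 : ℕ) * θ) := by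
          rw [a1, a2, Real.cos_add, Real.cos_sub]
          ring
        rw [e3, e1]
        ring
      have e0 : (Real.cos θ : ℂ) • Q (Q^[k] (V (ψ i))) = Q ((Real.cos θ : ℂ) • Q^[k] (V (ψ i))) := by
        have := hQadd (Real.cos θ) 0 (Q^[k] (V (ψ i))) 0
        simpa using this.symm
      rw [Function.iterate_succ_apply', e0, ih, hQadd, hQG, hQV, e1, e2]
      push_cast
      module
  refine (hiter j).congr (fun _ => rfl) fun i => ?_
  have hpos : (0 : ℝ) < 2 * j + 1 := by positivity
  -- This is where `0 < j` is needed: for `j = 0` the angle would be `π / 2`.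
  have hcos : Real.cos θ ≠ 0 := by
    refine (Real.cos_pos_of_mem_Ioo ⟨?_, ?_⟩).ne'
    · have : 0 < θ := by positivity
      linarith [Real.pi_pos]
    · rw [hθ]
      have : (1 : ℝ) ≤ j := by exact_mod_cast hj
      exact div_lt_div_of_pos_left Real.pi_pos (by norm_num) (by linarith)
  have := hval j i
  have a1 : (2 * (j : ℝ) + 1) * θ = Real.pi / 2 := by rw [hθ]; field_simp
  have a2 : 2 * (j : ℝ) * θ = Real.pi / 2 - θ := by rw [← a1]; ring
  rw [a1, a2, Real.cos_pi_div_two, Real.sin_pi_div_two_sub, Complex.ofReal_zero, zero_smul,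
    zero_add] at this
  exact (smul_right_injective _ (Complex.ofReal_ne_zero.2 hcos) this).symm

end Amplify

/-! ### The additive character -/

section Character

variable {p : ℕ} [Fact p.Prime] {F : Type*} [Field F] [Fintype F] [Algebra (ZMod p) F]

variable (p F) in
/-- `chi` as an additive character. -/
def chiChar : AddChar F ℂ :=
  (ZMod.stdAddChar (N := p)).compAddMonoidHom (Algebra.trace (ZMod p) F).toAddMonoidHom

theorem chi_eq (x : F) : chi p x = chiChar p F x := rfl

/-- The trace is not the zero map and the standard character is injective, so `chiChar` is
nontrivial; over a field this suffices. -/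
theorem chiChar_isPrimitive : (chiChar p F).IsPrimitive := by
  refine AddChar.IsPrimitive.of_ne_one fun h => ?_
  refine Algebra.trace_ne_zero (ZMod p) F (LinearMap.ext fun x => ?_)
  refine ZMod.injective_stdAddChar ?_
  have := DFunLike.congr_fun h x
  rw [LinearMap.zero_apply, AddChar.map_zero_eq_one]
  exact this

theorem chi_zero : chi p (0 : F) = 1 := AddChar.map_zero_eq_one (chiChar p F)

theorem chi_add (x y : F) : chi p (x + y) = chi p x * chi p y :=
  AddChar.map_add_eq_mul (chiChar p F) x y

theorem chi_sum {ι : Type*} (s : Finset ι) (f : ι → F) :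
    chi p (∑ i ∈ s, f i) = ∏ i ∈ s, chi p (f i) := by
  classical
  induction s using Finset.induction_on with
  | empty => simp [chi_zero]
  | insert i s hi ih => rw [Finset.sum_insert hi, Finset.prod_insert hi, chi_add, ih]

theorem norm_chi (x : F) : ‖chi p x‖ = 1 := by
  rw [chi, ZMod.stdAddChar_apply]
  exact Circle.norm_coe _

theorem star_chi (x : F) : star (chi p x) = chi p (-x) := by
  have h : chi p x * chi p (-x) = 1 := by rw [← chi_add, add_neg_cancel, chi_zero]
  have h' : chi p x * star (chi p x) = 1 := by
    rw [Complex.star_def, Complex.mul_conj, Complex.normSq_eq_norm_sq, norm_chi]; simp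
  have h0 : chi p x ≠ 0 := fun h0 => by simp [h0] at h
  exact mul_left_cancel₀ h0 (h'.trans h.symm)

theorem sum_chi_mul [DecidableEq F] (b : F) :
    ∑ x : F, chi p (x * b) = if b = 0 then (Fintype.card F : ℂ) else 0 := by
  simpa [chi_eq] using AddChar.sum_mulShift b (chiChar_isPrimitive (p := p) (F := F))

end Character

/-! ### Valid encodings -/

section Valid

variable {X : Type*} {B : Set (X → Bool)} {p : ℕ} [hp : Fact p.Prime] {F : Type*} [Field F]
  [Algebra (ZMod p) F] {a : ℕ} (β : Module.Basis (Fin a) (ZMod p) F)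

theorem exists_enc_iff (u : Sym p a → Bool) :
    (∃ x, enc β x = u) ↔ ∀ i, Nat.ofBits (fun j => u (i, j)) < p := by
  have : NeZero p := ⟨hp.out.ne_zero⟩
  constructor
  · rintro ⟨x, rfl⟩ i
    refine lt_of_eq_of_lt ?_ (β.repr x i).val_lt
    rw [show (fun j => enc β x (i, j)) = fun j : Fin (Nat.clog 2 p) => (β.repr x i).val.testBit j
      from rfl, Nat.ofBits_testBit, Nat.mod_eq_of_lt]
    exact (β.repr x i).val_lt.trans_le (Nat.le_pow_clog one_lt_two p)
  · intro h
    refine ⟨β.equivFun.symm fun i => (Nat.ofBits fun j => u (i, j) : ℕ), ?_⟩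
    funext ⟨i, j⟩
    have : β.repr (β.equivFun.symm fun i => ((Nat.ofBits fun j => u (i, j) : ℕ) : ZMod p)) i =
        ((Nat.ofBits fun j => u (i, j) : ℕ) : ZMod p) := by
      rw [← Module.Basis.equivFun_apply, LinearEquiv.apply_symm_apply]
    simp only [enc]
    rw [this, ZMod.val_natCast_of_lt (h i), Nat.testBit_ofBits_lt _ _ j.2]

-- A bit string encodes a field element exactly if each block is a number less than `p`, which is
-- one comparison with a constant for each coordinate.
open Classical in
theorem bcomp_valid (u : X → Sym p a → Bool) (hu : ∀ r, (fun x => u x r) ∈ B) :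
    BComp B (10 * symBits p a) {fun x => decide (∃ y, enc β y = u x)} := by
  set k := Nat.clog 2 p with hk
  have hk1 : 1 ≤ k := Nat.clog_pos one_lt_two hp.out.two_le
  have hpk : p < 2 ^ (k + 1) :=
    (Nat.le_pow_clog one_lt_two p).trans_lt (Nat.pow_lt_pow_right one_lt_two (Nat.lt_succ_self _))
  have h := BComp.all (B := B) (n := 4 * (k + 1) + 1) (Finset.univ : Finset (Fin a))
    (fun i x => (BitVec.ofNat (k + 1) (Nat.ofBits fun j => u x (i, j))).ult (BitVec.ofNat (k + 1) p))
    fun i _ => by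
      have h0 : BComp B 0 (bvBits fun x => BitVec.ofNat (k + 1) (Nat.ofBits fun j => u x (i, j))) := by
        refine .of_subset ?_
        rintro _ ⟨j, rfl⟩
        by_cases hj : j < k
        · refine Or.inl ?_
          convert hu (i, ⟨j, hj⟩) using 1
          funext x
          beta_reduce
          rw [BitVec.getLsbD_ofNat, Nat.testBit_ofBits_lt _ _ hj]
          simp [show j < k + 1 by omega]
        · refine Or.inr ⟨false, ?_⟩
          funext x
          simp only [Function.const_apply]
          rw [BitVec.getLsbD_ofNat, Nat.testBit_ofBits_ge _ _ (by omega)]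
          simp
      exact (h0.trans (bcomp_ult_const _ (BitVec.ofNat (k + 1) p) Set.subset_union_right)).mono
        subset_rfl (by omega) subset_rfl
  refine h.mono subset_rfl ?_ (Set.singleton_subset_iff.2 ?_)
  · rw [Finset.card_univ, Fintype.card_fin, symBits, ← hk]
    nlinarith [Nat.zero_le a]
  · rw [Set.mem_singleton_iff]
    funext x
    rw [decide_eq_decide, exists_enc_iff]
    simp only [Finset.mem_univ, true_imp_iff]
    refine forall_congr' fun i => ?_
    have h1 : Nat.ofBits (fun j => u x (i, j)) < 2 ^ (k + 1) :=
      (Nat.ofBits_lt_two_pow _).trans (Nat.pow_lt_pow_right one_lt_two (Nat.lt_succ_self _))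
    rw [BitVec.ult, decide_eq_true_eq, BitVec.toNat_ofNat, BitVec.toNat_ofNat, Nat.mod_eq_of_lt h1,
      Nat.mod_eq_of_lt hpk]

end Valid

/-! ### Hadamard gates -/

section Hadamard

variable {W R : Type*}

/-- The entries of the Hadamard gate. -/
def hadamardEntry (b c : Bool) : ℂ := if b && c then -(1 / Real.sqrt 2 : ℂ) else (1 / Real.sqrt 2 : ℂ)

theorem sqrt_two_inv_sq : (1 / Real.sqrt 2 : ℂ) * (1 / Real.sqrt 2 : ℂ) = 1 / 2 := by
  rw [div_mul_div_comm, one_mul, ← Complex.ofReal_mul, Real.mul_self_sqrt (by norm_num)]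
  simp

/-- The Hadamard gate. -/
def hadamard : Matrix.unitaryGroup Bool ℂ :=
  mkUnitary (1 / Real.sqrt 2 : ℂ) (1 / Real.sqrt 2 : ℂ) (1 / Real.sqrt 2 : ℂ) (-(1 / Real.sqrt 2 : ℂ))
    (by have := sqrt_two_inv_sq; simp [Complex.conj_ofReal] at *; rw [this]; norm_num)
    (by simp [Complex.conj_ofReal])
    (by have := sqrt_two_inv_sq; simp [Complex.conj_ofReal] at *; rw [this]; norm_num)

theorem hadamard_apply (b c : Bool) :
    (hadamard : Matrix Bool Bool ℂ) b c = hadamardEntry b c := by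
  cases b <;> cases c <;> simp [hadamard, mkUnitary_apply, hadamardEntry]

variable [Fintype R]

/-- Hadamard gates on all qubits of a register. -/
def hadamards (f : R → W) : Circuit W :=
  (Finset.univ : Finset R).toList.flatMap fun r => [Gate.one hadamard (f r)]

theorem length_hadamards (f : R → W) : (hadamards f).length = Fintype.card R := by
  simp [hadamards, List.length_flatMap]

theorem run_hadamards [DecidableEq R] (f : R → W) (k : (R → Bool) → W → Bool) (hk : ∀ v r, k v (f r) = v r)
    (hk' : ∀ v r b, k (Function.update v r b) = setBit (k v) (f r) b) (v₀ : R → Bool) :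
    (hadamards f).run (ket (k v₀)) =
      ∑ v : R → Bool, (∏ r, hadamardEntry (v r) (v₀ r)) • ket (k v) := by
  have h := run_flatMap_tensor (fun o : R → Option Bool => ket (k fun r => (o r).getD (v₀ r)))
    (fun r => [Gate.one hadamard (f r)]) (fun r b => hadamardEntry b (v₀ r)) fun r o ho => by
      rw [Circuit.run_cons, Circuit.run_nil, Gate.one_ket, hk, ho]
      refine Finset.sum_congr rfl fun b _ => ?_
      rw [hadamard_apply, ← hk']
      congr 3
      funext r'
      rcases eq_or_ne r' r with rfl | hr
      · simp
      · simp [hr]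
  exact h

end Hadamard

/-! ### The inverse Fourier transform of one symbol -/

section SymbolQFT

variable {p : ℕ} [hp : Fact p.Prime] {F : Type*} [Field F] [Fintype F] [DecidableEq F]
  [Algebra (ZMod p) F] {a : ℕ} (β : Module.Basis (Fin a) (ZMod p) F)

/-- Two symbol registers and one further qubit. -/
abbrev QFTWire (p a : ℕ) := Sym p a ⊕ Sym p a ⊕ Unit

/-- The bits of two symbol registers and one further qubit. -/
def qftBits (s x : Sym p a → Bool) (t : Bool) : QFTWire p a → Bool :=
  Sum.elim s (Sum.elim x fun _ => t)

theorem qftBits_inj {s x s' x' : Sym p a → Bool} {t t' : Bool} :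
    qftBits s x t = qftBits s' x' t' ↔ s = s' ∧ x = x' ∧ t = t' := by
  refine ⟨fun h => ⟨?_, ?_, ?_⟩, fun ⟨h, h', h''⟩ => by rw [h, h', h'']⟩
  · exact funext fun r => congrFun h (Sum.inl r)
  · exact funext fun r => congrFun h (Sum.inr (Sum.inl r))
  · exact congrFun h (Sum.inr (Sum.inr ()))

theorem exists_qftBits (u : QFTWire p a → Bool) : ∃ s x t, u = qftBits s x t :=
  ⟨fun r => u (Sum.inl r), fun r => u (Sum.inr (Sum.inl r)), u (Sum.inr (Sum.inr ())), by
    funext w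
    rcases w with r | r | ⟨⟩ <;> rfl⟩

theorem setBit_qftBits_left (s x : Sym p a → Bool) (t : Bool) (r : Sym p a) (b : Bool) :
    qftBits (Function.update s r b) x t = setBit (qftBits s x t) (Sum.inl r) b := by
  classical
  rw [eq_setBit_iff]
  refine ⟨by simp [qftBits], ?_⟩
  rintro (r' | r' | ⟨⟩) h
  · have : r' ≠ r := fun h' => h (congrArg _ h')
    simp [qftBits, this]
  · rfl
  · rfl

theorem setBit_qftBits_right (s x : Sym p a → Bool) (t : Bool) (r : Sym p a) (b : Bool) :
    qftBits s (Function.update x r b) t = setBit (qftBits s x t) (Sum.inr (Sum.inl r)) b := by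
  classical
  rw [eq_setBit_iff]
  refine ⟨by simp only [qftBits, Sum.elim_inr, Sum.elim_inl, Function.update_self], ?_⟩
  rintro (r' | r' | ⟨⟩) h
  · rfl
  · have : r' ≠ r := fun h' => h (by rw [h'])
    exact Function.update_of_ne this _ _
  · rfl

theorem setBit_qftBits_unit (s x : Sym p a → Bool) (t b : Bool) :
    setBit (qftBits s x t) (Sum.inr (Sum.inr ())) b = qftBits s x b := by
  rw [setBit_eq_iff]
  refine ⟨rfl, ?_⟩
  rintro (r | r | ⟨⟩) h
  · rfl
  · rfl
  · exact absurd rfl h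

/-- The phase of the kernel of the inverse Fourier transform, as a function on bit strings. -/
def qftPhase (u : QFTWire p a → Bool) : ℂ :=
  ∏ r : Sym p a × Sym p a, if u (Sum.inl r.1) && u (Sum.inr (Sum.inl r.2)) then
    chi p (-(symVal β r.1 * symVal β r.2)) else 1

/-- The exponent `s * x` is bilinear in the bits, so the kernel is a product of phases for pairs of
bits. `qftPhase` is nevertheless defined on all strings, since Hadamard gates also produce invalid
encodings. -/
theorem qftPhase_enc (s x : F) (t : Bool) :
    qftPhase β (qftBits (enc β s) (enc β x) t) = chi p (-(s * x)) := by
  conv_rhs => rw [← sum_symVal β s, ← sum_symVal β x, Finset.sum_mul_sum, ← Finset.sum_product',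
    ← Finset.sum_neg_distrib, chi_sum]
  refine Finset.prod_congr rfl fun r _ => ?_
  simp only [qftBits, Sum.elim_inl, Sum.elim_inr]
  by_cases h₁ : enc β s r.1 = true <;> by_cases h₂ : enc β x r.2 = true <;> simp [h₁, h₂, chi_zero]

theorem norm_qftPhase (u : QFTWire p a → Bool) : ‖qftPhase β u‖ = 1 := by
  rw [qftPhase, norm_prod]
  refine Finset.prod_eq_one fun r _ => ?_
  split_ifs
  · exact norm_chi _
  · exact norm_one

theorem impl_qftPhase :
    Impl (symBits p a ^ 2 * 11) (fun ψ : QState (QFTWire p a) => ψ) (diag (qftPhase β)) := by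
  classical
  refine Impl.diag ?_
  have key : ∀ S : Finset (Sym p a × Sym p a), Impl (S.card * 11)
      (ket : (QFTWire p a → Bool) → QState (QFTWire p a))
      (fun u => (∏ r ∈ S, if u (Sum.inl r.1) && u (Sum.inr (Sum.inl r.2)) then
        chi p (-(symVal β r.1 * symVal β r.2)) else 1) • ket u) := by
    intro S
    induction S using Finset.induction_on with
    | empty => exact Impl.refl.congr (fun _ => rfl) fun u => by simp
    | insert r S hr ih =>
      have h := impl_phase (u := fun u : QFTWire p a → Bool => u) (n := 1)
        (fun u => u (Sum.inl r.1) && u (Sum.inr (Sum.inl r.2)))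
        (BComp.op (n := 0) (m := 0) (fun a b => a && b) (Comp.of_mem ⟨_, trivial, rfl⟩)
          (Comp.of_mem ⟨_, trivial, rfl⟩)) (chi p (-(symVal β r.1 * symVal β r.2))) (norm_chi _)
      obtain ⟨c, hc, h1⟩ := h
      obtain ⟨d, hd, h2⟩ := ih
      refine ⟨c ++ d, ?_, fun u => ?_⟩
      · rw [List.length_append, Finset.card_insert_of_notMem hr]
        omega
      · beta_reduce
        rw [Circuit.run_append, h1, ext_smul, Circuit.run_smul, h2, ← ext_smul, smul_smul,
          Finset.prod_insert hr]
  refine (key Finset.univ).mono ?_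
  rw [Finset.card_univ, Fintype.card_prod, card_sym, sq]

/-- The amplitude `√q / 2 ^ b`, with `b` the number of bits of a symbol, is at least `1 / q`,
because `(2 ^ clog p) ^ 2 ≤ p ^ 3`. The angle belonging to `q` rounds of amplification is at most `1
/ q`, so the amplitude can be lowered to its sine by a factor `r ≤ 1`, the amplitude at `|0⟩` of an
extra qubit. -/
theorem qft_angle (ha : Fintype.card F = p ^ a) :
    ∃ r α : ℝ, r ^ 2 + ‖(α : ℂ)‖ ^ 2 = 1 ∧
      r * (Real.sqrt (Fintype.card F) / 2 ^ symBits p a) =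
        Real.sin (Real.pi / (2 * (2 * (Fintype.card F : ℝ) + 1))) := by
  set q := Fintype.card F with hq
  have hk : ∀ p : ℕ, p.Prime → (2 ^ Nat.clog 2 p) ^ 2 ≤ p ^ 3 := by
    intro p hp
    have h1 : 1 ≤ Nat.clog 2 p := Nat.clog_pos one_lt_two hp.two_le
    have h2 : 2 ^ (Nat.clog 2 p - 1) < p := Nat.pow_pred_clog_lt_self one_lt_two hp.one_lt
    obtain ⟨k, hk⟩ := Nat.exists_eq_add_of_le h1
    rw [hk, Nat.add_sub_cancel_left] at h2
    rw [hk, pow_add]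
    obtain ⟨c, rfl⟩ : ∃ c, p = c + 1 := ⟨p - 1, by have := hp.one_lt; omega⟩
    have h3 : 2 ^ k ≤ c := by omega
    have h4 : (2 ^ k) ^ 2 ≤ c ^ 2 := Nat.pow_le_pow_left h3 2
    have h5 : 1 ≤ c := by have := hp.one_lt; omega
    nlinarith [sq_nonneg ((c : ℤ) - 1), Nat.zero_le (c ^ 3), Nat.pow_le_pow_left h5 2]
  have hN : ((2 : ℝ) ^ symBits p a) ^ 2 ≤ (q : ℝ) ^ 3 := by
    have : (2 ^ symBits p a) ^ 2 ≤ q ^ 3 := by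
      have h := Nat.pow_le_pow_left (hk p hp.out) a
      rw [← pow_mul, ← pow_mul, ← pow_mul] at h
      rw [ha, symBits, ← pow_mul, ← pow_mul]
      convert h using 2 <;> ring
    exact_mod_cast this
  have hq1 : (1 : ℝ) ≤ q := by exact_mod_cast Fintype.card_pos
  have hsq : 0 < Real.sqrt q := Real.sqrt_pos.2 (by linarith)
  have hNpos : (0 : ℝ) < 2 ^ symBits p a := by positivity
  have hNle : (2 : ℝ) ^ symBits p a ≤ q * Real.sqrt q := by
    refine abs_le_of_sq_le_sq' (le_of_le_of_eq hN ?_) (by positivity) |>.2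
    rw [mul_pow, Real.sq_sqrt (by linarith)]
    ring
  set lam := Real.sqrt q / 2 ^ symBits p a with hlam
  have hlam0 : 0 < lam := by positivity
  set θ := Real.pi / (2 * (2 * (q : ℝ) + 1)) with hθ
  have hθ0 : 0 < θ := by positivity
  have hθ1 : θ ≤ 1 / q := by
    rw [hθ, div_le_div_iff₀ (by positivity) (by linarith)]
    nlinarith [Real.pi_le_four]
  have hlamle : 1 / q ≤ lam := by
    rw [hlam, div_le_div_iff₀ (by linarith) hNpos]
    linarith
  have hsin : Real.sin θ ≤ lam := (Real.sin_le hθ0.le).trans (hθ1.trans hlamle)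
  have hsin0 : 0 ≤ Real.sin θ := by
    refine Real.sin_nonneg_of_nonneg_of_le_pi hθ0.le (hθ1.trans ?_)
    have : 1 / (q : ℝ) ≤ 1 := by rw [div_le_one (by linarith)]; exact hq1
    linarith [Real.pi_gt_three]
  have hr : (Real.sin θ / lam) ^ 2 ≤ 1 := by
    rw [sq_le_one_iff₀ (by positivity)]
    exact (div_le_one hlam0).2 hsin
  refine ⟨Real.sin θ / lam, Real.sqrt (1 - (Real.sin θ / lam) ^ 2), ?_, ?_⟩
  · rw [Complex.norm_real, Real.norm_of_nonneg (Real.sqrt_nonneg _), Real.sq_sqrt (by linarith)]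
    ring
  · field_simp

theorem braket_eq {W : Type*} [Fintype W] [DecidableEq W] (ψ φ : QState W) :
    braket ψ φ = ∑ s, star (ψ s) * φ s := by
  unfold braket
  congr!

theorem braket_ket {W : Type*} [Fintype W] (s : W → Bool) (ψ : QState W) : braket (ket s) ψ = ψ s := by
  classical
  simp [braket, ket_apply, apply_ite (starRingEnd ℂ), ite_mul]

theorem braket_diag {W : Type*} [Fintype W] (ω : (W → Bool) → ℂ) (h : ∀ u, ‖ω u‖ = 1)
    (ψ φ : QState W) : braket (diag ω ψ) (diag ω φ) = braket ψ φ := by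
  classical
  unfold braket
  refine Finset.sum_congr rfl fun s _ => ?_
  have : star (ω s) * ω s = 1 := by
    rw [Complex.star_def, mul_comm, Complex.mul_conj, Complex.normSq_eq_norm_sq, h]; simp
  simp only [diag, star_mul']
  linear_combination (star (ψ s) * φ s) * this

/-- The inverse Fourier transform of one symbol, into a second register. -/
theorem impl_symbol_qft_move (ha : Fintype.card F = p ^ a) :
    Impl ((11 * symBits p a ^ 2 + 2 * symBits p a + 1) * (2 * Fintype.card F + 1) +
        Fintype.card F * (2 * (8 * (12 * symBits p a + 3) + 3) + 8))
      (fun s : F => ket (qftBits (enc β s) (fun _ => false) false))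
      (fun s => ∑ x : F, (chi p (-(s * x)) / (Real.sqrt (Fintype.card F) : ℂ)) •
        ket (qftBits (fun _ => false) (enc β x) false)) := by
  classical
  set q := Fintype.card F with hq
  set b := symBits p a with hb
  obtain ⟨r, α, hrα, hangle⟩ := qft_angle (F := F) ha
  obtain ⟨U, hU⟩ := exists_reflection r α hrα
  set U' := U * pauliX * U⁻¹
  -- Starting from `|s⟩|0⟩|0⟩`, the circuit `c₁` spreads the second register over all strings and
  -- rotates the extra qubit to `r|0⟩ + α|1⟩`; phases and Hadamard gates on the first register
  -- follow. The amplitude at `|0⟩|x⟩|0⟩` is then `r χ(-sx) / 2 ^ b`, a fixed multiple of the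
  -- desired one.
  let rot : Gate (QFTWire p a) := .one U' (Sum.inr (Sum.inr ()))
  let c₁ : Circuit (QFTWire p a) := rot :: hadamards fun r => Sum.inr (Sum.inl r)
  let c₂ : Circuit (QFTWire p a) := hadamards Sum.inl
  let V : QState (QFTWire p a) → QState (QFTWire p a) := fun ψ => c₂.run (diag (qftPhase β) (c₁.run ψ))
  let V' : QState (QFTWire p a) → QState (QFTWire p a) := fun ψ =>
    c₁.inv.run (diag (fun u => star (qftPhase β u)) (c₂.inv.run ψ))
  let G : F → QState (QFTWire p a) := fun s =>
    ∑ x : F, (chi p (-(s * x)) / (Real.sqrt (Fintype.card F) : ℂ)) •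
      ket (qftBits (fun _ => false) (enc β x) false)
  have hω : ∀ u, star (qftPhase β u) * qftPhase β u = 1 := fun u => by
    rw [Complex.star_def, mul_comm, Complex.mul_conj, Complex.normSq_eq_norm_sq, norm_qftPhase]; simp
  have hVV' : ∀ ψ, V (V' ψ) = ψ := fun ψ => by
    have : ∀ φ : QState (QFTWire p a), diag (qftPhase β) (diag (fun u => star (qftPhase β u)) φ) = φ :=
      fun φ => by
        funext u
        simp only [diag]
        linear_combination φ u * hω u
    simp only [V, V', Circuit.run_run_inv, this]
  have hV'V : ∀ ψ, V' (V ψ) = ψ := fun ψ => by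
    have : ∀ φ : QState (QFTWire p a), diag (fun u => star (qftPhase β u)) (diag (qftPhase β) φ) = φ :=
      fun φ => by
        funext u
        simp only [diag]
        linear_combination φ u * hω u
    simp only [V, V', Circuit.run_inv_run, this]
  have hadd : ∀ (c d : ℂ) ψ φ, V (c • ψ + d • φ) = c • V ψ + d • V φ := fun c d ψ φ => by
    have : ∀ ψ φ : QState (QFTWire p a), diag (qftPhase β) (c • ψ + d • φ) =
        c • diag (qftPhase β) ψ + d • diag (qftPhase β) φ := fun ψ φ => by
      funext u
      simp only [diag, Pi.add_apply, Pi.smul_apply, smul_eq_mul]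
      ring
    simp only [V, Circuit.run_add, Circuit.run_smul, this]
  have hbr : ∀ ψ φ, braket (V ψ) (V φ) = braket ψ φ := fun ψ φ => by
    simp only [V, Circuit.braket_run, braket_diag _ (norm_qftPhase β)]
  have hV : Impl (11 * b ^ 2 + 2 * b + 1) (fun ψ => ψ) V := by
    refine (((Impl.circuit c₁ _).comp ((impl_qftPhase β).reindex _)).comp
      (Impl.circuit c₂ _)).mono ?_
    simp only [c₁, c₂, List.length_cons, length_hadamards, card_sym]
    rw [hb]
    omega
  have hGval : ∀ s u, G s u = ∑ x : F, (chi p (-(s * x)) / (Real.sqrt q : ℂ)) *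
      if u = qftBits (fun _ => false) (enc β x) false then 1 else 0 := fun s u => by
    simp [G, Finset.sum_apply, ket_apply, hq]
  have hGenc : ∀ s x, G s (qftBits (fun _ => false) (enc β x) false) =
      chi p (-(s * x)) / (Real.sqrt q : ℂ) := fun s x => by
    rw [hGval]
    simp [qftBits_inj, (enc_injective β).eq_iff]
  let good : (QFTWire p a → Bool) → Bool := fun u =>
    decide (∃ x : F, u = qftBits (fun _ => false) (enc β x) false)
  let start : (QFTWire p a → Bool) → Bool := fun u =>
    decide (∃ x : F, u = qftBits (enc β x) (fun _ => false) false)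
  have h1 : ∀ s u, good u = true → V (ket (qftBits (enc β s) (fun _ => false) false)) u =
      Real.sin (Real.pi / (2 * (2 * (q : ℝ) + 1))) * G s u := by
    intro s u hu
    obtain ⟨x, rfl⟩ := of_decide_eq_true hu
    have e0 : rot.apply (ket (qftBits (enc β s) (fun _ => false) false)) =
        ∑ t : Bool, (if t then (α : ℂ) else r) • ket (qftBits (enc β s) (fun _ => false) t) := by
      rw [Gate.one_ket]
      refine Finset.sum_congr rfl fun t _ => ?_
      rw [setBit_qftBits_unit]
      congr 1
      exact hU t
    have e1 : ∀ t, (hadamards fun r => Sum.inr (Sum.inl r)).run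
        (ket (qftBits (enc β s) (fun _ => false) t)) =
        ∑ v, (1 / Real.sqrt 2 : ℂ) ^ b • ket (qftBits (enc β s) v t) := fun t => by
      rw [run_hadamards _ (fun v => qftBits (enc β s) v t) (fun _ _ => rfl)
        (fun v r b => setBit_qftBits_right _ _ _ _ _)]
      simp [hadamardEntry, Finset.prod_const, Finset.card_univ, hb]
    have e2 : ∀ v t, c₂.run (ket (qftBits (enc β s) v t)) (qftBits (fun _ => false) (enc β x) false) =
        if v = enc β x ∧ t = false then (1 / Real.sqrt 2 : ℂ) ^ b else 0 := fun v t => by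
      rw [run_hadamards _ (fun s => qftBits s v t) (fun _ _ => rfl)
        (fun v r b => setBit_qftBits_left _ _ _ _ _)]
      simp only [Finset.sum_apply, Pi.smul_apply, smul_eq_mul, ket_apply, qftBits_inj]
      rw [Finset.sum_eq_single (fun _ => false)]
      · simp [hadamardEntry, Finset.prod_const, Finset.card_univ, card_sym, hb, eq_comm]
      · intro v' _ hv'
        rw [if_neg fun h => hv' h.1.symm, mul_zero]
      · simp
    have e3 : V (ket (qftBits (enc β s) (fun _ => false) false)) =
        ∑ t : Bool, ∑ v, ((if t then (α : ℂ) else r) * ((1 / Real.sqrt 2 : ℂ) ^ b *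
          qftPhase β (qftBits (enc β s) v t))) • c₂.run (ket (qftBits (enc β s) v t)) := by
      simp only [V, c₁, Circuit.run_cons, e0, Circuit.run_sum, Circuit.run_smul, e1, diag_sum,
        diag_smul, diag_ket, Finset.smul_sum, smul_smul, mul_assoc]
    have e4 : (1 / Real.sqrt 2 : ℂ) ^ b * (1 / Real.sqrt 2 : ℂ) ^ b = 1 / 2 ^ b := by
      rw [← mul_pow, sqrt_two_inv_sq, div_pow, one_pow]
    have hsq : (Real.sqrt q : ℂ) * Real.sqrt q = q := by
      rw [← Complex.ofReal_mul, Real.mul_self_sqrt (Nat.cast_nonneg _)]; simp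
    have hq0 : (Real.sqrt q : ℂ) ≠ 0 := by
      intro h
      rw [h, mul_zero] at hsq
      exact Fintype.card_ne_zero (α := F) (by exact_mod_cast hsq.symm)
    rw [e3]
    simp only [Finset.sum_apply, Pi.smul_apply, smul_eq_mul, e2]
    rw [Finset.sum_eq_single false, Finset.sum_eq_single (enc β x)]
    · rw [hGenc, ← hangle, qftPhase_enc]
      simp only [and_self, if_true, Bool.false_eq_true, if_false]
      have e5 : (Real.sqrt q : ℂ) / Real.sqrt q = 1 := div_self hq0
      push_cast
      linear_combination (r * chi p (-(s * x)) : ℂ) * e4 -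
        (r * chi p (-(s * x)) / 2 ^ b : ℂ) * e5
    · intro v _ hv
      simp [hv]
    · simp
    · intro t _ ht
      exact Finset.sum_eq_zero fun v _ => by simp [ht]
    · simp
  have hGout : ∀ s u, good u = false → G s u = 0 := fun s u hu => by
    rw [hGval]
    refine Finset.sum_eq_zero fun x _ => ?_
    rw [if_neg fun h => of_decide_eq_false hu ⟨x, h⟩, mul_zero]
  -- The target states are orthonormal, by orthogonality of characters.
  have hGG : ∀ s s', braket (G s') (G s) = if s = s' then 1 else 0 := by
    intro s s'
    have e : braket (G s') (G s) = ∑ x : F, star (G s' (qftBits (fun _ => false) (enc β x) false)) *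
        G s (qftBits (fun _ => false) (enc β x) false) := by
      rw [braket_eq, ← Finset.sum_image (s := Finset.univ)
        (g := fun x : F => qftBits (fun _ => false) (enc β x) false) (f := fun u => star (G s' u) * G s u)]
      · refine (Finset.sum_subset (Finset.subset_univ _) fun u _ hu => ?_).symm
        rw [hGout s u, mul_zero]
        refine decide_eq_false fun ⟨x, hx⟩ => hu ?_
        exact Finset.mem_image.2 ⟨x, Finset.mem_univ _, hx.symm⟩
      · intro x _ y _ h
        exact enc_injective β (qftBits_inj.1 h).2.1
    rw [e]
    have hsq : (Real.sqrt q : ℂ) * Real.sqrt q = q := by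
      rw [← Complex.ofReal_mul, Real.mul_self_sqrt (Nat.cast_nonneg _)]; simp
    have e' : ∀ x : F, star (chi p (-(s' * x)) / (Real.sqrt q : ℂ)) *
        (chi p (-(s * x)) / (Real.sqrt q : ℂ)) = chi p (x * (s' - s)) / q := fun x => by
      rw [star_div₀, star_chi, Complex.star_def, Complex.conj_ofReal, div_mul_div_comm, hsq, ← chi_add]
      congr 2
      ring
    simp only [hGenc, e']
    rw [← Finset.sum_div, sum_chi_mul]
    have hq0 : (q : ℂ) ≠ 0 := by exact_mod_cast Fintype.card_ne_zero
    by_cases h : s = s'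
    · simp [h, hq]
    · rw [if_neg h, if_neg (sub_ne_zero.2 (Ne.symm h)), zero_div]
  have h2 : ∀ s u, start u = true → V' (G s) u =
      Real.sin (Real.pi / (2 * (2 * (q : ℝ) + 1))) *
        ket (qftBits (enc β s) (fun _ => false) false) u := by
    intro s u hu
    obtain ⟨s', rfl⟩ := of_decide_eq_true hu
    -- By unitarity the amplitude is the inner product of `V` of a start state with `G s`. The
    -- latter lives on good strings, where `V` of the start state is a multiple of `G s'`; so
    -- orthonormality gives the value.
    rw [← braket_ket _ (V' (G s)), ← hbr, hVV']
    have e : braket (V (ket (qftBits (enc β s') (fun _ => false) false))) (G s) =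
        Real.sin (Real.pi / (2 * (2 * (q : ℝ) + 1))) * braket (G s') (G s) := by
      unfold braket
      rw [Finset.mul_sum]
      refine Finset.sum_congr rfl fun u _ => ?_
      rcases Bool.eq_false_or_eq_true (good u) with hu | hu
      · rw [h1 s' u hu, star_mul', Complex.star_def, Complex.conj_ofReal, mul_assoc]
      · rw [hGout s u hu, mul_zero, mul_zero, mul_zero]
    rw [e, hGG, ket_apply]
    simp only [qftBits_inj, (enc_injective β).eq_iff, and_true, eq_comm]
  have hzero : ∀ f : Sym p a → QFTWire p a, BComp (wireFuns (fun u : QFTWire p a → Bool => u) Set.univ)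
      (b * 2) {fun u => decide (∀ r, u (f r) = false)} := fun f => by
    have := BComp.all (B := wireFuns (fun u : QFTWire p a → Bool => u) Set.univ) (n := 1)
      (Finset.univ : Finset (Sym p a)) (fun r u => !(u (f r)))
      fun r _ => BComp.not (n := 0) (Comp.of_mem ⟨f r, trivial, rfl⟩)
    rw [Finset.card_univ, card_sym] at this
    simpa using this
  have hvalid : ∀ f : Sym p a → QFTWire p a, BComp (wireFuns (fun u : QFTWire p a → Bool => u) Set.univ)
      (10 * b) {fun u => decide (∃ y, enc β y = fun r => u (f r))} := fun f => by
    convert bcomp_valid (B := wireFuns (fun u : QFTWire p a → Bool => u) Set.univ) β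
      (fun u r => u (f r)) fun r => ⟨f r, trivial, rfl⟩
  have hbit : BComp (wireFuns (fun u : QFTWire p a → Bool => u) Set.univ) 1
      {fun u => !(u (Sum.inr (Sum.inr ())))} := BComp.not (n := 0) (Comp.of_mem ⟨_, trivial, rfl⟩)
  have hgood : Impl (8 * (12 * b + 3) + 3) (fun ψ => ψ) (reflect good) := by
    refine Impl.diag ((impl_phase (u := fun u : QFTWire p a → Bool => u) good ?_ (-1) (by simp)))
    refine (BComp.op (fun a b => a && b) (BComp.op (fun a b => a && b) (hzero Sum.inl)
      (hvalid fun r => Sum.inr (Sum.inl r))) hbit).mono subset_rfl (by omega)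
      (Set.singleton_subset_iff.2 ?_)
    rw [Set.mem_singleton_iff]
    funext u
    obtain ⟨s, x, t, rfl⟩ := exists_qftBits u
    rw [Bool.eq_iff_iff]
    simp only [good, decide_eq_true_eq, qftBits_inj, Bool.and_eq_true, Bool.not_eq_true']
    simp only [qftBits, Sum.elim_inl, Sum.elim_inr, funext_iff]
    constructor
    · rintro ⟨y, h, h', h''⟩
      exact ⟨⟨h, y, fun r => (h' r).symm⟩, h''⟩
    · rintro ⟨⟨h, y, h'⟩, h''⟩
      exact ⟨y, h, fun r => (h' r).symm, h''⟩
  have hstart : Impl (8 * (12 * b + 3) + 3 + 8) (fun ψ => ψ) (reflect fun u => !start u) := by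
    refine Impl.diag (((impl_phase (u := fun u : QFTWire p a → Bool => u) (n := 12 * b + 4)
      (fun u => !start u) ?_ (-1) (by simp))).mono (by omega))
    refine BComp.not ?_
    refine (BComp.op (fun a b => a && b) (BComp.op (fun a b => a && b)
      (hzero fun r => Sum.inr (Sum.inl r)) (hvalid Sum.inl)) hbit).mono subset_rfl (by omega)
      (Set.singleton_subset_iff.2 ?_)
    rw [Set.mem_singleton_iff]
    funext u
    obtain ⟨s, x, t, rfl⟩ := exists_qftBits u
    rw [Bool.eq_iff_iff]
    simp only [start, decide_eq_true_eq, qftBits_inj, Bool.and_eq_true, Bool.not_eq_true']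
    simp only [qftBits, Sum.elim_inl, Sum.elim_inr, funext_iff]
    constructor
    · rintro ⟨y, h, h', h''⟩
      exact ⟨⟨h', y, fun r => (h r).symm⟩, h''⟩
    · rintro ⟨⟨h, y, h'⟩, h''⟩
      exact ⟨y, fun r => (h' r).symm, h, h''⟩
  refine (impl_amplify hV hVV' hV'V hadd hgood hstart q Fintype.card_pos
    (fun s : F => ket (qftBits (enc β s) (fun _ => false) false)) G ?_ hGout h1 h2).mono ?_
  · intro s u hu
    rw [ket_apply, if_neg]
    exact fun h => of_decide_eq_false hu ⟨s, h⟩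
  · exact le_of_eq (by ring)

/-- The number of gates of the Fourier transform of one symbol, `q` the number of field elements and
`b` the number of bits of a symbol. -/
def qftCost (q b : ℕ) : ℕ :=
  (11 * b ^ 2 + 2 * b + 1) * (2 * q + 1) + q * (2 * (8 * (12 * b + 3) + 3) + 8) + (2 * b + 4)

/-- The inverse Fourier transform of one symbol. -/
theorem impl_symbol_qft (ha : Fintype.card F = p ^ a) :
    Impl (qftCost (Fintype.card F) (symBits p a))
      (fun s : F => ket (enc β s))
      (fun s => ∑ x : F, (chi p (-(s * x)) / (Real.sqrt (Fintype.card F) : ℂ)) • ket (enc β x)) := by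
  classical
  have hcopy : Impl (2 + symBits p a) (fun x : F => ket (qftBits (fun _ => false) (enc β x) false))
      (fun x => ket (qftBits (enc β x) (enc β x) false)) := by
    have h := impl_xor (u := fun x : F => qftBits (fun _ => false) (enc β x) false)
      (R := Set.range fun r => Sum.inr (Sum.inl r)) (n := 0)
      (Finset.univ.image Sum.inl) (by simp)
      (fun w x => w.elim (enc β x) fun _ => false) (.of_subset ?_)
    · refine (h.mono ?_).congr (fun _ => rfl) fun x => congrArg ket (funext ?_)
      · have := (Finset.card_image_le (s := Finset.univ) (f := (Sum.inl : Sym p a → QFTWire p a)))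
        rw [Finset.card_univ, card_sym] at this
        omega
      · rintro (r | r | ⟨⟩) <;> simp [qftBits]
    · rintro _ ⟨w, hw, rfl⟩
      simp only [Finset.coe_image, Finset.coe_univ, Set.image_univ, Set.mem_range] at hw
      obtain ⟨r, rfl⟩ := hw
      exact Or.inl ⟨_, ⟨r, rfl⟩, rfl⟩
  have hclear : Impl (2 + symBits p a) (fun x : F => ket (qftBits (enc β x) (fun _ => false) false))
      (fun x => ket (qftBits (enc β x) (enc β x) false)) := by
    have h := impl_xor (u := fun x : F => qftBits (enc β x) (fun _ => false) false)
      (R := Set.range Sum.inl) (n := 0)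
      (Finset.univ.image fun r => Sum.inr (Sum.inl r)) (by simp)
      (fun w x => w.elim (fun _ => false) fun w' => w'.elim (enc β x) fun _ => false) (.of_subset ?_)
    · refine (h.mono ?_).congr (fun _ => rfl) fun x => congrArg ket (funext ?_)
      · have := (Finset.card_image_le (s := Finset.univ)
          (f := fun r : Sym p a => (Sum.inr (Sum.inl r) : QFTWire p a)))
        rw [Finset.card_univ, card_sym] at this
        omega
      · rintro (r | r | ⟨⟩) <;> simp [qftBits]
    · rintro _ ⟨w, hw, rfl⟩
      simp only [Finset.coe_image, Finset.coe_univ, Set.image_univ, Set.mem_range] at hw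
      obtain ⟨r, rfl⟩ := hw
      exact Or.inl ⟨_, ⟨r, rfl⟩, rfl⟩
  -- The result is moved back to the first register: copied bit by bit, after which the original is
  -- erased against the copy.
  have hswap := (hcopy.comp hclear.symm).sum (fun _ : F => (Finset.univ : Finset F)) fun s x =>
    chi p (-(s * x)) / (Real.sqrt (Fintype.card F) : ℂ)
  have hemb : ∀ x, emb (Function.Embedding.inl : Sym p a ↪ QFTWire p a) (fun _ => false)
      (ket (enc β x)) = ket (qftBits (enc β x) (fun _ => false) false) := fun x => by
    refine emb_ket _ (fun _ => rfl) ?_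
    rintro (r | r | ⟨⟩) hr
    · exact absurd ⟨r, rfl⟩ hr
    · rfl
    · rfl
  refine Impl.hide (Z := Sym p a ⊕ Unit) ((((impl_symbol_qft_move β ha).comp hswap).mono ?_).congr
    hemb fun s => ?_)
  · unfold qftCost
    omega
  · simp only [emb_sum, emb_smul, hemb]

end SymbolQFT

/-! ### Circuits with finitely many ancillas -/

section Restrict

universe v

variable {W ι : Type*}

/-- A list of gates mentions only finitely many ancillas. The bound works for every larger supply as
well, so that several circuits can share one number of ancillas. -/
theorem Circuit.exists_relabel (c : Circuit (W ⊕ ℕ)) : ∃ A₀ : ℕ, ∀ {W' : Type v} (f : W' ↪ W ⊕ ℕ),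
    (∀ w, Sum.inl w ∈ Set.range f) → (∀ i < A₀, Sum.inr i ∈ Set.range f) →
      ∃ c' : Circuit W', c'.relabel f = c := by
  have hwire : ∀ w : W ⊕ ℕ, ∃ A₀ : ℕ, ∀ {W' : Type v} (f : W' ↪ W ⊕ ℕ),
      (∀ w, Sum.inl w ∈ Set.range f) → (∀ i < A₀, Sum.inr i ∈ Set.range f) → ∃ v, f v = w := by
    rintro (w | i)
    · exact ⟨0, fun f h _ => h w⟩
    · exact ⟨i + 1, fun f _ h => h i (Nat.lt_succ_self i)⟩
  induction c with
  | nil => exact ⟨0, fun f _ _ => ⟨[], rfl⟩⟩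
  | cons g c ih =>
    obtain ⟨A, hA⟩ := ih
    have hg : ∃ A₀ : ℕ, ∀ {W' : Type v} (f : W' ↪ W ⊕ ℕ), (∀ w, Sum.inl w ∈ Set.range f) →
        (∀ i < A₀, Sum.inr i ∈ Set.range f) → ∃ g' : Gate W', g'.relabel f = g := by
      cases g with
      | one U i =>
        obtain ⟨A₁, h₁⟩ := hwire i
        refine ⟨A₁, fun f h h' => ?_⟩
        obtain ⟨v, rfl⟩ := h₁ f h h'
        exact ⟨.one U v, rfl⟩
      | cnot i j hij =>
        obtain ⟨A₁, h₁⟩ := hwire i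
        obtain ⟨A₂, h₂⟩ := hwire j
        refine ⟨max A₁ A₂, fun f h h' => ?_⟩
        obtain ⟨v, rfl⟩ := h₁ f h fun k hk => h' k (hk.trans_le (le_max_left _ _))
        obtain ⟨w, rfl⟩ := h₂ f h fun k hk => h' k (hk.trans_le (le_max_right _ _))
        exact ⟨.cnot v w fun h => hij (h ▸ rfl), rfl⟩
      | toffoli i j k hij hik hjk =>
        obtain ⟨A₁, h₁⟩ := hwire i
        obtain ⟨A₂, h₂⟩ := hwire j
        obtain ⟨A₃, h₃⟩ := hwire k
        refine ⟨max A₁ (max A₂ A₃), fun f h h' => ?_⟩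
        obtain ⟨u, rfl⟩ := h₁ f h fun k hk => h' k (hk.trans_le (le_max_left _ _))
        obtain ⟨v, rfl⟩ := h₂ f h fun k hk =>
          h' k (hk.trans_le ((le_max_left _ _).trans (le_max_right _ _)))
        obtain ⟨w, rfl⟩ := h₃ f h fun k hk =>
          h' k (hk.trans_le ((le_max_right _ _).trans (le_max_right _ _)))
        exact ⟨.toffoli u v w (fun h => hij (h ▸ rfl)) (fun h => hik (h ▸ rfl))
          fun h => hjk (h ▸ rfl), rfl⟩
    obtain ⟨A', hA'⟩ := hg
    refine ⟨max A A', fun f h h' => ?_⟩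
    obtain ⟨c', rfl⟩ := hA f h fun k hk => h' k (hk.trans_le (le_max_left _ _))
    obtain ⟨g', rfl⟩ := hA' f h fun k hk => h' k (hk.trans_le (le_max_right _ _))
    exact ⟨g' :: c', rfl⟩

/-- Finitely many ancillas are enough. -/
theorem Impl.exists_circuit {N : ℕ} {ψ φ : ι → QState W} (h : Impl N ψ φ) :
    ∃ A₀ : ℕ, ∀ {W' : Type v} (f : W' ↪ W ⊕ ℕ), (∀ w, Sum.inl w ∈ Set.range f) →
      (∀ i < A₀, Sum.inr i ∈ Set.range f) → ∃ c : Circuit W', c.length ≤ N ∧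
        ∀ i ψ' φ', DQI.emb f (fun _ => false) ψ' = ext (ψ i) →
          DQI.emb f (fun _ => false) φ' = ext (φ i) → c.run ψ' = φ' := by
  obtain ⟨c, hc, h⟩ := h
  obtain ⟨A₀, hA⟩ := c.exists_relabel
  refine ⟨A₀, fun f h1 h2 => ?_⟩
  obtain ⟨c', rfl⟩ := hA f h1 h2
  refine ⟨c', by simpa using hc, fun i ψ' φ' hψ hφ => ?_⟩
  refine emb_injective f (fun _ => false) ?_
  rw [← Circuit.run_relabel, hψ, h, hφ]

end Restrict

/-! ### The Fourier coefficients of the constraints -/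

section Fourier

variable {p : ℕ} [hp : Fact p.Prime] {F : Type*} [Field F] [Fintype F] [DecidableEq F]
  [Algebra (ZMod p) F] {T : Finset F}

theorem card_mul_sgnMean : (Fintype.card F : ℝ) * sgnMean T = ∑ z, sgn T z := by
  have : (Fintype.card F : ℝ) ≠ 0 := by exact_mod_cast Fintype.card_ne_zero
  rw [sgnMean, mul_div_cancel₀ _ this]

theorem sum_sgn_sub_sgnMean : ∑ z, (sgn T z - sgnMean T) = 0 := by
  rw [Finset.sum_sub_distrib, ← card_mul_sgnMean]
  simp

theorem sum_gFun : ∑ z, gFun T z = 0 := by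
  simp only [gFun]
  rw [← Finset.sum_div, sum_sgn_sub_sgnMean, zero_div]

theorem sgnScale_pos (h₀ : T ≠ ∅) (h₁ : T ≠ Finset.univ) : 0 < sgnScale T := by
  refine Real.sqrt_pos.2 (lt_of_le_of_ne (Finset.sum_nonneg fun _ _ => sq_nonneg _) fun h => ?_)
  have h2 := (Finset.sum_eq_zero_iff_of_nonneg fun z _ => sq_nonneg (sgn T z - sgnMean T)).1 h.symm
  obtain ⟨z, hz⟩ := Finset.nonempty_iff_ne_empty.2 h₀
  obtain ⟨z', hz'⟩ : ∃ z', z' ∉ T := by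
    by_contra! h
    exact h₁ (Finset.eq_univ_iff_forall.2 h)
  have e1 := pow_eq_zero_iff two_ne_zero |>.1 (h2 z (Finset.mem_univ _))
  have e2 := pow_eq_zero_iff two_ne_zero |>.1 (h2 z' (Finset.mem_univ _))
  rw [sgn, if_pos hz] at e1
  rw [sgn, if_neg hz'] at e2
  linarith

theorem sum_gFun_sq (h₀ : T ≠ ∅) (h₁ : T ≠ Finset.univ) : ∑ z, gFun T z ^ 2 = 1 := by
  have h := sgnScale_pos h₀ h₁
  simp only [gFun, div_pow]
  rw [← Finset.sum_div, sgnScale, Real.sq_sqrt (Finset.sum_nonneg fun _ _ => sq_nonneg _), div_self]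
  exact (Real.sqrt_pos.1 h).ne'

/-- The mean of `g` is zero. Hence the sum over `e ≠ 0` in the encoding gate loses nothing, and it
is normalized. -/
theorem gHat_zero : gHat p T 0 = 0 := by
  have := sum_gFun (T := T)
  simp only [gHat, zero_mul, chi_zero, one_mul]
  rw [← Complex.ofReal_sum, this]
  simp

theorem sqrt_card_mul_self : (Real.sqrt (Fintype.card F) : ℂ) * Real.sqrt (Fintype.card F) =
    Fintype.card F := by
  rw [← Complex.ofReal_mul, Real.mul_self_sqrt (Nat.cast_nonneg _)]; simp

theorem sqrt_card_ne_zero : (Real.sqrt (Fintype.card F) : ℂ) ≠ 0 := by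
  intro h
  have := sqrt_card_mul_self (F := F)
  rw [h, mul_zero] at this
  exact Fintype.card_ne_zero (α := F) (by exact_mod_cast this.symm)

/-- Fourier inversion. -/
theorem sum_gHat_mul_chi (z : F) :
    ∑ e, gHat p T e * chi p (-(e * z)) =
      (Real.sqrt (Fintype.card F) : ℂ) * (gFun T z : ℂ) := by
  have h : ∀ e, gHat p T e * chi p (-(e * z)) =
      ∑ z', chi p (e * (z' - z)) * (gFun T z' : ℂ) / (Real.sqrt (Fintype.card F) : ℂ) := fun e => by
    rw [gHat, div_mul_eq_mul_div, Finset.sum_mul, Finset.sum_div]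
    refine Finset.sum_congr rfl fun z' _ => ?_
    rw [mul_sub, sub_eq_add_neg, chi_add]
    ring
  rw [Finset.sum_congr rfl fun e _ => h e, Finset.sum_comm]
  have h2 : ∀ z', ∑ e, chi p (e * (z' - z)) * (gFun T z' : ℂ) / (Real.sqrt (Fintype.card F) : ℂ) =
      if z' = z then (Real.sqrt (Fintype.card F) : ℂ) * (gFun T z' : ℂ) else 0 := fun z' => by
    rw [← Finset.sum_div, ← Finset.sum_mul, sum_chi_mul]
    simp only [sub_eq_zero]
    split_ifs
    · rw [← sqrt_card_mul_self]
      field_simp [sqrt_card_ne_zero (F := F)]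
    · simp
  rw [Finset.sum_congr rfl fun z' _ => h2 z']
  simp

theorem star_gHat (e : F) : star (gHat p T e) =
    (∑ z, chi p (-(e * z)) * (gFun T z : ℂ)) / (Real.sqrt (Fintype.card F) : ℂ) := by
  rw [gHat, star_div₀, star_sum]
  congr 1
  · refine Finset.sum_congr rfl fun z _ => ?_
    rw [star_mul', star_chi, Complex.star_def, Complex.conj_ofReal]
  · exact Complex.conj_ofReal _

/-- Parseval's identity, from Fourier inversion. The conditions on `T` make the scale of `g`
nonzero. -/
theorem sum_norm_gHat_sq (h₀ : T ≠ ∅) (h₁ : T ≠ Finset.univ) : ∑ e : F, ‖gHat p T e‖ ^ 2 = 1 := by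
  have h : ∑ e : F, gHat p T e * star (gHat p T e) = 1 := by
    simp only [star_gHat, mul_div_assoc', Finset.mul_sum, ← Finset.sum_div]
    rw [Finset.sum_comm]
    have : ∀ z, ∑ e, gHat p T e * (chi p (-(e * z)) * (gFun T z : ℂ)) =
        (Real.sqrt (Fintype.card F) : ℂ) * ((gFun T z ^ 2 : ℝ) : ℂ) := fun z => by
      simp only [← mul_assoc]
      rw [← Finset.sum_mul, sum_gHat_mul_chi]
      push_cast
      ring
    rw [Finset.sum_congr rfl fun z _ => this z, ← Finset.mul_sum, ← Complex.ofReal_sum,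
      sum_gFun_sq h₀ h₁, Complex.ofReal_one, mul_one, div_self sqrt_card_ne_zero]
  have h' : ((∑ e : F, ‖gHat p T e‖ ^ 2 : ℝ) : ℂ) = 1 := by
    rw [← h, Complex.ofReal_sum]
    refine Finset.sum_congr rfl fun e _ => ?_
    rw [Complex.star_def, Complex.mul_conj, Complex.normSq_eq_norm_sq]
  exact_mod_cast h'

end Fourier

/-! ### The constraint-encoding gates -/

section Encode

variable {p : ℕ} [hp : Fact p.Prime] {F : Type*} [Field F] [Fintype F] [DecidableEq F]
  [Algebra (ZMod p) F] {a : ℕ} (β : Module.Basis (Fin a) (ZMod p) F)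

theorem enc_zero : enc β 0 = fun _ => false := by
  funext r
  simp [enc]

/-- The bits of a flag, a symbol and ancillas. -/
def gateBits (A : ℕ) (t : Bool) (e : F) : GateWire p a A → Bool
  | .flag => t
  | .sym r => enc β e r
  | .anc _ => false

theorem gateKet_eq (A : ℕ) (t : Bool) (e : F) : gateKet β A t e = ket (gateBits β A t e) := by
  unfold gateKet
  congr 1

/-- The wires of a constraint-encoding gate, ancillas apart. -/
def gateSplit (p a A : ℕ) : GateWire p a A ↪ GateWire p a 0 ⊕ ℕ where
  toFun
    | .flag => .inl .flag
    | .sym r => .inl (.sym r)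
    | .anc i => .inr i
  inj' := by
    rintro (_ | r | i) (_ | r' | i') h <;> simp_all [Fin.ext_iff]

theorem emb_gateSplit (A : ℕ) (t : Bool) (e : F) :
    emb (gateSplit p a A) (fun _ => false) (gateKet β A t e) = ext (gateKet β 0 t e) := by
  rw [gateKet_eq, gateKet_eq, ext_ket]
  refine emb_ket _ ?_ ?_
  · rintro (_ | r | i) <;> rfl
  · rintro ((_ | r | i) | i) hw
    · exact absurd ⟨.flag, rfl⟩ hw
    · exact absurd ⟨.sym r, rfl⟩ hw
    · exact i.elim0
    · rfl

/-- The encodings of the nonzero elements are distinct nonzero patterns, so `impl_prep` applies with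
one step for each of them. -/
theorem exists_encode (T : Finset F) (h₀ : T ≠ ∅) (h₁ : T ≠ Finset.univ) :
    ∃ A₀ : ℕ, ∀ A ≥ A₀, ∃ c : Circuit (GateWire p a A),
      c.length ≤ Fintype.card Fˣ * (30 * (symBits p a + 1)) ∧ ImplementsEncoding β T c := by
  have hα : ∑ e : {e : F // e ≠ 0}, ‖gHat p T (e : F)‖ ^ 2 = 1 := by
    rw [← sum_norm_gHat_sq (p := p) h₀ h₁, ← Finset.sum_subtype (Finset.univ.filter fun e : F => e ≠ 0)
      (by simp) fun e => ‖gHat p T e‖ ^ 2]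
    refine Finset.sum_subset (Finset.filter_subset _ _) fun e _ he => ?_
    obtain rfl : e = 0 := by simpa using he
    simp [gHat_zero]
  have h := impl_prep (R := Sym p a) (fun e : {e : F // e ≠ 0} => enc β (e : F))
    (fun e he => e.2 (enc_injective β (he.trans (enc_zero β).symm)))
    (fun e e' h => Subtype.ext (enc_injective β h)) (fun e => gHat p T (e : F)) hα
  let f : Option (Sym p a) ↪ GateWire p a 0 :=
    ⟨fun w => w.elim .flag .sym, by rintro (_ | r) (_ | r') h <;> simp_all⟩
  have hf : ∀ (t : Bool) (e : F), emb f (fun _ => false)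
      (ket fun w : Option (Sym p a) => w.elim t (enc β e)) = gateKet β 0 t e := fun t e => by
    rw [gateKet_eq]
    refine emb_ket _ ?_ ?_
    · rintro (_ | r) <;> rfl
    · rintro (_ | r | i) hw
      · exact absurd ⟨none, rfl⟩ hw
      · exact absurd ⟨some r, rfl⟩ hw
      · exact i.elim0
  obtain ⟨A₀, hA⟩ := ((h.emb f).reindex fun t : Bool => (t, fun _ => false)).exists_circuit
  refine ⟨A₀, fun A hAA => ?_⟩
  obtain ⟨c, hc, hrun⟩ := hA (gateSplit p a A) (by
      rintro (_ | r | i)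
      · exact ⟨.flag, rfl⟩
      · exact ⟨.sym r, rfl⟩
      · exact i.elim0) fun i hi => ⟨.anc ⟨i, by omega⟩, rfl⟩
  refine ⟨c, ?_, ?_, ?_⟩
  · rwa [Fintype.card_congr (unitsEquivNeZero (G₀ := F)), ← card_sym]
  · refine hrun false _ _ ?_ ?_
    · rw [emb_gateSplit, ← hf, enc_zero]
    · rw [emb_gateSplit, ← hf, enc_zero]
      simp
  · refine hrun true _ _ ?_ ?_
    · rw [emb_gateSplit, ← hf, enc_zero]
    · simp only [emb_sum, emb_smul, if_true, emb_gateSplit, hf, ext_sum, ext_smul]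
      exact Finset.sum_subtype (Finset.univ.filter fun e : F => e ≠ 0) (by simp)
        fun e => gHat p T e • ext (gateKet β 0 false e)

end Encode

/-! ### The stages of the algorithm -/

section Stages

variable {p : ℕ} [hp : Fact p.Prime] {F : Type*} [Field F] [Fintype F] [DecidableEq F]
  [Algebra (ZMod p) F] {a : ℕ} (β : Module.Basis (Fin a) (ZMod p) F) {n : ℕ}

/-- The bits of the registers of the algorithm. -/
def regBits (A : ℕ) (mask : Fˣ → Bool) (e : Fˣ → F) (s : Fin n → F) : Wire F p a n A → Bool
  | .mask y => mask y
  | .err y r => enc β (e y) r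
  | .syn j r => enc β (s j) r
  | .anc _ => false

theorem regKet_eq (A : ℕ) (mask : Fˣ → Bool) (e : Fˣ → F) (s : Fin n → F) :
    regKet β A mask e s = ket (regBits β A mask e s) := by
  unfold regKet
  congr 1

/-- The wires of the algorithm, ancillas apart. -/
def regSplit (F : Type*) [Field F] (p a n A : ℕ) : Wire F p a n A ↪ Wire F p a n 0 ⊕ ℕ where
  toFun
    | .mask y => .inl (.mask y)
    | .err y r => .inl (.err y r)
    | .syn j r => .inl (.syn j r)
    | .anc i => .inr i
  inj' := by
    rintro (y | ⟨y, r⟩ | ⟨j, r⟩ | i) (y' | ⟨y', r'⟩ | ⟨j', r'⟩ | i') h <;> simp_all [Fin.ext_iff]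

theorem emb_regSplit (A : ℕ) (mask : Fˣ → Bool) (e : Fˣ → F) (s : Fin n → F) :
    emb (regSplit F p a n A) (fun _ => false) (regKet β A mask e s) =
      ext (regKet β 0 mask e s) := by
  rw [regKet_eq, regKet_eq, ext_ket]
  refine emb_ket _ ?_ ?_
  · rintro (y | ⟨y, r⟩ | ⟨j, r⟩ | i) <;> rfl
  · rintro ((y | ⟨y, r⟩ | ⟨j, r⟩ | i) | i) hw
    · exact absurd ⟨.mask y, rfl⟩ hw
    · exact absurd ⟨.err y r, rfl⟩ hw
    · exact absurd ⟨.syn j r, rfl⟩ hw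
    · exact i.elim0
    · rfl

theorem exists_stage {ι : Type*} {N : ℕ} {ψ φ : ι → QState (Wire F p a n 0)} (h : Impl N ψ φ) :
    ∃ A₀ : ℕ, ∀ A ≥ A₀, ∃ c : Circuit (Wire F p a n A), c.length ≤ N ∧ ∀ i ψ' φ',
      emb (regSplit F p a n A) (fun _ => false) ψ' = ext (ψ i) →
        emb (regSplit F p a n A) (fun _ => false) φ' = ext (φ i) → c.run ψ' = φ' := by
  obtain ⟨A₀, hA⟩ := h.exists_circuit
  refine ⟨A₀, fun A hAA => hA _ ?_ fun i hi => ⟨.anc ⟨i, by omega⟩, rfl⟩⟩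
  rintro (y | ⟨y, r⟩ | ⟨j, r⟩ | i)
  · exact ⟨.mask y, rfl⟩
  · exact ⟨.err y r, rfl⟩
  · exact ⟨.syn j r, rfl⟩
  · exact i.elim0

theorem exists_dicke {ℓ : ℕ} (hℓ : ℓ ≤ Fintype.card Fˣ) (w : Fin (ℓ + 1) → ℂ)
    (hw : ∑ k, ‖w k‖ ^ 2 = 1) : ∃ A₀ : ℕ, ∀ A ≥ A₀, ∃ c : Circuit (Wire F p a n A),
      c.length ≤ (ℓ + 1) * (30 * (ℓ + 2)) + Fintype.card Fˣ * (ℓ * 7) + 2 ∧ IsDickePrep β w c := by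
  let f : Fˣ ↪ Wire F p a n 0 := ⟨.mask, fun y y' h => by simpa using h⟩
  have hf : ∀ u : Fˣ → Bool, emb f (fun _ => false) (ket u) = regKet β 0 u 0 0 := fun u => by
    rw [regKet_eq]
    refine emb_ket _ (fun y => rfl) ?_
    rintro (y | ⟨y, r⟩ | ⟨j, r⟩ | i) hw
    · exact absurd ⟨y, rfl⟩ hw
    · simp [regBits, enc_zero]
    · simp [regBits, enc_zero]
    · rfl
  obtain ⟨A₀, hA⟩ := exists_stage (((impl_dicke hℓ w hw).emb f).reindex fun u => (u, fun _ => false))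
  refine ⟨A₀, fun A hAA => ?_⟩
  obtain ⟨c, hc, hrun⟩ := hA A hAA
  refine ⟨c, hc, hrun () _ _ ?_ ?_⟩
  · rw [emb_regSplit, ← hf]
  · simp only [emb_sum, emb_smul, emb_regSplit, hf, ext_sum, ext_smul]

theorem sqrt_pow_eq {x : ℝ} (hx : 0 ≤ x) (n : ℕ) : Real.sqrt (x ^ n) = Real.sqrt x ^ n := by
  rw [Real.sqrt_eq_iff_eq_sq (by positivity) (by positivity), ← pow_mul, mul_comm, pow_mul,
    Real.sq_sqrt hx]

theorem exists_iqft (ha : Fintype.card F = p ^ a) :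
    ∃ A₀ : ℕ, ∀ A ≥ A₀, ∃ c : Circuit (Wire F p a n A), 
      c.length ≤ n * qftCost (Fintype.card F) (symBits p a) ∧ IsInverseQFT β c := by
  let f : Fin n → (Sym p a ↪ Wire F p a n 0) := fun j => ⟨.syn j, fun r r' h => by simpa using h⟩
  have hf : ∀ (s : Fin n → F) (j : Fin n) (x : F), emb (f j) (regBits β 0 (fun _ => false) 0 s)
      (ket (enc β x)) = regKet β 0 (fun _ => false) 0 (Function.update s j x) := fun s j x => by
    rw [regKet_eq]
    refine emb_ket _ (fun r => ?_) ?_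
    · show enc β (Function.update s j x j) r = enc β x r
      rw [Function.update_self]
    · rintro (y | ⟨y, r⟩ | ⟨j', r⟩ | i) hw
      · rfl
      · rfl
      · have : j' ≠ j := fun h => hw ⟨r, by rw [h]; rfl⟩
        simp [regBits, this]
      · rfl
  choose c hc hrun using fun j => (impl_symbol_qft β ha).emb (f j)
  have h : Impl (n * qftCost (Fintype.card F) (symBits p a))
      (fun s : Fin n → F => regKet β 0 (fun _ => false) 0 s)
      (fun s => ∑ x : Fin n → F,
        (chi p (-(∑ j, s j * x j)) / (Real.sqrt ((Fintype.card F : ℝ) ^ n) : ℂ)) •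
          regKet β 0 (fun _ => false) 0 x) := by
    refine ⟨(Finset.univ : Finset (Fin n)).toList.flatMap c, ?_, fun s => ?_⟩
    · simpa using length_flatMap_le c hc
    · have := run_flatMap_tensor
        (fun o : Fin n → Option F => ext (regKet β 0 (fun _ => false) 0 fun j => (o j).getD (s j)))
        c (fun j x => chi p (-(s j * x)) / (Real.sqrt (Fintype.card F) : ℂ)) fun j o ho => by
          have h1 := hrun j (s j, regBits β 0 (fun _ => false) 0 fun j => (o j).getD (s j))
          beta_reduce at h1
          rw [hf, Function.update_eq_self_iff.2 (by simp [ho])] at h1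
          simp only [emb_sum, emb_smul, hf, ext_sum, ext_smul] at h1
          rw [h1]
          refine Finset.sum_congr rfl fun x _ => ?_
          congr 3
          funext j'
          rcases eq_or_ne j' j with rfl | hj
          · simp
          · simp [hj]
      simp only [Option.getD_none, Option.getD_some] at this
      rw [this]
      simp only [ext_sum, ext_smul]
      refine Finset.sum_congr rfl fun x _ => ?_
      congr 1
      rw [Finset.prod_div_distrib, ← chi_sum, Finset.prod_const, Finset.card_univ, Fintype.card_fin,
        Finset.sum_neg_distrib]
      congr 1
      rw [← Complex.ofReal_pow, sqrt_pow_eq (Nat.cast_nonneg _)]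
  obtain ⟨A₀, hA⟩ := exists_stage h
  refine ⟨A₀, fun A hAA => ?_⟩
  obtain ⟨c, hc, hrun⟩ := hA A hAA
  refine ⟨c, hc, fun s => hrun s _ _ ?_ ?_⟩
  · rw [emb_regSplit]
  · simp only [emb_sum, emb_smul, emb_regSplit, ext_sum, ext_smul]

/-- The decoder is the inverse of the circuit that computes `e` from its syndrome and writes it to
an empty error register. -/
theorem exists_decode {ℓ : ℕ} (hq : 3 ≤ Fintype.card F) (hn : 1 ≤ n) (hℓ : 2 * ℓ ≤ n) :
    ∃ A₀ : ℕ, ∀ A ≥ A₀, ∃ c : Circuit (Wire F p a n A), c.length ≤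
      8 * (decodeCost (Fintype.card Fˣ) n (Fintype.card F) * opCost p a) + 2 +
        Fintype.card Fˣ * symBits p a ∧ IsDecoder β ℓ c := by
  classical
  let X := {e : Fˣ → F // weight e ≤ ℓ}
  let u : X → Wire F p a n 0 → Bool := fun x => regBits β 0 (fun _ => false) 0 (syndrome n x.1)
  let f : Wire F p a n 0 → X → Bool := fun w x => regBits β 0 (fun _ => false) x.1 0 w
  let v : Fˣ × Sym p a → Wire F p a n 0 := fun yr => .err yr.1 yr.2
  have hf : BComp (wireFuns u (Set.range fun jr : Fin n × Sym p a => .syn jr.1 jr.2))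
      (decodeCost (Fintype.card Fˣ) n (Fintype.card F) * opCost p a)
      (f '' (Finset.univ.image v : Finset (Wire F p a n 0))) := by
    have h1 := fcomp_decode (B := ⋃ j : Fin n, {fun x : X => syndrome n x.1 j}) hq hn
      (fun x : X => x.1) (fun x => (Nat.mul_le_mul_left 2 x.2).trans hℓ)
      fun j => Set.mem_iUnion.2 ⟨j, rfl⟩
    refine (h1.toBComp β).mono ?_ le_rfl ?_
    · refine Set.iUnion₂_subset fun φ hφ => ?_
      obtain ⟨j, rfl⟩ := Set.mem_iUnion.1 hφ
      rintro _ ⟨r, rfl⟩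
      exact ⟨_, ⟨(j, r), rfl⟩, rfl⟩
    · rintro _ ⟨w, hw, rfl⟩
      simp only [Finset.coe_image, Finset.coe_univ, Set.image_univ, Set.mem_range] at hw
      obtain ⟨⟨y, r⟩, rfl⟩ := hw
      exact Set.mem_iUnion₂.2 ⟨_, Set.mem_iUnion.2 ⟨y, rfl⟩, ⟨r, rfl⟩⟩
  have h := impl_xor (u := u) (Finset.univ.image v)
    (by rintro _ hw ⟨jr, rfl⟩; simp [v] at hw) f hf
  have h' : Impl (8 * (decodeCost (Fintype.card Fˣ) n (Fintype.card F) * opCost p a) + 2 +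
      Fintype.card Fˣ * symBits p a) (fun x : X => regKet β 0 (fun _ => false) 0 (syndrome n x.1))
      (fun x => regKet β 0 (fun _ => false) x.1 (syndrome n x.1)) := by
    refine (h.mono ?_).congr (fun x => regKet_eq _ _ _ _ _) fun x => ?_
    · refine Nat.add_le_add_left (Finset.card_image_le.trans_eq ?_) _
      rw [Finset.card_univ, Fintype.card_prod, card_sym]
    · rw [regKet_eq]
      refine congrArg ket (funext ?_)
      rintro (y | ⟨y, r⟩ | ⟨j, r⟩ | i) <;> simp [u, f, v, regBits, enc_zero]
  obtain ⟨A₀, hA⟩ := exists_stage h'.symm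
  refine ⟨A₀, fun A hAA => ?_⟩
  obtain ⟨c, hc, hrun⟩ := hA A hAA
  exact ⟨c, hc, fun e he => hrun ⟨e, he⟩ _ _ (emb_regSplit _ _ _ _ _) (emb_regSplit _ _ _ _ _)⟩

/-- The bits of the registers, and of a second syndrome register. -/
def bankBits (e : Fˣ → F) (s t : Fin n → F) : Wire F p a n 0 ⊕ Fin n × Sym p a → Bool :=
  Sum.elim (regBits β 0 (fun _ => false) e s) fun jr => enc β (t jr.1) jr.2

section Bank

variable {X : Type*} (e : X → Fˣ → F) (s t g : X → Fin n → F) {N : ℕ}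

theorem impl_bank (h : BComp ((⋃ y, fBits β fun x => e x y) ∪ ⋃ j, fBits β fun x => s x j) N
      (⋃ j, fBits β fun x => g x j)) :
    Impl (8 * N + 2 + n * symBits p a) (fun x => ket (bankBits β (e x) (s x) 0))
      (fun x => ket (bankBits β (e x) (s x) (g x))) := by
  classical
  have h := impl_xor (u := fun x => bankBits β (e x) (s x) 0) (R := Set.range Sum.inl) (n := N)
    (Finset.univ.image Sum.inr) (by simp)
    (fun w x => w.elim (fun _ => false) fun jr => enc β (g x jr.1) jr.2) (h.mono ?_ le_rfl ?_)
  · refine (h.mono ?_).congr (fun _ => rfl) fun x => congrArg ket (funext ?_)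
    · refine Nat.add_le_add_left (Finset.card_image_le.trans_eq ?_) _
      rw [Finset.card_univ, Fintype.card_prod, card_sym, Fintype.card_fin]
    · rintro (w | jr) <;> simp [bankBits, enc_zero]
  · refine Set.union_subset (Set.iUnion_subset fun y => ?_) (Set.iUnion_subset fun j => ?_)
    · rintro _ ⟨r, rfl⟩
      exact ⟨Sum.inl (.err y r), ⟨_, rfl⟩, rfl⟩
    · rintro _ ⟨r, rfl⟩
      exact ⟨Sum.inl (.syn j r), ⟨_, rfl⟩, rfl⟩
  · rintro _ ⟨w, hw, rfl⟩
    simp only [Finset.coe_image, Finset.coe_univ, Set.image_univ, Set.mem_range] at hw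
    obtain ⟨⟨j, r⟩, rfl⟩ := hw
    exact Set.mem_iUnion.2 ⟨j, r, rfl⟩

theorem impl_unbank (h : BComp ((⋃ y, fBits β fun x => e x y) ∪ ⋃ j, fBits β fun x => t x j) N
      (⋃ j, fBits β fun x => g x j)) :
    Impl (8 * N + 2 + n * symBits p a) (fun x => ket (bankBits β (e x) 0 (t x)))
      (fun x => ket (bankBits β (e x) (g x) (t x))) := by
  classical
  have h := impl_xor (u := fun x => bankBits β (e x) 0 (t x))
    (R := {w | ∀ j r, w ≠ Sum.inl (.syn j r)}) (n := N)
    (Finset.univ.image fun jr : Fin n × Sym p a => Sum.inl (.syn jr.1 jr.2))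
    (fun w hw hR => by obtain ⟨jr, -, rfl⟩ := Finset.mem_image.1 hw; exact hR _ _ rfl)
    (fun w x => bankBits β 0 (g x) 0 w) (h.mono ?_ le_rfl ?_)
  · refine (h.mono ?_).congr (fun _ => rfl) fun x => congrArg ket (funext ?_)
    · refine Nat.add_le_add_left (Finset.card_image_le.trans_eq ?_) _
      rw [Finset.card_univ, Fintype.card_prod, card_sym, Fintype.card_fin]
    · rintro ((y | ⟨y, r⟩ | ⟨j, r⟩ | i) | jr) <;> simp [bankBits, regBits, enc_zero]
  · refine Set.union_subset (Set.iUnion_subset fun y => ?_) (Set.iUnion_subset fun j => ?_)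
    · rintro _ ⟨r, rfl⟩
      exact ⟨Sum.inl (.err y r), by simp, rfl⟩
    · rintro _ ⟨r, rfl⟩
      exact ⟨Sum.inr (j, r), by simp, rfl⟩
  · rintro _ ⟨w, hw, rfl⟩
    simp only [Finset.coe_image, Finset.coe_univ, Set.image_univ, Set.mem_range] at hw
    obtain ⟨⟨j, r⟩, rfl⟩ := hw
    exact Set.mem_iUnion.2 ⟨j, r, rfl⟩

end Bank

/-- Adding in place is not an XOR, so a second register is used. The new syndrome is computed there,
and the old one is erased by recomputing it from the new one and `e`. Then the new one is copied
back and the second register is cleared. -/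
theorem exists_synd :
    ∃ A₀ : ℕ, ∀ A ≥ A₀, ∃ c : Circuit (Wire F p a n A), c.length ≤
      16 * (n * (3 * Fintype.card Fˣ + 2) * opCost p a) + 8 + 4 * (n * symBits p a) ∧
        IsSyndromeUpdate β c := by
  let X := (Fˣ → F) × (Fin n → F)
  have hcomp : ∀ (s : X → Fin n → F) (c : F),
      BComp ((⋃ y, fBits β fun x : X => x.1 y) ∪ ⋃ j, fBits β fun x => s x j)
        (n * (3 * Fintype.card Fˣ + 2) * opCost p a)
        (⋃ j, fBits β fun x => s x j + c * syndrome n x.1 j) := fun s c => by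
    have h := fcomp_syndrome (B := (⋃ y, {fun x : X => x.1 y}) ∪ ⋃ j, {fun x => s x j})
      (fun x : X => x.1) s (fun y => Or.inl (Set.mem_iUnion.2 ⟨y, rfl⟩))
      (fun j => Or.inr (Set.mem_iUnion.2 ⟨j, rfl⟩)) c
    refine (h.toBComp β).mono ?_ le_rfl ?_
    · refine Set.iUnion₂_subset fun φ hφ => ?_
      rcases hφ with hφ | hφ
      · obtain ⟨y, rfl⟩ := Set.mem_iUnion.1 hφ
        exact fun f hf => Or.inl (Set.mem_iUnion.2 ⟨y, hf⟩)
      · obtain ⟨j, rfl⟩ := Set.mem_iUnion.1 hφ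
        exact fun f hf => Or.inr (Set.mem_iUnion.2 ⟨j, hf⟩)
    · exact Set.iUnion_subset fun j f hf => Set.mem_iUnion₂.2 ⟨_, Set.mem_iUnion.2 ⟨j, rfl⟩, hf⟩
  have h1 := impl_bank β (fun x : X => x.1) (fun x => x.2) (fun x => x.2 + syndrome n x.1)
    (by simpa using hcomp (fun x => x.2) 1)
  have h2 := impl_unbank β (fun x : X => x.1) (fun x => x.2 + syndrome n x.1) (fun x => x.2)
    (by simpa using hcomp (fun x => x.2 + syndrome n x.1) (-1))
  have h3 := impl_unbank β (N := 0) (fun x : X => x.1) (fun x => x.2 + syndrome n x.1)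
    (fun x => x.2 + syndrome n x.1) (.of_subset (Set.subset_union_right.trans Set.subset_union_left))
  have h4 := impl_bank β (N := 0) (fun x : X => x.1) (fun x => x.2 + syndrome n x.1)
    (fun x => x.2 + syndrome n x.1) (.of_subset (Set.subset_union_right.trans Set.subset_union_left))
  have hemb : ∀ (e : Fˣ → F) (s : Fin n → F),
      emb (Function.Embedding.inl : Wire F p a n 0 ↪ Wire F p a n 0 ⊕ Fin n × Sym p a)
        (fun _ => false) (regKet β 0 (fun _ => false) e s) = ket (bankBits β e s 0) := fun e s => by
    rw [regKet_eq]
    refine emb_ket _ (fun _ => rfl) ?_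
    rintro (w | jr) hw
    · exact absurd ⟨w, rfl⟩ hw
    · simp [bankBits, enc_zero]
  have h := Impl.hide (Z := Fin n × Sym p a) (W := Wire F p a n 0)
    (ψ := fun x : X => regKet β 0 (fun _ => false) x.1 x.2)
    (φ := fun x : X => regKet β 0 (fun _ => false) x.1 (x.2 + syndrome n x.1))
    ((((h1.comp h2.symm).comp h3).comp h4.symm).congr (fun x => hemb _ _) fun x => hemb _ _)
  obtain ⟨A₀, hA⟩ := exists_stage h
  refine ⟨A₀, fun A hAA => ?_⟩
  obtain ⟨c, hc, hrun⟩ := hA A hAA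
  exact ⟨c, hc.trans (by omega), fun e s => hrun (e, s) _ _ (emb_regSplit _ _ _ _ _) (emb_regSplit _ _ _ _ _)⟩

end Stages

/-! ### The whole algorithm -/

section Full

variable {p : ℕ} [hp : Fact p.Prime] {F : Type*} [Field F] [Fintype F] [DecidableEq F]
  [Algebra (ZMod p) F] {a : ℕ} (β : Module.Basis (Fin a) (ZMod p) F) {n ℓ A : ℕ}

theorem emb_gateEmb (mask : Fˣ → Bool) (e : Fˣ → F) (s : Fin n → F) (y : Fˣ) (t : Bool) (x : F) :
    emb (gateEmb F p a n A y) (regBits β A mask e s) (gateKet β A t x) =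
      regKet β A (Function.update mask y t) (Function.update e y x) s := by
  rw [gateKet_eq, regKet_eq]
  refine emb_ket _ ?_ ?_
  · rintro (_ | r | i)
    · exact Function.update_self y t mask
    · show enc β (Function.update e y x y) r = enc β x r
      rw [Function.update_self]
    · rfl
  · rintro (y' | ⟨y', r⟩ | ⟨j, r⟩ | i) hw
    · have : y' ≠ y := fun h => hw ⟨.flag, by rw [h]; rfl⟩
      simp [regBits, this]
    · have : y' ≠ y := fun h => hw ⟨.sym r, by rw [h]; rfl⟩
      simp [regBits, this]
    · rfl
    · rfl

/-- All constraint-encoding gates together. -/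
theorem run_encode (T : Fˣ → Finset F) (c : Fˣ → Circuit (GateWire p a A))
    (hc : ∀ y, ImplementsEncoding β (T y) (c y)) (S : Finset Fˣ) :
    Circuit.run ((Finset.univ : Finset Fˣ).toList.flatMap
        fun y => (c y).relabel (gateEmb F p a n A y)) (regKet β A (fun y => decide (y ∈ S)) 0 0) =
      ∑ e : Fˣ → F, (∏ y, if y ∈ S then gHat p (T y) (e y) else if e y = 0 then 1 else 0) •
        regKet β A (fun _ => false) e 0 := by
  have h := run_flatMap_tensor (fun o : Fˣ → Option F => regKet (n := n) β A
      (fun y => (o y).elim (decide (y ∈ S)) fun _ => false) (fun y => (o y).getD 0) 0)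
    (fun y => (c y).relabel (gateEmb F p a n A y))
    (fun y e => if y ∈ S then gHat p (T y) e else if e = 0 then 1 else 0) fun y o ho => by
      set mask : Fˣ → Bool := fun y => (o y).elim (decide (y ∈ S)) fun _ => false with hmask
      set e₀ : Fˣ → F := fun y => (o y).getD 0 with he₀
      have hm : mask y = decide (y ∈ S) := by simp [hmask, ho]
      have he : e₀ y = 0 := by simp [he₀, ho]
      have hupd : ∀ x, regKet (n := n) β A (fun y' => (Function.update o y (some x) y').elim
          (decide (y' ∈ S)) fun _ => false) (fun y' => (Function.update o y (some x) y').getD 0) 0 =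
          emb (gateEmb F p a n A y) (regBits β A mask e₀ 0) (gateKet β A false x) := fun x => by
        rw [emb_gateEmb]
        congr 1
        · funext y'
          rcases eq_or_ne y' y with rfl | hy
          · simp
          · simp [hy, hmask]
        · funext y'
          rcases eq_or_ne y' y with rfl | hy
          · simp
          · simp [hy, he₀]
      have h0 : regKet β A mask e₀ 0 =
          emb (gateEmb F p a n A y) (regBits β A mask e₀ 0) (gateKet β A (decide (y ∈ S)) 0) := by
        rw [emb_gateEmb, ← hm, ← he, Function.update_eq_self, Function.update_eq_self]
      simp only [hupd]
      rw [h0, Circuit.run_relabel]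
      by_cases hS : y ∈ S
      · have e1 : (c y).run (gateKet β A true 0) = ∑ e, gHat p (T y) e • gateKet β A false e := by
          rw [(hc y).2]
          refine Finset.sum_subset (Finset.filter_subset _ _) fun e _ he => ?_
          obtain rfl : e = 0 := by simpa using he
          rw [gHat_zero, zero_smul]
        simp only [hS, decide_true, e1, emb_sum, emb_smul, if_true]
      · simp [hS, (hc y).1]
  exact h

/-- Transposition of `B`: this is how the polynomial `Q_x` appears in the final amplitudes. -/
theorem sum_syndrome_mul (e : Fˣ → F) (x : Fin n → F) :
    ∑ j, syndrome n e j * x j = ∑ y, e y * polyVal x y := by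
  simp only [syndrome, polyVal, Finset.sum_mul, Finset.mul_sum]
  rw [Finset.sum_comm]
  exact Finset.sum_congr rfl fun y _ => Finset.sum_congr rfl fun j _ => by ring

/-- The sum over all error vectors factorizes over the constraints. A constraint in `S` gives
Fourier inversion, and any other contributes the single term `e y = 0`. -/
theorem sum_encode_mul_chi (T : Fˣ → Finset F) (S : Finset Fˣ) (x : Fin n → F) :
    ∑ e : Fˣ → F, (∏ y, if y ∈ S then gHat p (T y) (e y) else if e y = 0 then 1 else 0) *
        chi p (-(∑ j, syndrome n e j * x j)) =
      (Real.sqrt (Fintype.card F) : ℂ) ^ S.card * ((∏ y ∈ S, gFun (T y) (polyVal x y) : ℝ) : ℂ) := by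
  have h1 : ∀ e : Fˣ → F, (∏ y, if y ∈ S then gHat p (T y) (e y) else if e y = 0 then 1 else 0) *
      chi p (-(∑ j, syndrome n e j * x j)) =
      ∏ y, (if y ∈ S then gHat p (T y) (e y) else if e y = 0 then 1 else 0) *
        chi p (-(e y * polyVal x y)) := fun e => by
    rw [Finset.prod_mul_distrib, sum_syndrome_mul, ← Finset.sum_neg_distrib, chi_sum]
  have h2 : ∀ y : Fˣ, ∑ e : F, (if y ∈ S then gHat p (T y) e else if e = 0 then 1 else 0) *
      chi p (-(e * polyVal x y)) =
      if y ∈ S then (Real.sqrt (Fintype.card F) : ℂ) * (gFun (T y) (polyVal x y) : ℂ) else 1 := fun y => by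
    by_cases hy : y ∈ S
    · simp only [hy, if_true, sum_gHat_mul_chi]
    · simp [hy, chi_zero]
  rw [Finset.sum_congr rfl fun e _ => h1 e,
    ← Fintype.prod_sum fun (y : Fˣ) (e : F) =>
      (if y ∈ S then gHat p (T y) e else if e = 0 then 1 else 0) * chi p (-(e * polyVal x y)),
    Finset.prod_congr rfl fun y _ => h2 y, Finset.prod_ite_mem, Finset.univ_inter,
    Finset.prod_mul_distrib, Finset.prod_const, Complex.ofReal_prod]

/-- Only the specifications of the stages are used. The decoder is specified for at most `ℓ` errors,
which suffices because the errors are supported in a mask with at most `ℓ` elements. -/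
theorem DQICircuit.run_full (D : DQICircuit F p a n A) (T : Fˣ → Finset F) (w : Fin (ℓ + 1) → ℂ)
    (hℓ : ℓ ≤ n) (hdicke : IsDickePrep β w D.dicke)
    (hencode : ∀ y, ImplementsEncoding β (T y) (D.encode y)) (hsynd : IsSyndromeUpdate β D.synd)
    (hdecode : IsDecoder β ℓ D.decode) (hiqft : IsInverseQFT β D.iqft) :
    D.full.run (regKet β A (fun _ => false) 0 0) =
      ∑ x : Fin n → F, dqiAmplitude T w x • regKet β A (fun _ => false) 0 x := by
  have hlast : ∀ S : Finset Fˣ, S.card ≤ ℓ → D.iqft.run (D.decode.run (D.synd.run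
      (∑ e : Fˣ → F, (∏ y, if y ∈ S then gHat p (T y) (e y) else if e y = 0 then 1 else 0) •
        regKet β A (fun _ => false) e 0))) =
      ∑ x : Fin n → F, ((Real.sqrt (Fintype.card F) : ℂ) ^ S.card *
        ((∏ y ∈ S, gFun (T y) (polyVal x y) : ℝ) : ℂ) / (Real.sqrt ((Fintype.card F : ℝ) ^ n) : ℂ)) •
          regKet β A (fun _ => false) 0 x := by
    intro S hS
    simp only [Circuit.run_sum, Circuit.run_smul]
    have h1 : ∀ e : Fˣ → F,
        (∏ y, if y ∈ S then gHat p (T y) (e y) else if e y = 0 then (1 : ℂ) else 0) •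
          D.iqft.run (D.decode.run (D.synd.run (regKet β A (fun _ => false) e 0))) =
        ∑ x : Fin n → F, ((∏ y, if y ∈ S then gHat p (T y) (e y) else if e y = 0 then 1 else 0) *
          chi p (-(∑ j, syndrome n e j * x j)) / (Real.sqrt ((Fintype.card F : ℝ) ^ n) : ℂ)) •
            regKet β A (fun _ => false) 0 x := fun e => by
      by_cases he : weight e ≤ ℓ
      · rw [hsynd, zero_add, hdecode e he, hiqft, Finset.smul_sum]
        simp only [smul_smul, mul_div_assoc]
      · obtain ⟨y, hy, hyS⟩ : ∃ y ∈ Finset.univ.filter fun y => e y ≠ 0, y ∉ S := by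
          by_contra! h
          exact he ((Finset.card_le_card h).trans hS)
        have : (∏ y, if y ∈ S then gHat p (T y) (e y) else if e y = 0 then (1 : ℂ) else 0) = 0 := by
          refine Finset.prod_eq_zero (Finset.mem_univ y) ?_
          rw [if_neg hyS, if_neg (Finset.mem_filter.1 hy).2]
        simp [this]
    rw [Finset.sum_congr rfl fun e _ => h1 e, Finset.sum_comm]
    refine Finset.sum_congr rfl fun x _ => ?_
    rw [← Finset.sum_smul, ← Finset.sum_div, sum_encode_mul_chi]
  have hq : (0 : ℝ) ≤ Fintype.card F := Nat.cast_nonneg _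
  rw [DQICircuit.full, Circuit.run_append, Circuit.run_append, Circuit.run_append,
    Circuit.run_append, hdicke]
  simp only [Circuit.run_sum, Circuit.run_smul]
  have h2 : ∀ k : Fin (ℓ + 1), ∀ S ∈ (Finset.univ : Finset Fˣ).powersetCard (k : ℕ),
      D.iqft.run (D.decode.run (D.synd.run (Circuit.run ((Finset.univ : Finset Fˣ).toList.flatMap
        fun y => (D.encode y).relabel (gateEmb F p a n A y))
          (regKet β A (fun y => decide (y ∈ S)) 0 0)))) =
      ∑ x : Fin n → F, ((Real.sqrt (Fintype.card F) : ℂ) ^ (k : ℕ) *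
        ((∏ y ∈ S, gFun (T y) (polyVal x y) : ℝ) : ℂ) / (Real.sqrt ((Fintype.card F : ℝ) ^ n) : ℂ)) •
          regKet β A (fun _ => false) 0 x := fun k S hS => by
    have hk := (Finset.mem_powersetCard.1 hS).2
    rw [run_encode β T _ hencode, hlast S (hk.le.trans (Nat.lt_succ_iff.1 k.2)), hk]
  rw [Finset.sum_congr rfl fun k _ => by rw [Finset.sum_congr rfl (h2 k), Finset.sum_comm,
    Finset.smul_sum], Finset.sum_comm]
  refine Finset.sum_congr rfl fun x _ => ?_
  rw [dqiAmplitude, Finset.sum_smul]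
  refine Finset.sum_congr rfl fun k _ => ?_
  rw [← Finset.sum_smul, smul_smul, ← Finset.sum_div, ← Finset.mul_sum, ← Complex.ofReal_sum]
  congr 1
  have hk : (k : ℕ) ≤ n := (Nat.lt_succ_iff.1 k.2).trans hℓ
  -- The factor `√q ^ k` from Fourier inversion cancels part of the normalization of the Fourier
  -- transform; this explains the exponent `n - k` in `dqiAmplitude`.
  have hs : (Real.sqrt ((Fintype.card F : ℝ) ^ n) : ℂ) =
      (Real.sqrt ((Fintype.card F : ℝ) ^ (n - (k : ℕ))) : ℂ) * (Real.sqrt (Fintype.card F) : ℂ) ^ (k : ℕ) := by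
    rw [← Complex.ofReal_pow, ← Complex.ofReal_mul, sqrt_pow_eq hq, sqrt_pow_eq hq, ← pow_add,
      Nat.sub_add_cancel hk]
  have h0 : (Real.sqrt (Fintype.card F) : ℂ) ^ (k : ℕ) ≠ 0 := pow_ne_zero _ sqrt_card_ne_zero
  rw [hs, Real.sqrt_mul (by positivity), Complex.ofReal_mul]
  rw [mul_comm ((Real.sqrt ((Fintype.card F : ℝ) ^ (n - (k : ℕ))) : ℂ)) (_ ^ _), mul_div_mul_left _ _ h0,
    div_mul_div_comm, mul_comm ((Real.sqrt ((Fintype.card Fˣ).choose k) : ℂ)), mul_div_right_comm]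

end Full

/-! ### Bounds for the number of gates -/

section Bounds

/-- Rounding up in each of the `a` coordinates costs at most a factor `2`, the worst case being
small `p`. -/
theorem symBits_le {p a : ℕ} (hp : p.Prime) : symBits p a ≤ 2 * Nat.log 2 (p ^ a) := by
  have h1 : Nat.clog 2 p ≤ 2 * Nat.log 2 p := by
    have h2 : 1 ≤ Nat.log 2 p := Nat.log_pos one_lt_two hp.two_le
    have h3 : Nat.clog 2 p ≤ Nat.log 2 p + 1 :=
      Nat.clog_le_of_le_pow (Nat.lt_pow_succ_log_self one_lt_two p).le
    omega
  have h2 : a * Nat.log 2 p ≤ Nat.log 2 (p ^ a) := by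
    refine Nat.le_log_of_pow_le one_lt_two ?_
    rw [mul_comm, pow_mul]
    exact Nat.pow_le_pow_left (Nat.pow_log_le_self 2 hp.ne_zero) a
  calc symBits p a = a * Nat.clog 2 p := rfl
    _ ≤ a * (2 * Nat.log 2 p) := Nat.mul_le_mul_left a h1
    _ = 2 * (a * Nat.log 2 p) := by ring
    _ ≤ _ := Nat.mul_le_mul_left 2 h2

theorem log_succ_le {m : ℕ} (hm : 2 ≤ m) : Nat.log 2 (m + 1) ≤ 2 * Nat.log 2 m := by
  have h1 : 1 ≤ Nat.log 2 m := Nat.log_pos one_lt_two hm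
  have h2 : m + 1 ≤ 2 ^ (Nat.log 2 m + 1) := Nat.lt_pow_succ_log_self one_lt_two m
  have h3 := Nat.log_mono_right (b := 2) h2
  rw [Nat.log_pow one_lt_two] at h3
  omega

variable {m n ℓ L : ℕ}

theorem encodeCost_le {b : ℕ} (hL : 1 ≤ L) (hb : b ≤ 4 * L) : m * (30 * (b + 1)) ≤ 150 * (m * L) := by
  calc m * (30 * (b + 1)) ≤ m * (30 * (5 * L)) := Nat.mul_le_mul_left m (by omega)
    _ = _ := by ring

theorem dickeCost_le (hn : 1 ≤ n) (hnm : n < m) (hℓ : 2 * ℓ ≤ n) :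
    (ℓ + 1) * (30 * (ℓ + 2)) + m * (ℓ * 7) + 2 ≤ 100 * (m * n) := by
  have h1 : (ℓ + 1) * (30 * (ℓ + 2)) ≤ m * (30 * (3 * n)) := Nat.mul_le_mul (by omega) (by omega)
  have h2 : m * (ℓ * 7) ≤ m * (n * 7) := Nat.mul_le_mul_left m (by omega)
  have h3 : 1 * 1 ≤ m * n := Nat.mul_le_mul (by omega) hn
  calc _ ≤ m * (30 * (3 * n)) + m * (n * 7) + 2 * (m * n) := by omega
    _ = 99 * (m * n) := by ring
    _ ≤ _ := by omega

theorem opCost_le {p a : ℕ} (hL : 1 ≤ L) (hb : symBits p a ≤ 4 * L) : opCost p a ≤ 3216 * L ^ 3 := by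
  have h2 : symBits p a ^ 2 ≤ (4 * L) ^ 2 := Nat.pow_le_pow_left hb 2
  have h3 : L ^ 2 ≤ L ^ 3 := Nat.pow_le_pow_right hL (by norm_num)
  have h4 : symBits p a ^ 2 * (40 * symBits p a + 1) ≤ (4 * L) ^ 2 * (161 * L) :=
    Nat.mul_le_mul h2 (by omega)
  calc opCost p a ≤ 40 * (4 * L) ^ 2 + (4 * L) ^ 2 * (161 * L) := by unfold opCost; omega
    _ = 640 * L ^ 2 + 2576 * L ^ 3 := by ring
    _ ≤ _ := by omega

theorem syndCost_le {p a : ℕ} (hL : 1 ≤ L) (hb : symBits p a ≤ 4 * L) (hn : 1 ≤ n) (hnm : n < m) :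
    16 * (n * (3 * m + 2) * opCost p a) + 8 + 4 * (n * symBits p a) ≤ 300000 * (m * n * L ^ 3) := by
  have h1 : n * (3 * m + 2) * opCost p a ≤ n * (4 * m) * (3216 * L ^ 3) :=
    Nat.mul_le_mul (Nat.mul_le_mul_left n (by omega)) (opCost_le hL hb)
  have hL3 : L ≤ L ^ 3 := Nat.le_self_pow (by norm_num) L
  have h2 : n * symBits p a ≤ m * n * (4 * L ^ 3) :=
    Nat.mul_le_mul (Nat.le_mul_of_pos_left n (by omega)) (by omega)
  have h3 : 1 * 1 * 1 ≤ m * n * L ^ 3 := Nat.mul_le_mul (Nat.mul_le_mul (by omega) hn) (by omega)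
  calc _ ≤ 16 * (n * (4 * m) * (3216 * L ^ 3)) + 8 * (m * n * L ^ 3) + 4 * (m * n * (4 * L ^ 3)) := by
        omega
    _ = 205848 * (m * n * L ^ 3) := by ring
    _ ≤ _ := Nat.mul_le_mul_right _ (by norm_num)

theorem decodeCost_le {q : ℕ} (hL : 1 ≤ L) (hq : Nat.log 2 q ≤ 2 * L) (hn : 1 ≤ n) (hnm : n < m) :
    decodeCost m n q ≤ 400 * (m * n * L) := by
  have e1 : n * (105 * n + 4 * Nat.log 2 q + 124) ≤ n * (m * (237 * L)) := by
    refine Nat.mul_le_mul_left n ?_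
    have h1 : 105 * n ≤ m * (105 * L) := by
      calc 105 * n ≤ 105 * m * 1 := by omega
        _ ≤ 105 * m * L := Nat.mul_le_mul_left _ hL
        _ = _ := by ring
    have h2 : 1 * (132 * L) ≤ m * (132 * L) := Nat.mul_le_mul_right _ (by omega)
    calc _ ≤ m * (105 * L) + m * (132 * L) := by omega
      _ = _ := by ring
  have e2 : m * (6 * n + 4 * Nat.log 2 q + 24) ≤ m * (n * (38 * L)) := by
    refine Nat.mul_le_mul_left m ?_
    have h1 : 6 * n * 1 ≤ 6 * n * L := Nat.mul_le_mul_left _ hL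
    have h2 : 1 * (32 * L) ≤ n * (32 * L) := Nat.mul_le_mul_right _ (by omega)
    calc _ ≤ 6 * n * L + n * (32 * L) := by omega
      _ = _ := by ring
  have e3 : 13 * n + 20 ≤ 33 * (m * n * L) := by
    have h1 : 1 * n * 1 ≤ m * n * L := Nat.mul_le_mul (Nat.mul_le_mul_right n (by omega)) hL
    omega
  calc decodeCost m n q ≤ n * (m * (237 * L)) + 33 * (m * n * L) + m * (n * (38 * L)) := by
        unfold decodeCost; omega
    _ = 308 * (m * n * L) := by ring
    _ ≤ _ := Nat.mul_le_mul_right _ (by norm_num)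

theorem decodeGates_le {p a q : ℕ} (hL : 1 ≤ L) (hb : symBits p a ≤ 4 * L)
    (hq : Nat.log 2 q ≤ 2 * L) (hn : 1 ≤ n) (hnm : n < m) :
    8 * (decodeCost m n q * opCost p a) + 2 + m * symBits p a ≤ 11000000 * (m * n * L ^ 4) := by
  have h1 : decodeCost m n q * opCost p a ≤ 400 * (m * n * L) * (3216 * L ^ 3) :=
    Nat.mul_le_mul (decodeCost_le hL hq hn hnm) (opCost_le hL hb)
  have hL4 : L ≤ L ^ 4 := Nat.le_self_pow (by norm_num) L
  have h2 : m * 1 * symBits p a ≤ m * n * (4 * L ^ 4) :=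
    Nat.mul_le_mul (Nat.mul_le_mul_left m hn) (by omega)
  have h3 : 1 * 1 * 1 ≤ m * n * L ^ 4 := Nat.mul_le_mul (Nat.mul_le_mul (by omega) hn) (by omega)
  rw [mul_one] at h2
  calc _ ≤ 8 * (400 * (m * n * L) * (3216 * L ^ 3)) + 2 * (m * n * L ^ 4) + m * n * (4 * L ^ 4) := by
        omega
    _ = 10291206 * (m * n * L ^ 4) := by ring
    _ ≤ _ := Nat.mul_le_mul_right _ (by norm_num)

theorem qftCost_le {b : ℕ} (hL : 1 ≤ L) (hb : b ≤ 4 * L) (hm : 1 ≤ m) :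
    qftCost (m + 1) b ≤ 5000 * (m * L ^ 2) := by
  have h2 : b ^ 2 ≤ (4 * L) ^ 2 := Nat.pow_le_pow_left hb 2
  have hL2 : L ≤ L ^ 2 := Nat.le_self_pow (by norm_num) L
  have e0 : (4 * L) ^ 2 = 16 * L ^ 2 := by ring
  have h3 : (11 * b ^ 2 + 2 * b + 1) * (2 * (m + 1) + 1) ≤ 185 * L ^ 2 * (5 * m) :=
    Nat.mul_le_mul (by omega) (by omega)
  have h4 : (m + 1) * (2 * (8 * (12 * b + 3) + 3) + 8) ≤ 2 * m * (830 * L ^ 2) :=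
    Nat.mul_le_mul (by omega) (by omega)
  have h5 : 1 * (12 * L ^ 2) ≤ m * (12 * L ^ 2) := Nat.mul_le_mul_right _ hm
  calc qftCost (m + 1) b ≤ 185 * L ^ 2 * (5 * m) + 2 * m * (830 * L ^ 2) + m * (12 * L ^ 2) := by
        unfold qftCost; omega
    _ = 2597 * (m * L ^ 2) := by ring
    _ ≤ _ := Nat.mul_le_mul_right _ (by norm_num)

end Bounds

/-! ### Assembly of the stages within the gate bounds -/

section Existence

variable {p : ℕ} [hp : Fact p.Prime] {F : Type*} [Field F] [Fintype F] [DecidableEq F]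
  [Algebra (ZMod p) F] {a : ℕ} (β : Module.Basis (Fin a) (ZMod p) F)

/-- Decoded quantum interferometry has an implementation within the bounds on the number of gates. -/
theorem exists_implements {m n ℓ : ℕ} (hm : m = Fintype.card F - 1) (hn : 1 ≤ n) (hnm : n < m)
    (hℓ : 2 * ℓ ≤ n) (T : Fˣ → Finset F) (hT : ∀ y, T y ≠ ∅ ∧ T y ≠ Finset.univ)
    (w : Fin (ℓ + 1) → ℂ) (hw : ∑ k, ‖w k‖ ^ 2 = 1) :
    ∃ (A : ℕ) (D : DQICircuit F p a n A), D.Implements β T w ∧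
      (∀ y, (D.encode y).length ≤ 12000000 * m * Nat.log 2 m ^ 4) ∧
      D.otherGates ≤ 12000000 * (m * n) * Nat.log 2 m ^ 4 ∧
      D.full.length ≤ 12000000 * m ^ 2 * Nat.log 2 m ^ 4 := by
  set L := Nat.log 2 m with hLdef
  have hcard : Fintype.card F = m + 1 := by have := Fintype.card_pos (α := F); omega
  have hunits : Fintype.card Fˣ = m := by rw [Fintype.card_units]; omega
  have ha : Fintype.card F = p ^ a := by
    rw [Module.card_fintype β, ZMod.card, Fintype.card_fin]
  have hL : 1 ≤ L := Nat.log_pos one_lt_two (by omega)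
  have hlog : Nat.log 2 (Fintype.card F) ≤ 2 * L := by rw [hcard]; exact log_succ_le (by omega)
  have hb : symBits p a ≤ 4 * L := by
    have := symBits_le (a := a) hp.out
    rw [← ha] at this
    omega
  obtain ⟨A₁, h₁⟩ := exists_dicke (n := n) β (ℓ := ℓ) (by omega) w hw
  choose A₂ h₂ using fun y => exists_encode β (T y) (hT y).1 (hT y).2
  obtain ⟨A₃, h₃⟩ := exists_synd (n := n) β
  obtain ⟨A₄, h₄⟩ := exists_decode β (by omega) hn hℓ
  obtain ⟨A₅, h₅⟩ := exists_iqft (n := n) β ha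
  -- All stages have to act on the same qubits; the sum exceeds each of the individual thresholds.
  set A := A₁ + ∑ y, A₂ y + A₃ + A₄ + A₅ with hA
  have hA₂ : ∀ y, A₂ y ≤ A := fun y => by
    have := Finset.single_le_sum (f := A₂) (fun _ _ => Nat.zero_le _) (Finset.mem_univ y)
    omega
  obtain ⟨c₁, hc₁, hi₁⟩ := h₁ A (by omega)
  choose c₂ hc₂ hi₂ using fun y => h₂ y A (hA₂ y)
  obtain ⟨c₃, hc₃, hi₃⟩ := h₃ A (by omega)
  obtain ⟨c₄, hc₄, hi₄⟩ := h₄ A (by omega)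
  obtain ⟨c₅, hc₅, hi₅⟩ := h₅ A (by omega)
  let D : DQICircuit F p a n A := ⟨c₁, c₂, c₃, c₄, c₅⟩
  have hLk : ∀ k, k ≤ 4 → L ^ k ≤ L ^ 4 := fun k hk => Nat.pow_le_pow_right hL hk
  have henc : ∀ y, (c₂ y).length ≤ 150 * (m * L) := fun y => by
    have := hc₂ y
    rw [hunits] at this
    exact this.trans (encodeCost_le hL hb)
  have hother : D.otherGates ≤ 11500000 * (m * n * L ^ 4) := by
    rw [hunits] at hc₁ hc₃ hc₄
    rw [hcard] at hc₅
    have b₁ := hc₁.trans (dickeCost_le hn hnm hℓ)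
    have b₃ := hc₃.trans (syndCost_le hL hb hn hnm)
    have b₄ := hc₄.trans (decodeGates_le hL hb (hcard ▸ hlog) hn hnm)
    have b₅ := hc₅.trans (Nat.mul_le_mul_left n (qftCost_le hL hb (by omega)))
    have e₁ : m * n * 1 ≤ m * n * L ^ 4 := Nat.mul_le_mul_left _ (Nat.one_le_pow _ _ hL)
    have e₃ : m * n * L ^ 3 ≤ m * n * L ^ 4 := Nat.mul_le_mul_left _ (hLk 3 (by norm_num))
    have e₅ : n * (5000 * (m * L ^ 2)) ≤ 5000 * (m * n * L ^ 4) := by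
      calc _ = 5000 * (m * n * L ^ 2) := by ring
        _ ≤ _ := Nat.mul_le_mul_left _ (Nat.mul_le_mul_left _ (hLk 2 (by norm_num)))
    show c₁.length + c₃.length + c₄.length + c₅.length ≤ _
    omega
  refine ⟨A, D, ⟨hi₁, hi₂, hi₃, hi₄, hi₅, D.run_full β T w (by omega) hi₁ hi₂ hi₃ hi₄ hi₅⟩, ?_, ?_, ?_⟩
  · intro y
    refine (henc y).trans ?_
    have : m * L ≤ m * L ^ 4 := Nat.mul_le_mul_left _ (Nat.le_self_pow (by norm_num) L)
    rw [mul_assoc]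
    omega
  · rw [mul_assoc]
    omega
  · have h1 : D.full.length = D.otherGates + ((Finset.univ : Finset Fˣ).toList.flatMap
        fun y => (D.encode y).relabel (gateEmb F p a n A y)).length := by
      simp only [DQICircuit.full, DQICircuit.otherGates, List.length_append]
      ring
    have h2 := length_flatMap_le (fun y => (D.encode y).relabel (gateEmb F p a n A y))
      (N := 150 * (m * L)) fun y => by rw [Circuit.length_relabel]; exact henc y
    rw [hunits] at h2
    have h3 : m * (150 * (m * L)) ≤ 150 * (m ^ 2 * L ^ 4) := by
      calc _ = 150 * (m ^ 2 * L) := by ring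
        _ ≤ _ := Nat.mul_le_mul_left _ (Nat.mul_le_mul_left _ (Nat.le_self_pow (by norm_num) L))
    have h4 : m * n * L ^ 4 ≤ m ^ 2 * L ^ 4 := by
      rw [sq]
      exact Nat.mul_le_mul_right _ (Nat.mul_le_mul_left _ hnm.le)
    rw [h1, mul_assoc]
    omega

end Existence

/-! ### Elementary symmetric polynomials in numbers with two values -/

section TwoValues

open Polynomial

variable {Y : Type*} [Fintype Y] [DecidableEq Y]

/-- If the numbers `g y` are roots of one quadratic polynomial, then their elementary symmetric
polynomials are polynomials in their sum. -/
theorem exists_polynomial_esymm (α γ : ℝ) (k : ℕ) : ∃ P : ℝ[X], P.natDegree ≤ k ∧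
    ∀ g : Y → ℝ, (∀ y, g y ^ 2 = α * g y + γ) →
      ∑ S ∈ (Finset.univ : Finset Y).powersetCard k, ∏ y ∈ S, g y = P.eval (∑ y, g y) := by
  -- The quadratic relation makes every power affine, so every power sum of the `g y` is affine in
  -- `∑ y, g y`.
  have hpow : ∀ j : ℕ, ∃ b c : ℝ, ∀ t : ℝ, t ^ 2 = α * t + γ → t ^ j = b * t + c := by
    intro j
    induction j with
    | zero => exact ⟨0, 1, fun t _ => by simp⟩
    | succ j ih =>
      obtain ⟨b, c, h⟩ := ih
      refine ⟨b * α + c, b * γ, fun t ht => ?_⟩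
      rw [pow_succ, h t ht]
      linear_combination b * ht
  choose b c hbc using hpow
  induction k using Nat.strong_induction_on with
  | _ k ih =>
    rcases Nat.eq_zero_or_pos k with rfl | hk
    · exact ⟨1, by simp, fun g _ => by simp⟩
    choose! P hP hPe using ih
    -- The right-hand side of Newton's identity for `k * e_k`. Each term is `e_i` with `i < k` times
    -- a power sum, so its degree is at most `i + 1 ≤ k`.
    let N : ℝ[X] := ∑ i ∈ Finset.HasAntidiagonal.antidiagonal k with i.1 < k,
      C ((-1) ^ i.1) * P i.1 * (C (b i.2) * X + C (c i.2 * Fintype.card Y))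
    refine ⟨C ((k : ℝ)⁻¹ * (-1) ^ (k + 1)) * N, ?_, fun g hg => ?_⟩
    · refine (natDegree_C_mul_le _ _).trans (natDegree_sum_le_of_forall_le _ _ fun i hi => ?_)
      obtain ⟨hi, hik⟩ := Finset.mem_filter.1 hi
      rw [Finset.HasAntidiagonal.mem_antidiagonal] at hi
      refine natDegree_mul_le.trans ?_
      have h1 : (C ((-1) ^ i.1) * P i.1).natDegree ≤ i.1 :=
        (natDegree_C_mul_le _ _).trans (hP i.1 hik)
      have h2 : (C (b i.2) * X + C (c i.2 * (Fintype.card Y : ℝ))).natDegree ≤ 1 :=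
        natDegree_linear_le
      omega
    · have hnewton := congrArg (MvPolynomial.aeval g) (MvPolynomial.mul_esymm_eq_sum Y ℝ k)
      have hpsum : ∀ j, MvPolynomial.aeval g (MvPolynomial.psum Y ℝ j) =
          b j * ∑ y, g y + c j * Fintype.card Y := fun j => by
        simp only [MvPolynomial.psum, map_sum, map_pow, MvPolynomial.aeval_X]
        rw [Finset.sum_congr rfl fun y _ => hbc j (g y) (hg y), Finset.sum_add_distrib,
          ← Finset.mul_sum]
        simp [mul_comm]
      have hesymm : ∀ j, MvPolynomial.aeval g (MvPolynomial.esymm Y ℝ j) =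
          ∑ S ∈ (Finset.univ : Finset Y).powersetCard j, ∏ y ∈ S, g y := fun j => by
        simp [MvPolynomial.esymm]
      have hk0 : (k : ℝ) ≠ 0 := by exact_mod_cast hk.ne'
      simp only [map_mul, map_natCast, map_pow, map_neg, map_one, map_sum, hpsum, hesymm] at hnewton
      have hN : N.eval (∑ y, g y) = ∑ i ∈ Finset.HasAntidiagonal.antidiagonal k with i.1 < k,
          (-1) ^ i.1 * (∑ S ∈ (Finset.univ : Finset Y).powersetCard i.1, ∏ y ∈ S, g y) *
            (b i.2 * ∑ y, g y + c i.2 * Fintype.card Y) := by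
        simp only [N, eval_finsetSum, eval_mul, eval_add, eval_C, eval_X]
        refine Finset.sum_congr rfl fun i hi => ?_
        rw [hPe i.1 (Finset.mem_filter.1 hi).2 g hg]
      rw [eval_mul, eval_C, hN, mul_assoc, ← hnewton, inv_mul_cancel_left₀ hk0]

end TwoValues

/-! ### Target sets of equal size -/

section EqualSize

variable {p : ℕ} [hp : Fact p.Prime] {F : Type*} [Field F] [Fintype F] [DecidableEq F]
  [Algebra (ZMod p) F] {a : ℕ}

theorem sgn_sq (T : Finset F) (z : F) : sgn T z ^ 2 = 1 := by
  unfold sgn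
  split_ifs <;> norm_num

theorem sgnMean_eq_of_card_eq {T T' : Finset F} (h : T.card = T'.card) : sgnMean T = sgnMean T' := by
  have key : ∀ T : Finset F, ∑ z, sgn T z = 2 * T.card - Fintype.card F := fun T => by
    have : ∀ z, sgn T z = 2 * (if z ∈ T then 1 else 0) - 1 := fun z => by
      unfold sgn
      split_ifs <;> norm_num
    simp only [this, Finset.sum_sub_distrib, ← Finset.mul_sum]
    simp
  rw [sgnMean, sgnMean, key, key, h]

theorem sgnScale_eq_of_card_eq {T T' : Finset F} (h : T.card = T'.card) :
    sgnScale T = sgnScale T' := by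
  have key : ∀ T : Finset F, ∑ z, (sgn T z - sgnMean T) ^ 2 =
      Fintype.card F * (1 - sgnMean T ^ 2) := fun T => by
    have : ∀ z, (sgn T z - sgnMean T) ^ 2 = 1 + sgnMean T ^ 2 - 2 * sgnMean T * sgn T z := fun z => by
      linear_combination sgn_sq T z
    simp only [this, Finset.sum_sub_distrib, ← Finset.mul_sum, ← card_mul_sgnMean]
    simp
    ring
  rw [sgnScale, sgnScale, key, key, sgnMean_eq_of_card_eq h]

variable {n ℓ : ℕ} {T : Fˣ → Finset F}

/-- For target sets of equal size the amplitudes are polynomials in the objective. -/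
theorem exists_polynomial_dqiAmplitude {r : ℕ} (hr : ∀ y, (T y).card = r)
    (hT : ∀ y, T y ≠ ∅ ∧ T y ≠ Finset.univ) (w : Fin (ℓ + 1) → ℂ) :
    ∃ P : Polynomial ℂ, P.natDegree ≤ ℓ ∧
      ∀ x : Fin n → F, dqiAmplitude T w x = P.eval (objective T x : ℂ) := by
  classical
  set μ := sgnMean (T 1) with hμ
  set c := sgnScale (T 1) with hc
  have hμy : ∀ y, sgnMean (T y) = μ := fun y => sgnMean_eq_of_card_eq ((hr y).trans (hr 1).symm)
  have hcy : ∀ y, sgnScale (T y) = c := fun y => sgnScale_eq_of_card_eq ((hr y).trans (hr 1).symm)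
  have hc0 : c ≠ 0 := (sgnScale_pos (hT 1).1 (hT 1).2).ne'
  -- This is `sgn ^ 2 = 1` rewritten for `g = (sgn - μ) / c`. Equal sizes make `μ` and `c`, and
  -- hence the quadratic, independent of `y`.
  have hg : ∀ y z, gFun (T y) z ^ 2 = -(2 * μ / c) * gFun (T y) z + (1 - μ ^ 2) / c ^ 2 := fun y z => by
    rw [gFun, hμy, hcy]
    field_simp
    linear_combination sgn_sq (T y) z
  have hsum : ∀ x : Fin n → F, ∑ y, gFun (T y) (polyVal x y) =
      c⁻¹ * objective T x + -(Fintype.card Fˣ * μ / c) := fun x => by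
    simp only [gFun, hμy, hcy, objective]
    rw [← Finset.sum_div, Finset.sum_sub_distrib]
    simp
    ring
  choose P hP hPe using exists_polynomial_esymm (Y := Fˣ) (-(2 * μ / c)) ((1 - μ ^ 2) / c ^ 2)
  let lin : Polynomial ℝ := Polynomial.C c⁻¹ * Polynomial.X + Polynomial.C (-(Fintype.card Fˣ * μ / c))
  refine ⟨∑ k : Fin (ℓ + 1), Polynomial.C (w k / (Real.sqrt ((Fintype.card F : ℝ) ^ (n - (k : ℕ)) *
    (Fintype.card Fˣ).choose k) : ℂ)) * ((P k).comp lin).map Complex.ofRealHom, ?_, fun x => ?_⟩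
  · refine Polynomial.natDegree_sum_le_of_forall_le _ _ fun k _ => ?_
    refine (Polynomial.natDegree_C_mul_le _ _).trans (Polynomial.natDegree_map_le.trans ?_)
    refine Polynomial.natDegree_comp_le.trans ?_
    calc _ ≤ (k : ℕ) * 1 := Nat.mul_le_mul (hP k) Polynomial.natDegree_linear_le
      _ ≤ ℓ := by have := k.2; omega
  · rw [dqiAmplitude, Polynomial.eval_finsetSum]
    refine Finset.sum_congr rfl fun k _ => ?_
    rw [Polynomial.eval_mul, Polynomial.eval_C, hPe k _ fun y => hg y _, hsum]
    congr 1
    have : (objective T x : ℂ) = Complex.ofRealHom (objective T x) := rfl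
    rw [this, Polynomial.eval_map_apply, Polynomial.eval_comp]
    simp [lin]

/-- Needed for the inner product of states of the whole algorithm. -/
instance : Finite (Wire F p a n ℓ) := by
  refine Finite.of_injective (β := Fˣ ⊕ (Fˣ × Sym p a) ⊕ (Fin n × Sym p a) ⊕ Fin ℓ) (fun
    | .mask y => .inl y
    | .err y r => .inr (.inl (y, r))
    | .syn j r => .inr (.inr (.inl (j, r)))
    | .anc i => .inr (.inr (.inr i))) ?_
  rintro (y | ⟨y, r⟩ | ⟨j, r⟩ | i) (y' | ⟨y', r'⟩ | ⟨j', r'⟩ | i') h <;> simp_all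

theorem dqiAmplitude_add (w w' : Fin (ℓ + 1) → ℂ) (x : Fin n → F) :
    dqiAmplitude T (w + w') x = dqiAmplitude T w x + dqiAmplitude T w' x := by
  simp only [dqiAmplitude, ← Finset.sum_add_distrib, Pi.add_apply, add_div, add_mul]

theorem dqiAmplitude_smul (c : ℂ) (w : Fin (ℓ + 1) → ℂ) (x : Fin n → F) :
    dqiAmplitude T (c • w) x = c * dqiAmplitude T w x := by
  simp only [dqiAmplitude, Finset.mul_sum, Pi.smul_apply, smul_eq_mul, mul_div_assoc, mul_assoc]

/-- The prepared states are normalized. -/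
theorem sum_norm_dqiAmplitude_sq (β : Module.Basis (Fin a) (ZMod p) F) {m : ℕ}
    (hm : m = Fintype.card F - 1) (hn : 1 ≤ n) (hnm : n < m) (hℓ : 2 * ℓ ≤ n)
    (hT : ∀ y, T y ≠ ∅ ∧ T y ≠ Finset.univ) (w : Fin (ℓ + 1) → ℂ) :
    ∑ x : Fin n → F, ‖dqiAmplitude T w x‖ ^ 2 = ∑ k, ‖w k‖ ^ 2 := by
  classical
  -- For normalized weights no computation with characters is needed: the state is the output of a
  -- unitary circuit on a basis state. General weights follow by scaling.
  have hone : ∀ w : Fin (ℓ + 1) → ℂ, ∑ k, ‖w k‖ ^ 2 = 1 →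
      ∑ x : Fin n → F, ‖dqiAmplitude T w x‖ ^ 2 = 1 := by
    intro w hw
    obtain ⟨A, D, hD, -⟩ := exists_implements β hm hn hnm hℓ T hT w hw
    have : Fintype (Wire F p a n A) := Fintype.ofFinite _
    have hreg : ∀ x x' : Fin n → F, braket (regKet β A (fun _ => false) 0 x)
        (regKet β A (fun _ => false) 0 x') = if x' = x then 1 else 0 := fun x x' => by
      rw [regKet_eq, regKet_eq, braket_ket, ket_apply]
      refine if_congr ⟨fun h => ?_, fun h => by rw [h]⟩ rfl rfl
      funext j
      refine (enc_injective β (funext fun r => ?_)).symm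
      exact congrFun h (.syn j r)
    have h1 := D.full.braket_run (regKet β A (fun _ => false) 0 0) (regKet β A (fun _ => false) 0 0)
    rw [hD.full, hreg, if_pos rfl] at h1
    have hsum : ∀ (s : Finset (Fin n → F)) (c : (Fin n → F) → ℂ) (ψ : (Fin n → F) → QState (Wire F p a n A))
        (φ : QState (Wire F p a n A)),
        braket (∑ x ∈ s, c x • ψ x) φ = ∑ x ∈ s, star (c x) * braket (ψ x) φ := fun s c ψ φ => by
      simp only [braket_eq, Finset.sum_apply, Pi.smul_apply, smul_eq_mul, star_sum, star_mul',
        Finset.sum_mul, Finset.mul_sum]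
      rw [Finset.sum_comm]
      simp only [mul_assoc]
    have hsum' : ∀ (s : Finset (Fin n → F)) (c : (Fin n → F) → ℂ) (ψ : (Fin n → F) → QState (Wire F p a n A))
        (φ : QState (Wire F p a n A)),
        braket φ (∑ x ∈ s, c x • ψ x) = ∑ x ∈ s, c x * braket φ (ψ x) := fun s c ψ φ => by
      simp only [braket_eq, Finset.sum_apply, Pi.smul_apply, smul_eq_mul, Finset.mul_sum]
      rw [Finset.sum_comm]
      exact Finset.sum_congr rfl fun x _ => Finset.sum_congr rfl fun t _ => by ring
    simp only [hsum, hsum', hreg, mul_ite, mul_one, mul_zero, Finset.sum_ite_eq', Finset.mem_univ,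
      if_true] at h1
    have h2 : ((∑ x : Fin n → F, ‖dqiAmplitude T w x‖ ^ 2 : ℝ) : ℂ) = 1 := by
      rw [← h1, Complex.ofReal_sum]
      refine Finset.sum_congr rfl fun x _ => ?_
      rw [Complex.star_def, mul_comm, Complex.mul_conj, Complex.normSq_eq_norm_sq]
    exact_mod_cast h2
  set N := ∑ k, ‖w k‖ ^ 2 with hN
  have hN0 : 0 ≤ N := Finset.sum_nonneg fun _ _ => sq_nonneg _
  rcases hN0.eq_or_lt with h0 | h0
  · have hw : w = 0 := by
      funext k
      have := (Finset.sum_eq_zero_iff_of_nonneg fun k _ => sq_nonneg ‖w k‖).1 h0.symm k (Finset.mem_univ _)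
      simpa using this
    rw [← h0, hw]
    simp [dqiAmplitude]
  · have hs : 0 < Real.sqrt N := Real.sqrt_pos.2 h0
    have hnorm : ‖((Real.sqrt N)⁻¹ : ℂ)‖ ^ 2 = N⁻¹ := by
      rw [norm_inv, Complex.norm_real, Real.norm_of_nonneg hs.le, inv_pow, Real.sq_sqrt hN0]
    have h1 := hone (((Real.sqrt N)⁻¹ : ℂ) • w) (by
      simp only [Pi.smul_apply, smul_eq_mul, norm_mul, mul_pow, hnorm]
      rw [← Finset.mul_sum, ← hN, inv_mul_cancel₀ h0.ne'])
    simp only [dqiAmplitude_smul, norm_mul, mul_pow, hnorm] at h1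
    rw [← Finset.mul_sum] at h1
    field_simp at h1
    exact h1

/-- For target sets of equal size, all normalized polynomials in the objective are prepared. -/
theorem exists_weights (β : Module.Basis (Fin a) (ZMod p) F) {m : ℕ}
    (hm : m = Fintype.card F - 1) (hn : 1 ≤ n) (hnm : n < m) (hℓ : 2 * ℓ ≤ n)
    (hT : ∀ y, T y ≠ ∅ ∧ T y ≠ Finset.univ) {r : ℕ} (hr : ∀ y, (T y).card = r)
    (P : Polynomial ℂ) (hP : P.natDegree ≤ ℓ)
    (hnorm : ∑ x : Fin n → F, ‖P.eval (objective T x : ℂ)‖ ^ 2 = 1) :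
    ∃ w : Fin (ℓ + 1) → ℂ, ∑ k, ‖w k‖ ^ 2 = 1 ∧
      ∀ x : Fin n → F, dqiAmplitude T w x = P.eval (objective T x : ℂ) := by
  let Φ : (Fin (ℓ + 1) → ℂ) →ₗ[ℂ] ((Fin n → F) → ℂ) :=
    { toFun := fun w x => dqiAmplitude T w x
      map_add' := fun w w' => funext fun x => dqiAmplitude_add w w' x
      map_smul' := fun c w => funext fun x => dqiAmplitude_smul c w x }
  let E : (Fin (ℓ + 1) → ℂ) →ₗ[ℂ] ((Fin n → F) → ℂ) :=
    { toFun := fun c x => ∑ i, c i * (objective T x : ℂ) ^ (i : ℕ)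
      map_add' := fun c c' => funext fun x => by
        simp [add_mul, Finset.sum_add_distrib]
      map_smul' := fun b c => funext fun x => by
        simp [Finset.mul_sum, mul_assoc] }
  have hE : ∀ P : Polynomial ℂ, P.natDegree ≤ ℓ →
      (fun x : Fin n → F => P.eval (objective T x : ℂ)) ∈ LinearMap.range E := fun P hP => by
    refine ⟨fun i => P.coeff i, funext fun x => ?_⟩
    rw [Polynomial.eval_eq_sum_range' (Nat.lt_succ_of_le hP),
      ← Fin.sum_univ_eq_sum_range (fun i => P.coeff i * (objective T x : ℂ) ^ i) (ℓ + 1)]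
    rfl
  have hle : LinearMap.range Φ ≤ LinearMap.range E := by
    rintro _ ⟨w, rfl⟩
    obtain ⟨P, hP, hPe⟩ := exists_polynomial_dqiAmplitude (n := n) hr hT w
    convert hE P hP using 1
    exact funext hPe
  have hinj : Function.Injective Φ := by
    rw [injective_iff_map_eq_zero]
    intro w hw
    have h := sum_norm_dqiAmplitude_sq β hm hn hnm hℓ hT w
    have h0 : ∀ x : Fin n → F, dqiAmplitude T w x = 0 := fun x => congrFun hw x
    simp only [h0, norm_zero, ne_eq, OfNat.ofNat_ne_zero, not_false_eq_true, zero_pow,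
      Finset.sum_const_zero] at h
    funext k
    have := (Finset.sum_eq_zero_iff_of_nonneg fun k _ => sq_nonneg ‖w k‖).1 h.symm k (Finset.mem_univ _)
    simpa using this
  -- Injectivity of `Φ` is the isometry property. Both maps start from a space of dimension `ℓ + 1`,
  -- so the range of `E` is no larger than that of `Φ`, which it contains.
  have heq : LinearMap.range Φ = LinearMap.range E := by
    refine Submodule.eq_of_le_of_finrank_le hle ?_
    rw [LinearMap.finrank_range_of_inj hinj]
    exact LinearMap.finrank_range_le E
  obtain ⟨w, hw⟩ : (fun x : Fin n → F => P.eval (objective T x : ℂ)) ∈ LinearMap.range Φ :=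
    heq ▸ hE P hP
  have hwx : ∀ x : Fin n → F, dqiAmplitude T w x = P.eval (objective T x : ℂ) :=
    fun x => congrFun hw x
  refine ⟨w, ?_, hwx⟩
  rw [← sum_norm_dqiAmplitude_sq β hm hn hnm hℓ hT w, ← hnorm]
  simp only [hwx]

end EqualSize

end DQI

end

theorem mainTheorem7 :
    ∃ C κ : ℕ, ∀ (p : ℕ) [Fact p.Prime] (F : Type*) [Field F] [Fintype F] [DecidableEq F]
      [Algebra (ZMod p) F] (a : ℕ) (β : Module.Basis (Fin a) (ZMod p) F)
      (m n ℓ : ℕ) (_ : m = Fintype.card F - 1) (_ : 1 ≤ n) (_ : n < m) (_ : 2 * ℓ ≤ n)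
      (T : Fˣ → Finset F) (_ : ∀ y, T y ≠ ∅ ∧ T y ≠ Finset.univ),
      -- for all weights there is an implementation within the gate bounds
      (∀ w : Fin (ℓ + 1) → ℂ, ∑ k, ‖w k‖ ^ 2 = 1 →
        ∃ (A : ℕ) (D : DQI.DQICircuit F p a n A),
          D.Implements β T w ∧
          (∀ y, (D.encode y).length ≤ C * m * Nat.log 2 m ^ κ) ∧
          D.otherGates ≤ C * (m * n) * Nat.log 2 m ^ κ ∧
          D.full.length ≤ C * m ^ 2 * Nat.log 2 m ^ κ) ∧
      -- for target sets of equal size, the prepared states are the states `∑_x P(f(x)) |x⟩`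
      (∀ r : ℕ, (∀ y, (T y).card = r) →
        (∀ w : Fin (ℓ + 1) → ℂ, ∑ k, ‖w k‖ ^ 2 = 1 →
          ∃ P : Polynomial ℂ, P.natDegree ≤ ℓ ∧
            ∀ x : Fin n → F, DQI.dqiAmplitude T w x = P.eval (DQI.objective T x : ℂ)) ∧
        (∀ P : Polynomial ℂ, P.natDegree ≤ ℓ →
          ∑ x : Fin n → F, ‖P.eval (DQI.objective T x : ℂ)‖ ^ 2 = 1 →
          ∃ w : Fin (ℓ + 1) → ℂ, ∑ k, ‖w k‖ ^ 2 = 1 ∧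
            ∀ x : Fin n → F, DQI.dqiAmplitude T w x = P.eval (DQI.objective T x : ℂ))) := by
  -- The decoder dominates the stages outside the encoding gates: `O(m n log m)` field operations of
  -- `O((log m) ^ 3)` gates each.
  refine ⟨12000000, 4, ?_⟩
  intro p _ F _ _ _ _ a β m n ℓ hm hn hnm hℓ T hT
  refine ⟨fun w hw => DQI.exists_implements β hm hn hnm hℓ T hT w hw, fun r hr =>
    ⟨fun w _ => DQI.exists_polynomial_dqiAmplitude hr hT w, fun P hP hnorm =>
      DQI.exists_weights β hm hn hnm hℓ hT hr P hP hnorm⟩⟩
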